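/- Let $\alpha>0$, $1<p\le\infty$, $q>0$, $c>1$, $C\ge 0$, $K_0\ge 0$. For $f:\mathbb R\to\mathbb C$ put $\|f\|_{S^p}=\sup_{u\in\mathbb R}\{\frac1\pi\int_u^{u+\pi}|f(t)|^p\,dt\}^{1/p}$ if $p<\infty$ and $\|f\|_{S^\infty}=\sup_u|f(u)|$. Let $S^p$ be the class of Stepanov almost periodic functions, i.e. of the measurable functions that are limits of trigonometric polynomials $\sum_j b_je^{i\lambda_jt}$ ($\lambda_j\in\mathbb R$) in this norm. For $f\in S^p$ and $\lambda\in\mathbb R$ let $A_\lambda(f)=\lim_{L\to\infty}\frac1L\int_0^Lf(t)e^{-i\lambda t}\,dt$; the $\lambda$ with $A_\lambda(f)\ne0$ are the Fourier exponents of $f$, and $S_\gamma f(x)=\sum_{|\lambda|\le\gamma}A_\lambda(f)e^{i\lambda x}$. Let $\Omega_{\alpha,p}$ be the set of bounded $f\in S^p$ such that $|\lambda'|-|\lambda|\ge\alpha$ for any two Fourier exponents of $f$ with $0<|\lambda|<|\lambda'|$. Let $x\in\mathbb R$, and let $w_x:[0,\infty)\to\mathbb R$ be continuous, nondecreasing and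 subadditive with $w_x(0)=0$. Put $\varphi_x(t)=f(x+t)+f(x-t)-2f(x)$, and let $f\in\Omega_{\alpha,p}(w_x)$ with constant $C$, i.e. $f\in\Omega_{\alpha,p}$ and for all $\gamma,\delta>0$ $$\Big\{\frac1\delta\int_0^\delta|\varphi_x(t)-\varphi_x(t\pm\gamma)|^p\,dt\Big\}^{1/p}\le C\,w_x(\gamma),\qquad \Big\{\frac1\delta\int_0^\delta|\varphi_x(t)|^p\,dt\Big\}^{1/p}\le C\,w_x(\delta)$$ (for both signs; essential suprema over $(0,\delta]$ if $p=\infty$). Let $E_\sigma(f)_{S^p}=\inf_g\|f-g\|_{S^p}$, where $g$ runs over the entire functions of exponential type at most $\sigma$ that are bounded on the real axis. Let $(a_{n,k})_{n,k\ge0}$ be a matrix of nonnegative real numbers with $\sum_{k=0}^\infty a_{n,k}=1$ for all $n$ and $\lim_{n\to\infty}a_{n,0}=0$, whose rows belong to $GM({}_2\beta)$ uniformly, i.e. for all $n$ and all $m$ with $\lfloor m/c\rfloor\ge1$ $$\sum_{k=m}^{2m-1}|a_{n,k}-a_{n,k+1}|\le K_0\sum_{k=\lfloor m/c\rfloor}^{\lfloor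 cm\rfloor}\frac{a_{n,k}}{k}.$$ Then there is a constant $K$ depending only on $\alpha,p,q,c,C,K_0$ such that for all $n=0,1,2,\dots$ $$\Big\{\sum_{k=0}^\infty a_{n,k}\big|S_{\alpha k/2}f(x)-f(x)\big|^q\Big\}^{1/q}\le K\Big\{\sum_{k=0}^\infty a_{n,k}\Big[w_x\Big(\frac{\pi}{k+1}\Big)+E_{\alpha k/2^{1+c}}(f)_{S^p}\Big]^q\Big\}^{1/q}.$$ -/

import Mathlib

open Filter Topology MeasureTheory
open scoped NNReal ENNReal

noncomputable section

namespace StrongApprox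

/-- The normalised `L^p` mean `{(b-a)⁻¹ ∫_a^b |g|^p}^{1/p}` of `g` over `(a, b]`
(the essential supremum of `|g|` over `(a, b]` when `p = ∞`). -/
def intervalMean (p : ℝ≥0∞) (a b : ℝ) (g : ℝ → ℂ) : ℝ≥0∞ :=
  eLpNorm g p (ENNReal.ofReal (1 / (b - a)) • volume.restrict (Set.Ioc a b))

/-- The Stepanov norm: `sup_u {π⁻¹ ∫_u^{u+π} |f|^p}^{1/p}` for `p < ∞` and `sup_u |f u|` for
`p = ∞`. -/
def stepanovNorm (p : ℝ≥0∞) (f : ℝ → ℂ) : ℝ≥0∞ :=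
  if p = ∞ then ⨆ u : ℝ, ‖f u‖ₑ else ⨆ u : ℝ, intervalMean p u (u + Real.pi) f

/-- The trigonometric polynomial `∑_{l ∈ s} b_l e^{i l t}` with arbitrary real frequencies. -/
def trigPoly (s : Finset ℝ) (b : ℝ → ℂ) (t : ℝ) : ℂ :=
  ∑ l ∈ s, b l * Complex.exp (Complex.I * l * t)

/-- The class `S^p` of Stepanov almost periodic functions: the measurable functions that are
limits of trigonometric polynomials in the Stepanov norm. For `p = ∞` these are the uniformly
(Bohr) almost periodic functions. -/
structure IsStepanovAP (p : ℝ≥0∞) (f : ℝ → ℂ) : Prop where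
  aestronglyMeasurable : AEStronglyMeasurable f volume
  approx : ∀ ε : ℝ≥0∞, 0 < ε → ∃ (s : Finset ℝ) (b : ℝ → ℂ),
    stepanovNorm p (fun t => f t - trigPoly s b t) < ε

/-- The Fourier coefficient `lim_{L → ∞} L⁻¹ ∫_0^L f(t) e^{-i l t} dt` of `f` at the frequency
`l`. The limit exists for every Stepanov almost periodic function. -/
def fourierCoef (f : ℝ → ℂ) (l : ℝ) : ℂ :=
  limUnder atTop
    (fun L : ℝ => (1 / (L : ℂ)) * ∫ t in (0 : ℝ)..L, f t * Complex.exp (-(Complex.I * l * t)))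

/-- The partial sum `∑_{|l| ≤ γ} A_l(f) e^{i l x}` of the Fourier series of `f`. Only the
frequencies with a nonzero coefficient contribute; in the class `Omega` below there are finitely
many of them in `[-γ, γ]`. -/
def partialSum (f : ℝ → ℂ) (γ x : ℝ) : ℂ :=
  ∑ᶠ (l : ℝ) (_ : |l| ≤ γ), fourierCoef f l * Complex.exp (Complex.I * l * x)

/-- The class `Ω_{α,p}`: bounded functions of class `S^p` such that any two different positive
numbers among the absolute values of the Fourier exponents are at distance at least `α`. -/
structure Omega (α : ℝ) (p : ℝ≥0∞) (f : ℝ → ℂ) : Prop where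
  stepanov : IsStepanovAP p f
  bounded : ∃ M : ℝ, ∀ t : ℝ, ‖f t‖ ≤ M
  gap : ∀ l l' : ℝ, fourierCoef f l ≠ 0 → fourierCoef f l' ≠ 0 →
    0 < |l| → |l| < |l'| → α ≤ |l'| - |l|

/-- `φ_x(t) = f(x+t) + f(x-t) - 2 f(x)`. -/
def phi (f : ℝ → ℂ) (x t : ℝ) : ℂ := f (x + t) + f (x - t) - 2 * f x

/-- A function of modulus of continuity type on `[0, ∞)`. -/
structure IsModulus (w : ℝ → ℝ) : Prop where
  continuousOn : ContinuousOn w (Set.Ici 0)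
  monotoneOn : MonotoneOn w (Set.Ici 0)
  map_zero : w 0 = 0
  subadd : ∀ d₁ d₂ : ℝ, 0 ≤ d₁ → 0 ≤ d₂ → w (d₁ + d₂) ≤ w d₁ + w d₂

/-- The class `Ω_{α,p}(w_x)`, where `C` is the constant implied in the `≪` of its three
conditions. -/
structure OmegaW (α : ℝ) (p : ℝ≥0∞) (x : ℝ) (w : ℝ → ℝ) (C : ℝ≥0) (f : ℝ → ℂ) : Prop where
  omega : Omega α p f
  shift_add : ∀ γ δ : ℝ, 0 < γ → 0 < δ →
    intervalMean p 0 δ (fun t => phi f x t - phi f x (t + γ)) ≤ C * ENNReal.ofReal (w γ)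
  shift_sub : ∀ γ δ : ℝ, 0 < γ → 0 < δ →
    intervalMean p 0 δ (fun t => phi f x t - phi f x (t - γ)) ≤ C * ENNReal.ofReal (w γ)
  modulus : ∀ δ : ℝ, 0 < δ → intervalMean p 0 δ (phi f x) ≤ C * ENNReal.ofReal (w δ)

/-- The class `B_σ`: entire functions of exponential type (at most) `σ`, bounded on the real
axis. -/
structure IsExpTypeBounded (σ : ℝ) (g : ℂ → ℂ) : Prop where
  entire : Differentiable ℂ g
  expType : ∀ ε : ℝ, 0 < ε → ∃ M : ℝ, ∀ z : ℂ, ‖g z‖ ≤ M * Real.exp ((σ + ε) * ‖z‖)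
  bounded : ∃ M : ℝ, ∀ t : ℝ, ‖g t‖ ≤ M

/-- The best approximation `E_σ(f)_{S^p} = inf_{g ∈ B_σ} ‖f - g‖_{S^p}`. -/
def bestApprox (p : ℝ≥0∞) (σ : ℝ) (f : ℝ → ℂ) : ℝ≥0∞ :=
  ⨅ (g : ℂ → ℂ) (_ : IsExpTypeBounded σ g), stepanovNorm p (fun t : ℝ => f t - g t)

/-- The sequence `a` belongs to `GM(₂β)` with the parameter `c` and the constant `K`. The
inequality is required only for those `m` for which all the quotients `|a_k| / k` on the right
have `k ≥ 1`. -/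
def IsGM (c : ℝ) (K : ℝ≥0) (a : ℕ → ℝ) : Prop :=
  ∀ m : ℕ, 1 ≤ ⌊(m : ℝ) / c⌋₊ →
    ∑ k ∈ Finset.Ico m (2 * m), |a k - a (k + 1)| ≤
      K * ∑ k ∈ Finset.Icc ⌊(m : ℝ) / c⌋₊ ⌊c * (m : ℝ)⌋₊, |a k| / (k : ℝ)

/-- The strong mean `{∑_k a_k |S_{γ_k} f(x) - f(x)|^q}^{1/q}` for one row `a` of the matrix,
as a value in `[0, ∞]`. -/
def strongMean (q : ℝ) (a : ℕ → ℝ) (γ : ℕ → ℝ) (f : ℝ → ℂ) (x : ℝ) : ℝ≥0∞ :=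
  (∑' k : ℕ, ENNReal.ofReal (a k) * ‖partialSum f (γ k) x - f x‖ₑ ^ q) ^ (1 / q)

end StrongApprox

end

open Filter Topology MeasureTheory
open scoped NNReal ENNReal

noncomputable section

namespace StrongApprox

/-! For `k ≥ 1` the deviation `S_{αk/2} f(x) - f(x)` is controlled, in the mean over blocks `m ≤ k <
2m`, by `w_x` alone. The best approximation is needed only at `k = 0`, where the type is `0` and the
approximating functions are constants (`IsExpTypeBounded.eq_const`).

Representation. The amplitude `sinc(εt)² / t` has a sine transform equal to `π/2` at every frequency
from `2ε` on (`integral_sin_mul_kerK`, a contour integral). Convolution with it, modulated by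
`sin(ρt)`, therefore multiplies `e^{ilx}` by `1` if `|l| ≤ ρ - 2ε` and by `0` if `|l| ≥ ρ + 2ε`. For
`ε = α/8` the transition zone has width `α/2`. By the gap condition the zone just above `αk/2` or
the one just below it is free of exponents, so one of `ρ = αk/2 ± α/4` separates them. The
uniqueness theorem for almost periodic functions then identifies the convolution with the partial
sum (`kerConv_eq_partialSum`), and the deviation becomes a singular integral of `φ_x` against
`sin(ρt) sinc(εt)² / t`.

Block estimate. At a scale `γ` comparable to `1/m` all phases satisfy `|1 - e^{iργ}| ≥ 1`, so an
oscillating integral may be replaced by that of a difference with step `γ`. Two such passages leave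
`O(w_x(γ))` and the integrals of `φ_x(t) - φ_x(t+γ)` (`ShiftBound.norm_integral_le`). The
frequencies of a block lie on a few arithmetic progressions, so a Hausdorff-Young inequality with a
loss in the exponent (`exists_lqNorm_integral_expi_le`), applied on the intervals `(2^j γ, 2^{j+1}
γ]`, bounds the `ℓ^Q` norm of these by a constant times `m^{1/Q} w_x(γ)` for all large `Q`. This is
where `p > 1` is used. Smaller exponents `q` follow by comparing powers.

Summation. Condition `IsGM` bounds each weight in a block by the mean of the weights of comparable
index (`IsGM.mul_le_sum`). Averaging the block estimates over `m` with weights `1/m`, and comparing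
values of `w_x` at comparable arguments by subadditivity, gives the result (`IsGM.sum_mul_le`). -/

/-! ### Oscillating integrals -/

/-- The exponential `t ↦ e^{i l t}`. -/
def expi (l t : ℝ) : ℂ := Complex.exp (Complex.I * l * t)

lemma expi_eq (l t : ℝ) : expi l t = Complex.exp (((l * t : ℝ) : ℂ) * Complex.I) := by
  simp only [expi]; push_cast; ring_nf

@[simp] lemma norm_expi (l t : ℝ) : ‖expi l t‖ = 1 := by
  rw [expi_eq, Complex.norm_exp_ofReal_mul_I]

lemma expi_add_left (l l' t : ℝ) : expi (l + l') t = expi l t * expi l' t := by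
  simp only [expi, ← Complex.exp_add]; push_cast; ring_nf

lemma expi_add_right (l t s : ℝ) : expi l (t + s) = expi l t * expi l s := by
  simp only [expi, ← Complex.exp_add]; push_cast; ring_nf

@[fun_prop] lemma continuous_expi (l : ℝ) : Continuous (expi l) := by
  unfold expi; fun_prop

@[simp] lemma expi_zero_left (t : ℝ) : expi 0 t = 1 := by simp [expi]

@[simp] lemma expi_zero_right (t : ℝ) : expi t 0 = 1 := by simp [expi]

/-- The `ℓ^Q` norm of a family of complex numbers over a finite set. -/
def lqNorm {ι : Type*} (Q : ℕ) (S : Finset ι) (c : ι → ℂ) : ℝ :=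
  (∑ k ∈ S, ‖c k‖ ^ Q) ^ (1 / (Q : ℝ))

section lq
variable {ι : Type*} {Q : ℕ} {S : Finset ι}

lemma lqNorm_le_iff (hQ : 1 ≤ Q) {c : ι → ℂ} {X : ℝ} (hX : 0 ≤ X) :
    lqNorm Q S c ≤ X ↔ ∑ k ∈ S, ‖c k‖ ^ Q ≤ X ^ Q := by
  have hQ0 : (0 : ℝ) < Q := by exact_mod_cast hQ
  unfold lqNorm
  rw [one_div, Real.rpow_inv_le_iff_of_pos (by positivity) hX hQ0, Real.rpow_natCast]

lemma lqNorm_add_le (hQ : 1 ≤ Q) (c d : ι → ℂ) :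
    lqNorm Q S (fun k => c k + d k) ≤ lqNorm Q S c + lqNorm Q S d := by
  have h := Real.Lp_add_le S (fun k => ‖c k‖) (fun k => ‖d k‖) (p := Q) (by exact_mod_cast hQ)
  simp only [Real.rpow_natCast, abs_norm] at h
  refine le_trans ?_ h
  unfold lqNorm
  gcongr with k hk
  rw [abs_of_nonneg (by positivity)]
  exact norm_add_le _ _

lemma lqNorm_sum_le (hQ : 1 ≤ Q) (c : ℕ → ι → ℂ) (n : ℕ) :
    lqNorm Q S (fun k => ∑ i ∈ Finset.range n, c i k) ≤
      ∑ i ∈ Finset.range n, lqNorm Q S (c i) := by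
  induction n with
  | zero => simp [lqNorm, show Q ≠ 0 by omega]
  | succ n ih =>
    simp only [Finset.sum_range_succ]
    exact (lqNorm_add_le hQ _ _).trans (by gcongr)

end lq

/-- Bessel's inequality for equidistant frequencies on an interval of arbitrary length. -/
lemma sum_sq_norm_integral_expi_le {ι : Type*} {β : ℝ} (hβ : 0 < β) {a l : ℝ} (hl : 0 < l)
    {u : ℝ → ℂ} (hu : MemLp u 2 (volume.restrict (Set.Ioc a (a + l)))) (θ : ℝ) (S : Finset ι)
    {κ : ι → ℤ} (hκ : Function.Injective κ) :
    ∑ k ∈ S, ‖∫ t in Set.Ioc a (a + l), u t * expi (β * κ k + θ) t‖ ^ 2 ≤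
      (l + 2 * Real.pi / β) * ∫ t in Set.Ioc a (a + l), ‖u t‖ ^ 2 := by
  set T := 2 * Real.pi / β with hT
  have hTpos : 0 < T := by positivity
  -- Rounding the length up to a multiple `L = n T` of `2π/β` puts the frequencies `β κ` on the
  -- Fourier lattice of an interval of length `L`. There `u`, extended by zero, has them as ordinary
  -- Fourier frequencies, and the rounding costs at most one `T`.
  set n := ⌈l / T⌉₊ with hn
  have hnpos : 0 < n := Nat.ceil_pos.2 (by positivity)
  have hn0 : (0 : ℝ) < n := by exact_mod_cast hnpos
  set L := (n : ℝ) * T with hL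
  have hLpos : 0 < L := by positivity
  have hlL : l ≤ L := by
    have := Nat.le_ceil (l / T)
    rwa [div_le_iff₀ hTpos] at this
  have hLl : L ≤ l + T := by
    have := (Nat.ceil_lt_add_one (show 0 ≤ l / T by positivity)).le
    calc L ≤ (l / T + 1) * T := mul_le_mul_of_nonneg_right this hTpos.le
      _ = l + T := by field_simp
  set I := Set.Ioc a (a + l) with hI
  have hIm : MeasurableSet I := measurableSet_Ioc
  have hsub : I ⊆ Set.Ioc a (a + L) := Set.Ioc_subset_Ioc_right (by linarith)
  set v : ℝ → ℂ := I.indicator (fun t => u t * expi θ t) with hv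
  have hv2 : MemLp v 2 (volume.restrict (Set.Ioc a (a + L))) := by
    have h1 : MemLp (fun t => u t * expi θ t) 2 (volume.restrict I) := by
      refine hu.of_le (hu.1.mul (continuous_expi θ).aestronglyMeasurable) (Eventually.of_forall ?_)
      intro t; simp
    rw [hv, memLp_indicator_iff_restrict hIm, Measure.restrict_restrict hIm,
      Set.inter_eq_left.2 hsub]
    exact h1
  have hab : a < a + L := by linarith
  have hsum := hasSum_sq_fourierCoeffOn hab hv2
  have hcoef : ∀ k, fourierCoeffOn hab v (-(n * κ k)) =
      (L : ℂ)⁻¹ * ∫ t in I, u t * expi (β * κ k + θ) t := by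
    intro k
    rw [fourierCoeffOn_eq_integral, intervalIntegral.integral_of_le hab.le]
    have : ∀ t : ℝ, (fourier (-(-((n : ℤ) * κ k))) (t : AddCircle (a + L - a)) : ℂ) • v t =
        I.indicator (fun t => u t * expi (β * κ k + θ) t) t := by
      intro t
      by_cases ht : t ∈ I
      · rw [hv, Set.indicator_of_mem ht, Set.indicator_of_mem ht, fourier_coe_apply, smul_eq_mul,
          expi_add_left]
        have : Complex.exp (2 * Real.pi * Complex.I * ((-(-((n : ℤ) * κ k)) : ℤ) : ℂ) * t /
            ((a + L - a : ℝ) : ℂ)) = expi (β * κ k) t := by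
          rw [expi, hL, hT]
          congr 1
          have : (n : ℂ) ≠ 0 := by exact_mod_cast hnpos.ne'
          have hpi : (Real.pi : ℂ) ≠ 0 := by exact_mod_cast Real.pi_ne_zero
          have hb : (β : ℂ) ≠ 0 := by exact_mod_cast hβ.ne'
          push_cast
          rw [add_sub_cancel_left]
          field_simp
        rw [this]; ring
      · rw [hv, Set.indicator_of_notMem ht, Set.indicator_of_notMem ht, smul_zero]
    simp only [this]
    rw [setIntegral_indicator hIm, Set.inter_eq_right.2 hsub]
    simp only [add_sub_cancel_left, one_div, Complex.real_smul]
    push_cast; rfl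
  have hintg : ∫ t in a..(a + L), ‖v t‖ ^ 2 = ∫ t in I, ‖u t‖ ^ 2 := by
    rw [intervalIntegral.integral_of_le hab.le]
    have : ∀ t, ‖v t‖ ^ 2 = I.indicator (fun t => ‖u t‖ ^ 2) t := by
      intro t
      by_cases ht : t ∈ I
      · simp [hv, Set.indicator_of_mem ht]
      · simp [hv, Set.indicator_of_notMem ht]
    simp only [this]
    rw [setIntegral_indicator hIm, Set.inter_eq_right.2 hsub]
  rw [hintg] at hsum
  have hinj : Function.Injective (fun k : ι => -((n : ℤ) * κ k)) := by
    intro x y hxy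
    apply hκ
    have : (n : ℤ) ≠ 0 := by exact_mod_cast hnpos.ne'
    simpa [hnpos.ne'] using hxy
  have hle := sum_le_hasSum (S.map ⟨_, hinj⟩) (fun i _ => by positivity) hsum
  rw [Finset.sum_map] at hle
  simp only [Function.Embedding.coeFn_mk, hcoef, norm_mul, norm_inv, Complex.norm_real,
    Real.norm_of_nonneg hLpos.le, mul_pow, ← Finset.mul_sum, add_sub_cancel_left, smul_eq_mul] at hle
  have h0 : 0 ≤ ∫ t in I, ‖u t‖ ^ 2 := integral_nonneg fun _ => by positivity
  have : ∑ k ∈ S, ‖∫ t in I, u t * expi (β * κ k + θ) t‖ ^ 2 ≤ L * ∫ t in I, ‖u t‖ ^ 2 := by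
    calc _ = L ^ 2 * (L⁻¹ ^ 2 * ∑ k ∈ S, ‖∫ t in I, u t * expi (β * κ k + θ) t‖ ^ 2) := by
          field_simp
      _ ≤ L ^ 2 * (L⁻¹ * ∫ t in I, ‖u t‖ ^ 2) := by gcongr
      _ = _ := by field_simp
  exact this.trans (by gcongr)

/-- Interpolation between two endpoints: each integral is at most `V`, which disposes of `Q - 2`
factors, and Bessel's inequality with `∫ ‖u‖² ≤ M V` disposes of the remaining two. -/
lemma sum_pow_norm_integral_expi_le_of_bound {ι : Type*} {β : ℝ} (hβ : 0 < β) {a l : ℝ}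
    (hl : 0 < l) {u : ℝ → ℂ} (hu : AEStronglyMeasurable u (volume.restrict (Set.Ioc a (a + l))))
    {M V : ℝ} (hM : ∀ t, ‖u t‖ ≤ M) (hV : ∫ t in Set.Ioc a (a + l), ‖u t‖ ≤ V) (θ : ℝ)
    (S : Finset ι) {κ : ι → ℤ} (hκ : Function.Injective κ) {Q : ℕ} (hQ : 2 ≤ Q) :
    ∑ k ∈ S, ‖∫ t in Set.Ioc a (a + l), u t * expi (β * κ k + θ) t‖ ^ Q ≤
      (l + 2 * Real.pi / β) * M * V ^ (Q - 1) := by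
  set I := Set.Ioc a (a + l) with hI
  have hM0 : 0 ≤ M := (norm_nonneg _).trans (hM 0)
  have hu1 : IntegrableOn u I := by
    exact Integrable.of_bound hu M (Eventually.of_forall hM)
  have hu2 : MemLp u 2 (volume.restrict I) :=
    MemLp.of_bound hu M (Eventually.of_forall hM)
  have hb := sum_sq_norm_integral_expi_le hβ hl hu2 θ S hκ
  have hV0 : 0 ≤ V := (integral_nonneg fun _ => norm_nonneg _).trans hV
  have hc : ∀ k, ‖∫ t in I, u t * expi (β * κ k + θ) t‖ ≤ V := by
    intro k
    refine (norm_integral_le_integral_norm _).trans ?_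
    simpa using hV
  have h2 : ∫ t in I, ‖u t‖ ^ 2 ≤ M * V := by
    calc ∫ t in I, ‖u t‖ ^ 2 ≤ ∫ t in I, M * ‖u t‖ := by
          refine integral_mono_of_nonneg (Eventually.of_forall fun _ => by positivity)
            (hu1.norm.const_mul M) (Eventually.of_forall fun t => ?_)
          simp only [sq]; gcongr; exact hM t
      _ = M * ∫ t in I, ‖u t‖ := integral_const_mul _ _
      _ ≤ M * V := by gcongr
  have hT : 0 < 2 * Real.pi / β := by positivity
  obtain ⟨N, rfl⟩ : ∃ N, Q = N + 2 := ⟨Q - 2, by omega⟩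
  calc _ = ∑ k ∈ S, ‖∫ t in I, u t * expi (β * κ k + θ) t‖ ^ N *
        ‖∫ t in I, u t * expi (β * κ k + θ) t‖ ^ 2 := by simp only [pow_add]
    _ ≤ ∑ k ∈ S, V ^ N * ‖∫ t in I, u t * expi (β * κ k + θ) t‖ ^ 2 := by
        gcongr with k hk; exact hc k
    _ = V ^ N * ∑ k ∈ S, ‖∫ t in I, u t * expi (β * κ k + θ) t‖ ^ 2 := by rw [Finset.mul_sum]
    _ ≤ V ^ N * ((l + 2 * Real.pi / β) * (M * V)) := by gcongr; exact hb.trans (by gcongr)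
    _ = _ := by rw [show N + 2 - 1 = N + 1 by omega]; ring

/-! ### Truncation layers and a Hausdorff-Young inequality with loss -/

/-- Truncation of a complex number at height `h`. -/
def trunc (h : ℝ) (z : ℂ) : ℂ := if ‖z‖ ≤ h then z else 0

lemma measurable_trunc (h : ℝ) : Measurable (trunc h) :=
  Measurable.ite (measurableSet_le measurable_norm measurable_const) measurable_id measurable_const

lemma norm_trunc_le {h : ℝ} (hh : 0 ≤ h) (z : ℂ) : ‖trunc h z‖ ≤ h := by
  unfold trunc; split_ifs <;> simp_all

lemma norm_trunc_le_norm (h : ℝ) (z : ℂ) : ‖trunc h z‖ ≤ ‖z‖ := by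
  unfold trunc; split_ifs <;> simp

lemma norm_trunc_sub_trunc_le {h h' : ℝ} (hh : 0 ≤ h) (hh' : h ≤ h') (z : ℂ) :
    ‖trunc h' z - trunc h z‖ ≤ h' := by
  unfold trunc; split_ifs <;> simp_all <;> linarith

/-- A layer lives where `‖z‖ > h`, and there `‖z‖^(1-r) ≤ h^(1-r)`. An `L^r` bound thus makes the
`L¹` norm of high layers small. -/
lemma norm_trunc_sub_trunc_le_rpow {h h' r : ℝ} (hh : 0 < h) (hh' : h ≤ h') (hr : 1 ≤ r) (z : ℂ) :
    ‖trunc h' z - trunc h z‖ ≤ h ^ (1 - r) * ‖z‖ ^ r := by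
  by_cases hz : ‖z‖ ≤ h
  · simp only [trunc, hz, hz.trans hh', if_true, sub_self, norm_zero]; positivity
  · have hz' : h < ‖z‖ := not_le.1 hz
    have hz0 : 0 < ‖z‖ := hh.trans hz'
    have h1 : ‖trunc h' z - trunc h z‖ ≤ ‖z‖ := by
      simp only [trunc, hz, if_false, sub_zero]; split_ifs <;> simp
    refine h1.trans ?_
    calc ‖z‖ = ‖z‖ ^ (1 - r) * ‖z‖ ^ r := by rw [← Real.rpow_add hz0]; simp
      _ ≤ h ^ (1 - r) * ‖z‖ ^ r := by
        gcongr ?_ * _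
        exact Real.rpow_le_rpow_of_nonpos hh hz'.le (by linarith)

/-- A Hausdorff-Young type inequality on an interval, with a loss in the exponent. -/
theorem exists_lqNorm_integral_expi_le {β r : ℝ} (hβ : 0 < β) (hr : 1 < r) {Q : ℕ} (hQ : 2 ≤ Q)
    (hrQ : 1 < (r - 1) * ((Q : ℝ) - 1)) :
    ∃ A : ℝ, 0 ≤ A ∧ ∀ (ι : Type) (S : Finset ι) (κ : ι → ℤ), Function.Injective κ →
      ∀ (a l θ U M : ℝ) (u : ℝ → ℂ), 0 < l → 0 ≤ U →
      AEStronglyMeasurable u (volume.restrict (Set.Ioc a (a + l))) → (∀ t, ‖u t‖ ≤ M) →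
      ∫ t in Set.Ioc a (a + l), ‖u t‖ ^ r ≤ l * U ^ r →
      lqNorm Q S (fun k => ∫ t in Set.Ioc a (a + l), u t * expi (β * κ k + θ) t) ≤
        A * U * (l ^ (Q - 1) * (l + 2 * Real.pi / β)) ^ (1 / (Q : ℝ)) := by
  -- Ratio of the `Q`-th power bounds of consecutive layers: the doubled height contributes `2`, the
  -- smaller `L¹` norm contributes `2^(1-r)` to the power `Q - 1`. By `hrQ` it is below `1`; the
  -- Hausdorff-Young exponent, with `(r-1)(Q-1) = 1`, is the excluded endpoint.
  set η : ℝ := 2 ^ (1 - (r - 1) * ((Q : ℝ) - 1)) with hη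
  have hη0 : 0 < η := by positivity
  have hη1 : η < 1 := Real.rpow_lt_one_of_one_lt_of_neg (by norm_num) (by linarith)
  have hQ0 : (0 : ℝ) < Q := by exact_mod_cast (by omega : 0 < Q)
  set ζ : ℝ := η ^ (1 / (Q : ℝ)) with hζ
  have hζ0 : 0 < ζ := by positivity
  have hζ1 : ζ < 1 := Real.rpow_lt_one hη0.le hη1 (by positivity)
  refine ⟨1 + 2 * (1 - ζ)⁻¹, ?_, ?_⟩
  · have := inv_nonneg.2 (sub_nonneg.2 hζ1.le); positivity
  intro ι S κ hκ a l θ U M u hl hU hu hM hintg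
  set I := Set.Ioc a (a + l) with hI
  set T := 2 * Real.pi / β with hT
  have hTpos : 0 < T := by positivity
  have hZ : 0 < 1 - ζ := by linarith
  have hM0 : 0 ≤ M := (norm_nonneg _).trans (hM 0)
  have hur : IntegrableOn (fun t => ‖u t‖ ^ r) I := by
    refine Integrable.of_bound ?_ (M ^ r) (Eventually.of_forall fun t => ?_)
    · exact (hu.norm.aemeasurable.pow_const r).aestronglyMeasurable
    · rw [Real.norm_of_nonneg (by positivity)]
      exact Real.rpow_le_rpow (norm_nonneg _) (hM t) (by linarith)
  rcases hU.eq_or_lt with rfl | hUpos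
  · have h0 : ∫ t in I, ‖u t‖ ^ r = 0 := by
      refine le_antisymm ?_ (integral_nonneg fun _ => by positivity)
      simpa [Real.zero_rpow (by linarith : r ≠ 0)] using hintg
    have hae := (integral_eq_zero_iff_of_nonneg (fun _ => by positivity) hur).1 h0
    have hae' : ∀ᵐ t ∂(volume.restrict I), u t = 0 := by
      filter_upwards [hae] with t ht
      have := (Real.rpow_eq_zero (norm_nonneg (u t)) (by linarith)).1 ht
      simpa using this
    have : ∀ k, ∫ t in I, u t * expi (β * κ k + θ) t = 0 := by
      intro k
      refine integral_eq_zero_of_ae ?_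
      filter_upwards [hae'] with t ht
      simp [ht]
    simp only [this]
    simp [lqNorm, show Q ≠ 0 by omega]
  -- the layers
  have hcomp : ∀ {g : ℂ → ℂ}, Measurable g →
      AEStronglyMeasurable (fun t => g (u t)) (volume.restrict I) := fun hg =>
    (hg.comp_aemeasurable hu.aemeasurable).aestronglyMeasurable
  set Y := l ^ (Q - 1) * (l + T) with hY
  have hY0 : 0 < Y := by positivity
  set J : (ℂ → ℂ) → ι → ℂ := fun g k => ∫ t in I, g (u t) * expi (β * κ k + θ) t with hJ
  have hroot : ∀ {X : ℝ} {g : ℂ → ℂ}, 0 ≤ X → ∑ k ∈ S, ‖J g k‖ ^ Q ≤ X →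
      lqNorm Q S (J g) ≤ X ^ (1 / (Q : ℝ)) := by
    intro X g hX h
    unfold lqNorm
    gcongr
  have hbase : lqNorm Q S (J (trunc U)) ≤ U * Y ^ (1 / (Q : ℝ)) := by
    have h1 : ∫ t in I, ‖trunc U (u t)‖ ≤ U * l := by
      calc ∫ t in I, ‖trunc U (u t)‖ ≤ ∫ t in I, U := by
            refine integral_mono_of_nonneg (Eventually.of_forall fun _ => norm_nonneg _)
              (integrable_const _) (Eventually.of_forall fun t => norm_trunc_le hU _)
        _ = U * l := by simp [hI, hl.le, mul_comm]
    have h2 := sum_pow_norm_integral_expi_le_of_bound hβ hl (hcomp (measurable_trunc U))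
      (fun t => norm_trunc_le hU (u t)) h1 θ S hκ hQ
    have h3 : (l + T) * U * (U * l) ^ (Q - 1) = U ^ Q * Y := by
      rw [hY, mul_pow]
      obtain ⟨N, rfl⟩ : ∃ N, Q = N + 1 := ⟨Q - 1, by omega⟩
      simp only [Nat.add_sub_cancel]; ring
    rw [h3] at h2
    refine (hroot (by positivity) h2).trans_eq ?_
    rw [Real.mul_rpow (by positivity) hY0.le, ← Real.rpow_natCast, ← Real.rpow_mul hU,
      mul_one_div_cancel hQ0.ne', Real.rpow_one]
  have hlayer : ∀ i : ℕ, lqNorm Q S (J (fun z => trunc (2 ^ (i + 1) * U) z - trunc (2 ^ i * U) z))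
      ≤ 2 * U * Y ^ (1 / (Q : ℝ)) * ζ ^ i := by
    intro i
    have hh : 0 < (2 : ℝ) ^ i * U := by positivity
    have hh' : (2 : ℝ) ^ i * U ≤ 2 ^ (i + 1) * U := by rw [pow_succ]; nlinarith
    have hmeas : Measurable (fun z => trunc (2 ^ (i + 1) * U) z - trunc (2 ^ i * U) z) :=
      (measurable_trunc _).sub (measurable_trunc _)
    have h1 : ∫ t in I, ‖trunc (2 ^ (i + 1) * U) (u t) - trunc (2 ^ i * U) (u t)‖ ≤
        ((2 : ℝ) ^ i) ^ (1 - r) * U * l := by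
      calc _ ≤ ∫ t in I, (2 ^ i * U) ^ (1 - r) * ‖u t‖ ^ r := by
            refine integral_mono_of_nonneg (Eventually.of_forall fun _ => norm_nonneg _)
              (hur.const_mul _) (Eventually.of_forall fun t =>
                norm_trunc_sub_trunc_le_rpow hh hh' hr.le _)
        _ = (2 ^ i * U) ^ (1 - r) * ∫ t in I, ‖u t‖ ^ r := integral_const_mul _ _
        _ ≤ (2 ^ i * U) ^ (1 - r) * (l * U ^ r) := by gcongr
        _ = ((2 : ℝ) ^ i) ^ (1 - r) * (U ^ (1 - r) * U ^ r) * l := by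
            rw [Real.mul_rpow (by positivity) hU]; ring
        _ = _ := by rw [← Real.rpow_add hUpos]; simp
    have h2 := sum_pow_norm_integral_expi_le_of_bound hβ hl (hcomp hmeas)
      (fun t => norm_trunc_sub_trunc_le hh.le hh' (u t)) h1 θ S hκ hQ
    have h3 : (l + T) * (2 ^ (i + 1) * U) * (((2 : ℝ) ^ i) ^ (1 - r) * U * l) ^ (Q - 1) =
        2 * (U ^ Q * Y) * η ^ i := by
      have hQ1 : ((Q - 1 : ℕ) : ℝ) = (Q : ℝ) - 1 := by
        rw [Nat.cast_sub (by omega)]; simp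
      have e1 : η ^ i = 2 ^ i * (((2 : ℝ) ^ i) ^ (1 - r)) ^ (Q - 1) := by
        rw [hη, ← Real.rpow_natCast, ← Real.rpow_natCast, ← Real.rpow_natCast, hQ1,
          ← Real.rpow_mul (by norm_num), ← Real.rpow_mul (by norm_num),
          ← Real.rpow_mul (by norm_num), ← Real.rpow_add (by norm_num)]
        congr 1; ring
      rw [e1, hY, mul_pow, mul_pow]
      obtain ⟨N, rfl⟩ : ∃ N, Q = N + 1 := ⟨Q - 1, by omega⟩
      simp only [Nat.add_sub_cancel]; ring
    rw [h3] at h2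
    refine (hroot (X := 2 * (U ^ Q * Y) * η ^ i)
      (g := fun z => trunc (2 ^ (i + 1) * U) z - trunc (2 ^ i * U) z) (by positivity) h2).trans ?_
    rw [Real.mul_rpow (by positivity) (by positivity), Real.mul_rpow (by positivity) (by positivity),
      Real.mul_rpow (by positivity) hY0.le, ← Real.rpow_natCast U, ← Real.rpow_mul hU,
      mul_one_div_cancel hQ0.ne', Real.rpow_one]
    have e2 : (η ^ i) ^ (1 / (Q : ℝ)) = ζ ^ i := by
      rw [hζ, ← Real.rpow_natCast, ← Real.rpow_natCast, ← Real.rpow_mul hη0.le,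
        ← Real.rpow_mul hη0.le, mul_comm]
    rw [e2]
    have e3 : (2 : ℝ) ^ (1 / (Q : ℝ)) ≤ 2 := by
      calc (2 : ℝ) ^ (1 / (Q : ℝ)) ≤ 2 ^ (1 : ℝ) := by
            apply Real.rpow_le_rpow_of_exponent_le (by norm_num)
            rw [div_le_one hQ0]; exact_mod_cast (by omega : 1 ≤ Q)
        _ = 2 := by simp
    rw [mul_assoc 2 U]
    gcongr
  -- Boundedness of `u` makes the number of layers finite, and the geometric series keeps the
  -- constant independent of `M`.
  obtain ⟨n, hn⟩ : ∃ n : ℕ, M ≤ 2 ^ n * U := by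
    obtain ⟨n, hn⟩ := pow_unbounded_of_one_lt (M / U) (by norm_num : (1 : ℝ) < 2)
    exact ⟨n, by rw [div_lt_iff₀ hUpos] at hn; exact hn.le⟩
  have hintJ : ∀ {g : ℂ → ℂ}, Measurable g → (∀ z, ‖g z‖ ≤ ‖z‖ + ‖z‖) → ∀ k,
      IntegrableOn (fun t => g (u t) * expi (β * κ k + θ) t) I := by
    intro g hg hgb k
    refine Integrable.of_bound ((hcomp hg).mul (continuous_expi _).aestronglyMeasurable) (M + M)
      (Eventually.of_forall fun t => ?_)
    rw [norm_mul, norm_expi, mul_one]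
    exact (hgb _).trans (add_le_add (hM t) (hM t))
  have hdecomp : (fun k => ∫ t in I, u t * expi (β * κ k + θ) t) = fun k =>
      J (trunc U) k + ∑ i ∈ Finset.range n,
        J (fun z => trunc (2 ^ (i + 1) * U) z - trunc (2 ^ i * U) z) k := by
    funext k
    rw [hJ]
    simp only
    rw [← integral_finsetSum, ← integral_add]
    · refine integral_congr_ae (Eventually.of_forall fun t => ?_)
      simp only
      rw [← Finset.sum_mul, ← add_mul, Finset.sum_range_sub (fun i => trunc (2 ^ i * U) (u t))]
      congr 1
      rw [pow_zero, one_mul, add_sub_cancel, trunc, if_pos ((hM t).trans hn)]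
    · exact hintJ (measurable_trunc U) (fun z => (norm_trunc_le_norm _ z).trans (by simp)) k
    · refine integrable_finsetSum _ fun i _ => ?_
      exact hintJ ((measurable_trunc _).sub (measurable_trunc _)) (fun z => (norm_sub_le _ _).trans
        (add_le_add (norm_trunc_le_norm _ z) (norm_trunc_le_norm _ z))) k
    · intro i _
      exact hintJ ((measurable_trunc _).sub (measurable_trunc _)) (fun z => (norm_sub_le _ _).trans
        (add_le_add (norm_trunc_le_norm _ z) (norm_trunc_le_norm _ z))) k
  rw [hdecomp]
  refine (lqNorm_add_le (by omega) _ _).trans ?_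
  have hgeo : ∑ i ∈ Finset.range n, ζ ^ i ≤ (1 - ζ)⁻¹ := by
    rw [← tsum_geometric_of_lt_one hζ0.le hζ1]
    exact (summable_geometric_of_lt_one hζ0.le hζ1).sum_le_tsum _ (fun _ _ => by positivity)
  calc _ ≤ U * Y ^ (1 / (Q : ℝ)) + ∑ i ∈ Finset.range n, 2 * U * Y ^ (1 / (Q : ℝ)) * ζ ^ i := by
        refine add_le_add hbase ((lqNorm_sum_le (by omega) _ _).trans ?_)
        exact Finset.sum_le_sum fun i _ => hlayer i
    _ = U * Y ^ (1 / (Q : ℝ)) + 2 * U * Y ^ (1 / (Q : ℝ)) * ∑ i ∈ Finset.range n, ζ ^ i := by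
        rw [Finset.mul_sum]
    _ ≤ U * Y ^ (1 / (Q : ℝ)) + 2 * U * Y ^ (1 / (Q : ℝ)) * (1 - ζ)⁻¹ := by gcongr
    _ = _ := by ring

/-! ### The kernel -/

/-- The amplitude of the summation kernel. -/
def kerK (ε t : ℝ) : ℝ := Real.sinc (ε * t) ^ 2 / t

section ker
variable {ε : ℝ}

lemma kerK_eq (hε : 0 < ε) {t : ℝ} (ht : 0 < t) :
    kerK ε t = Real.sin (ε * t) ^ 2 / (ε ^ 2 * t ^ 3) := by
  rw [kerK, Real.sinc_of_ne_zero (by positivity)]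
  field_simp

lemma measurable_kerK : Measurable (kerK ε) := by
  unfold kerK
  exact ((Real.continuous_sinc.measurable.comp (measurable_const.mul measurable_id)).pow_const 2).div
    measurable_id

lemma abs_kerK_le {t : ℝ} (ht : 0 < t) : |kerK ε t| ≤ 1 / t := by
  rw [kerK, abs_div, abs_of_pos ht, abs_pow]
  gcongr
  exact pow_le_one₀ (abs_nonneg _) (Real.abs_sinc_le_one _)

lemma abs_kerK_le' (hε : 0 < ε) {t : ℝ} (ht : 0 < t) : |kerK ε t| ≤ 1 / (ε ^ 2 * t ^ 3) := by
  rw [kerK_eq hε ht, abs_div, abs_of_pos (show 0 < ε ^ 2 * t ^ 3 by positivity), abs_pow]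
  gcongr
  exact pow_le_one₀ (abs_nonneg _) (Real.abs_sin_le_one _)

/-- The zero of the sine cancels `1/t` at the origin, and `sinc²` supplies cubic decay at infinity.
The integrable majorant is what makes every transform and convolution below absolutely convergent.
-/
lemma abs_sin_mul_kerK_le (hε : 0 < ε) (s : ℝ) {t : ℝ} (ht : 0 < t) :
    |Real.sin (s * t) * kerK ε t| ≤ 2 * (|s| + 1 / ε ^ 2) * (1 + t ^ 2)⁻¹ := by
  rw [abs_mul]
  rcases le_total t 1 with h1 | h1
  · have hs : |Real.sin (s * t)| ≤ |s| * t := by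
      refine Real.abs_sin_le_abs.trans ?_
      rw [abs_mul, abs_of_pos ht]
    calc |Real.sin (s * t)| * |kerK ε t| ≤ (|s| * t) * (1 / t) := by
          gcongr; exact abs_kerK_le ht
      _ = |s| := by field_simp
      _ = 2 * |s| * 2⁻¹ := by ring
      _ ≤ 2 * (|s| + 1 / ε ^ 2) * (1 + t ^ 2)⁻¹ := by
          have : 1 + t ^ 2 ≤ 2 := by nlinarith
          gcongr
          have : 0 < 1 / ε ^ 2 := by positivity
          linarith
  · calc |Real.sin (s * t)| * |kerK ε t| ≤ 1 * (1 / (ε ^ 2 * t ^ 3)) := by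
          gcongr
          · exact Real.abs_sin_le_one _
          · exact abs_kerK_le' hε ht
      _ = (1 / ε ^ 2) * (t ^ 3)⁻¹ := by field_simp
      _ = 2 * (1 / ε ^ 2) * (2 * t ^ 3)⁻¹ := by field_simp
      _ ≤ 2 * (|s| + 1 / ε ^ 2) * (1 + t ^ 2)⁻¹ := by
          have : 1 + t ^ 2 ≤ 2 * t ^ 3 := by
            nlinarith [pow_le_pow_right₀ h1 (show 2 ≤ 3 by norm_num), one_le_pow₀ h1 (n := 3)]
          gcongr
          have := abs_nonneg s
          linarith

lemma integrableOn_sin_mul_kerK (hε : 0 < ε) (s : ℝ) :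
    IntegrableOn (fun t => Real.sin (s * t) * kerK ε t) (Set.Ioi 0) := by
  refine Integrable.mono' ((integrable_inv_one_add_sq.const_mul (2 * (|s| + 1 / ε ^ 2))).integrableOn)
    ?_ ?_
  · exact ((Real.measurable_sin.comp (measurable_const.mul measurable_id)).mul
      measurable_kerK).aestronglyMeasurable
  · refine (ae_restrict_iff' measurableSet_Ioi).2 (Eventually.of_forall fun t ht => ?_)
    exact abs_sin_mul_kerK_le hε s ht

/-- The derivative of `kerK`. -/
def kerK' (ε t : ℝ) : ℝ :=
  2 * Real.sin (ε * t) * Real.cos (ε * t) / (ε * t ^ 3) - 3 * Real.sin (ε * t) ^ 2 / (ε ^ 2 * t ^ 4)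

/-- The second derivative of `kerK`. -/
def kerK'' (ε t : ℝ) : ℝ :=
  2 * (Real.cos (ε * t) ^ 2 - Real.sin (ε * t) ^ 2) / t ^ 3 -
    12 * Real.sin (ε * t) * Real.cos (ε * t) / (ε * t ^ 4) +
    12 * Real.sin (ε * t) ^ 2 / (ε ^ 2 * t ^ 5)

lemma hasDerivAt_sin_mul (ε t : ℝ) :
    HasDerivAt (fun t => Real.sin (ε * t)) (ε * Real.cos (ε * t)) t := by
  have := ((hasDerivAt_id' t).const_mul ε).sin
  simpa [mul_comm] using this

lemma hasDerivAt_cos_mul (ε t : ℝ) :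
    HasDerivAt (fun t => Real.cos (ε * t)) (-(ε * Real.sin (ε * t))) t := by
  have := ((hasDerivAt_id' t).const_mul ε).cos
  simpa [mul_comm] using this

lemma hasDerivAt_kerK (hε : 0 < ε) {t : ℝ} (ht : 0 < t) :
    HasDerivAt (kerK ε) (kerK' ε t) t := by
  have h1 : kerK ε =ᶠ[𝓝 t] fun t => Real.sin (ε * t) ^ 2 / (ε ^ 2 * t ^ 3) := by
    filter_upwards [lt_mem_nhds ht] with y hy using kerK_eq hε hy
  refine HasDerivAt.congr_of_eventuallyEq ?_ h1
  convert! ((hasDerivAt_sin_mul ε t).pow 2).div ((hasDerivAt_pow 3 t).const_mul (ε ^ 2))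
    (by positivity) using 1
  simp only [kerK', Pi.pow_apply]
  field_simp
  norm_num
  ring

lemma hasDerivAt_kerK' (hε : 0 < ε) {t : ℝ} (ht : 0 < t) :
    HasDerivAt (kerK' ε) (kerK'' ε t) t := by
  unfold kerK'
  convert! ((((hasDerivAt_sin_mul ε t).const_mul 2).mul (hasDerivAt_cos_mul ε t)).div
    ((hasDerivAt_pow 3 t).const_mul ε) (by positivity)).sub
    ((((hasDerivAt_sin_mul ε t).pow 2).const_mul 3).div ((hasDerivAt_pow 4 t).const_mul (ε ^ 2))
    (by positivity)) using 1
  simp only [kerK'', Pi.pow_apply, Pi.mul_apply]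
  field_simp
  norm_num
  ring

lemma abs_sin_mul_le (hε : 0 < ε) {t : ℝ} (ht : 0 < t) : |Real.sin (ε * t)| ≤ ε * t :=
  Real.abs_sin_le_abs.trans (by rw [abs_of_pos (by positivity)])

lemma abs_kerK'_le (hε : 0 < ε) {t : ℝ} (ht : 0 < t) : |kerK' ε t| ≤ 5 / t ^ 2 := by
  have hs := abs_sin_mul_le hε ht
  have hc := Real.abs_cos_le_one (ε * t)
  have h1 : |2 * Real.sin (ε * t) * Real.cos (ε * t) / (ε * t ^ 3)| ≤ 2 / t ^ 2 := by
    rw [abs_div, abs_mul, abs_mul, abs_of_pos (show 0 < ε * t ^ 3 by positivity), abs_two]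
    calc _ ≤ 2 * (ε * t) * 1 / (ε * t ^ 3) := by gcongr
      _ = _ := by field_simp
  have h2 : |3 * Real.sin (ε * t) ^ 2 / (ε ^ 2 * t ^ 4)| ≤ 3 / t ^ 2 := by
    rw [abs_div, abs_mul, abs_pow, abs_of_pos (show 0 < ε ^ 2 * t ^ 4 by positivity),
      abs_of_pos (show (0 : ℝ) < 3 by norm_num)]
    calc _ ≤ 3 * (ε * t) ^ 2 / (ε ^ 2 * t ^ 4) := by gcongr
      _ = _ := by field_simp
  calc |kerK' ε t| ≤ _ := abs_sub _ _
    _ ≤ 2 / t ^ 2 + 3 / t ^ 2 := add_le_add h1 h2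
    _ = _ := by ring

lemma abs_kerK''_le (hε : 0 < ε) {t : ℝ} (ht : 0 < t) : |kerK'' ε t| ≤ 26 / t ^ 3 := by
  have hs := abs_sin_mul_le hε ht
  have hc := Real.abs_cos_le_one (ε * t)
  have h0 : |2 * (Real.cos (ε * t) ^ 2 - Real.sin (ε * t) ^ 2) / t ^ 3| ≤ 2 / t ^ 3 := by
    rw [abs_div, abs_mul, abs_two, abs_of_pos (show 0 < t ^ 3 by positivity), ← Real.cos_two_mul']
    have := Real.abs_cos_le_one (2 * (ε * t))
    calc _ ≤ 2 * 1 / t ^ 3 := by gcongr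
      _ = _ := by ring
  have h1 : |12 * Real.sin (ε * t) * Real.cos (ε * t) / (ε * t ^ 4)| ≤ 12 / t ^ 3 := by
    rw [abs_div, abs_mul, abs_mul, abs_of_pos (show 0 < ε * t ^ 4 by positivity),
      abs_of_pos (show (0 : ℝ) < 12 by norm_num)]
    calc _ ≤ 12 * (ε * t) * 1 / (ε * t ^ 4) := by gcongr
      _ = _ := by field_simp
  have h2 : |12 * Real.sin (ε * t) ^ 2 / (ε ^ 2 * t ^ 5)| ≤ 12 / t ^ 3 := by
    rw [abs_div, abs_mul, abs_pow, abs_of_pos (show 0 < ε ^ 2 * t ^ 5 by positivity),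
      abs_of_pos (show (0 : ℝ) < 12 by norm_num)]
    calc _ ≤ 12 * (ε * t) ^ 2 / (ε ^ 2 * t ^ 5) := by gcongr
      _ = _ := by field_simp
  calc |kerK'' ε t| ≤ _ := (abs_add_le _ _).trans (add_le_add_left (abs_sub _ _) _)
    _ ≤ 2 / t ^ 3 + 12 / t ^ 3 + 12 / t ^ 3 := add_le_add (add_le_add h0 h1) h2
    _ = _ := by ring

lemma abs_kerK_sub_le (hε : 0 < ε) {t γ : ℝ} (ht : 0 < t) (hγ : 0 < γ) :
    |kerK ε t - kerK ε (t + γ)| ≤ 5 * γ / t ^ 2 := by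
  have h := Convex.norm_image_sub_le_of_norm_hasDerivWithin_le (f := kerK ε) (f' := kerK' ε)
    (C := 5 / t ^ 2) (s := Set.Ici t) (x := t + γ) (y := t)
    (fun y hy => (hasDerivAt_kerK hε (ht.trans_le hy)).hasDerivWithinAt)
    (fun y hy => (abs_kerK'_le hε (ht.trans_le hy)).trans (by
      have : t ≤ y := hy
      gcongr)) (convex_Ici t) (by simp [hγ.le]) (by simp)
  rw [Real.norm_eq_abs, Real.norm_eq_abs] at h
  refine h.trans_eq ?_
  rw [show t - (t + γ) = -γ by ring, abs_neg, abs_of_pos hγ]; ring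

lemma abs_kerK'_sub_le (hε : 0 < ε) {t γ : ℝ} (ht : 0 < t) (hγ : 0 < γ) :
    |kerK' ε t - kerK' ε (t + γ)| ≤ 26 * γ / t ^ 3 := by
  have h := Convex.norm_image_sub_le_of_norm_hasDerivWithin_le (f := kerK' ε) (f' := kerK'' ε)
    (C := 26 / t ^ 3) (s := Set.Ici t) (x := t + γ) (y := t)
    (fun y hy => (hasDerivAt_kerK' hε (ht.trans_le hy)).hasDerivWithinAt)
    (fun y hy => (abs_kerK''_le hε (ht.trans_le hy)).trans (by
      have : t ≤ y := hy
      gcongr)) (convex_Ici t) (by simp [hγ.le]) (by simp)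
  rw [Real.norm_eq_abs, Real.norm_eq_abs] at h
  refine h.trans_eq ?_
  rw [show t - (t + γ) = -γ by ring, abs_neg, abs_of_pos hγ]; ring

/-- Integrals of `‖φ‖` over `(0, s]` may grow like `s²`, which is too much for first differences of
order `γ / t²`. The second difference gains the one power of `t` that makes the weighted integral
converge. -/
lemma abs_kerK_second_sub_le (hε : 0 < ε) {t γ : ℝ} (ht : 0 < t) (hγ : 0 < γ) :
    |(kerK ε t - kerK ε (t + γ)) - (kerK ε (t + γ) - kerK ε (t + γ + γ))| ≤
      26 * γ ^ 2 / t ^ 3 := by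
  have h := Convex.norm_image_sub_le_of_norm_hasDerivWithin_le
    (f := fun y => kerK ε y - kerK ε (y + γ)) (f' := fun y => kerK' ε y - kerK' ε (y + γ))
    (C := 26 * γ / t ^ 3) (s := Set.Ici t) (x := t + γ) (y := t)
    (fun y hy => by
      have hy' : 0 < y := ht.trans_le hy
      exact ((hasDerivAt_kerK hε hy').sub
        ((hasDerivAt_kerK hε (add_pos hy' hγ)).comp_add_const y γ)).hasDerivWithinAt)
    (fun y hy => (abs_kerK'_sub_le hε (ht.trans_le hy) hγ).trans (by
      have : t ≤ y := hy
      gcongr)) (convex_Ici t) (by simp [hγ.le]) (by simp)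
  simp only [Real.norm_eq_abs] at h
  refine h.trans_eq ?_
  rw [show t - (t + γ) = -γ by ring, abs_neg, abs_of_pos hγ]; ring

end ker

/-! ### Contour integration and the sine transform of the kernel -/

/-- A function which is `O(|z|⁻²)` in the closed upper half plane and holomorphic inside has
vanishing integral over the real axis. -/
lemma tendsto_integral_of_decay {H : ℂ → ℂ} {A : ℝ} (hc : ContinuousOn H {z | 0 ≤ z.im})
    (hd : DifferentiableOn ℂ H {z | 0 < z.im})
    (hA : ∀ z : ℂ, 0 ≤ z.im → 1 ≤ ‖z‖ → ‖H z‖ ≤ A / ‖z‖ ^ 2) :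
    Tendsto (fun R : ℝ => ∫ t in (-R)..R, H t) atTop (𝓝 0) := by
  have hA0 : 0 ≤ A := by
    have := (norm_nonneg _).trans (hA Complex.I (by simp) (by simp))
    simpa using this
  have key : ∀ R : ℝ, 1 ≤ R → ‖∫ t in (-R)..R, H t‖ ≤ 4 * A / R := by
    intro R hR
    have hR0 : 0 < R := by linarith
    -- Cauchy's theorem on the rectangle `[-R, R] × [0, R]`: the other three sides have total length
    -- `4R` and stay at distance at least `R` from the origin.
    have h := Complex.integral_boundary_rect_eq_zero_of_continuousOn_of_differentiableOn H
      ⟨-R, 0⟩ ⟨R, R⟩ (hc.mono ?_) (hd.mono ?_)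
    · simp only [Complex.ofReal_zero, zero_mul, add_zero] at h
      have b : ∀ z : ℂ, 0 ≤ z.im → R ≤ ‖z‖ → ‖H z‖ ≤ A / R ^ 2 := by
        intro z hz hRz
        refine (hA z hz (hR.trans hRz)).trans ?_
        gcongr
      have b1 : ‖∫ x in (-R)..R, H (x + R * Complex.I)‖ ≤ A / R ^ 2 * |R - -R| := by
        refine intervalIntegral.norm_integral_le_of_norm_le_const fun x _ => b _ (by simp [hR0.le]) ?_
        have := Complex.abs_im_le_norm ((x : ℂ) + R * Complex.I)
        simpa [abs_of_pos hR0] using this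
      have b2 : ‖∫ y in (0 : ℝ)..R, H (R + y * Complex.I)‖ ≤ A / R ^ 2 * |R - 0| := by
        refine intervalIntegral.norm_integral_le_of_norm_le_const fun y hy => b _ ?_ ?_
        · rw [Set.uIoc_of_le hR0.le] at hy; simp [hy.1.le]
        · have := Complex.abs_re_le_norm ((R : ℂ) + y * Complex.I)
          simpa [abs_of_pos hR0] using this
      have b3 : ‖∫ y in (0 : ℝ)..R, H ((-R : ℝ) + y * Complex.I)‖ ≤ A / R ^ 2 * |R - 0| := by
        refine intervalIntegral.norm_integral_le_of_norm_le_const fun y hy => b _ ?_ ?_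
        · rw [Set.uIoc_of_le hR0.le] at hy; simp [hy.1.le]
        · have := Complex.abs_re_le_norm (((-R : ℝ) : ℂ) + y * Complex.I)
          simpa [abs_of_pos hR0] using this
      have e : ∫ x in (-R)..R, H x = (∫ x in (-R)..R, H (x + R * Complex.I)) -
          Complex.I • (∫ y in (0 : ℝ)..R, H (R + y * Complex.I)) +
          Complex.I • ∫ y in (0 : ℝ)..R, H ((-R : ℝ) + y * Complex.I) := by
        linear_combination (norm := module) h
      rw [e]
      refine (norm_add_le _ _).trans ((add_le_add_left (norm_sub_le _ _) _).trans ?_)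
      rw [norm_smul, norm_smul, Complex.norm_I, one_mul, one_mul]
      rw [sub_neg_eq_add, abs_of_pos (by linarith)] at b1
      rw [sub_zero, abs_of_pos hR0] at b2 b3
      calc _ ≤ A / R ^ 2 * (R + R) + A / R ^ 2 * R + A / R ^ 2 * R := by gcongr
        _ = 4 * A / R := by field_simp; ring
    · intro z hz
      have := hz.2
      simp only [Set.mem_preimage, Set.uIcc_of_le hR0.le] at this
      exact this.1
    · intro z hz
      have := hz.2
      simp only [Set.mem_preimage, min_eq_left hR0.le] at this
      exact this.1
  refine squeeze_zero_norm' (a := fun R => 4 * A / R) ?_ ?_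
  · filter_upwards [eventually_ge_atTop 1] with R hR using key R hR
  · exact tendsto_const_nhds.div_atTop tendsto_id

lemma norm_complex_sin_le {z : ℂ} (hz : 0 ≤ z.im) : ‖Complex.sin z‖ ≤ Real.exp z.im := by
  rw [Complex.sin, norm_div, norm_mul, Complex.norm_I, mul_one]
  have h1 : ‖Complex.exp (-z * Complex.I)‖ = Real.exp z.im := by
    rw [Complex.norm_exp]; simp
  have h2 : ‖Complex.exp (z * Complex.I)‖ ≤ Real.exp z.im := by
    rw [Complex.norm_exp]; simp only [Complex.mul_I_re]; gcongr; linarith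
  have h3 := norm_sub_le (Complex.exp (-z * Complex.I)) (Complex.exp (z * Complex.I))
  rw [Complex.norm_two, div_le_iff₀ (by norm_num)]
  linarith

/-- The entire function `sin z / z`. -/
def csinc : ℂ → ℂ := dslope Complex.sin 0

lemma differentiable_csinc : Differentiable ℂ csinc := by
  rw [← differentiableOn_univ]
  exact (Complex.differentiableOn_dslope univ_mem).2 Complex.differentiable_sin.differentiableOn

lemma csinc_of_ne {z : ℂ} (hz : z ≠ 0) : csinc z = Complex.sin z / z := by
  rw [csinc, dslope_of_ne _ hz, slope_def_field]; simp

lemma csinc_zero : csinc 0 = 1 := by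
  rw [csinc, dslope_same]; simp

lemma csinc_ofReal (t : ℝ) : csinc t = Real.sinc t := by
  rcases eq_or_ne t 0 with rfl | h
  · simp [csinc_zero]
  · rw [csinc_of_ne (by exact_mod_cast h), Real.sinc_of_ne_zero h]; push_cast; rfl

/-- The sine transform of the kernel amplitude is constant from the frequency `2ε` on. -/
theorem integral_sin_mul_kerK {ε s : ℝ} (hε : 0 < ε) (hs : 2 * ε ≤ s) :
    ∫ t in Set.Ioi (0 : ℝ), Real.sin (s * t) * kerK ε t = Real.pi / 2 := by
  -- Subtracting `1 / (1 - iz)` removes the pole at `0` of `e^{isz} sinc²(εz) / z` without creating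
  -- one in the upper half plane. After division by `z` the subtracted term has imaginary part `1 /
  -- (1 + t²)` on the axis, and half the integral of that is the asserted `π/2`.
  set G : ℂ → ℂ := fun z =>
    Complex.exp (Complex.I * s * z) * csinc (ε * z) ^ 2 - (1 - Complex.I * z)⁻¹ with hG
  set H := dslope G 0 with hH
  have hG0 : G 0 = 0 := by simp [hG, csinc_zero]
  set V : Set ℂ := {z | -1 < z.im} with hV
  have hVo : IsOpen V := isOpen_lt continuous_const Complex.continuous_im
  have hne : ∀ z ∈ V, 1 - Complex.I * z ≠ 0 := by
    intro z hz h
    have := congrArg Complex.re h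
    simp only [Complex.sub_re, Complex.one_re, Complex.I_mul_re, Complex.zero_re] at this
    have hz' : -1 < z.im := hz
    linarith
  have hGd : DifferentiableOn ℂ G V := by
    have h1 : Differentiable ℂ fun z : ℂ => csinc (ε * z) :=
      differentiable_csinc.comp (differentiable_id.const_mul _)
    have h2 : Differentiable ℂ fun z : ℂ => Complex.exp (Complex.I * s * z) :=
      (differentiable_id.const_mul _).cexp
    refine ((h2.mul (h1.pow 2)).differentiableOn).sub (DifferentiableOn.inv ?_ hne)
    exact ((differentiable_const _).sub (differentiable_id.const_mul _)).differentiableOn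
  have hHd : DifferentiableOn ℂ H V :=
    (Complex.differentiableOn_dslope (hVo.mem_nhds (by simp [hV]))).2 hGd
  have hHne : ∀ z, z ≠ 0 → H z = G z / z := by
    intro z hz
    rw [hH, dslope_of_ne _ hz, slope_def_field, hG0]; simp
  have hdecay : ∀ z : ℂ, 0 ≤ z.im → 1 ≤ ‖z‖ → ‖H z‖ ≤ (1 / ε ^ 2 + 1) / ‖z‖ ^ 2 := by
    intro z hz hz1
    have hz0 : z ≠ 0 := by rintro rfl; simp at hz1; linarith
    have hzp : 0 < ‖z‖ := by positivity
    have hεz : (ε : ℂ) * z ≠ 0 := mul_ne_zero (by exact_mod_cast hε.ne') hz0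
    have h1 : ‖Complex.exp (Complex.I * s * z) * csinc (ε * z) ^ 2‖ ≤ 1 / ε ^ 2 / ‖z‖ := by
      rw [norm_mul, norm_pow, csinc_of_ne hεz, norm_div, norm_mul, Complex.norm_real,
        Real.norm_of_nonneg hε.le, Complex.norm_exp]
      have e1 : (Complex.I * s * z).re = -(s * z.im) := by
        rw [mul_assoc, Complex.I_mul_re, Complex.im_ofReal_mul]
      have e2 : ‖Complex.sin (ε * z)‖ ≤ Real.exp (ε * z.im) := by
        have := norm_complex_sin_le (z := ε * z) (by rw [Complex.im_ofReal_mul]; positivity)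
        rwa [Complex.im_ofReal_mul] at this
      rw [e1]
      calc _ ≤ Real.exp (-(s * z.im)) * (Real.exp (ε * z.im) / (ε * ‖z‖)) ^ 2 := by gcongr
        _ = Real.exp (-(s * z.im) + 2 * (ε * z.im)) * (1 / ε ^ 2 / ‖z‖ ^ 2) := by
            rw [Real.exp_add, two_mul (ε * z.im), Real.exp_add]; field_simp
        -- Here `2ε ≤ s` enters: `e^{isz}` decays at least as fast as `sin²(εz)` can grow.
        _ ≤ 1 * (1 / ε ^ 2 / ‖z‖) := by
            gcongr
            · rw [Real.exp_le_one_iff]; nlinarith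
            · nlinarith
        _ = _ := one_mul _
    have h2 : ‖(1 - Complex.I * z)⁻¹‖ ≤ 1 / ‖z‖ := by
      rw [norm_inv, ← one_div]
      gcongr
      rw [← sq_le_sq₀ (norm_nonneg _) (norm_nonneg _), Complex.sq_norm, Complex.sq_norm,
        Complex.normSq_apply, Complex.normSq_apply]
      simp only [Complex.sub_re, Complex.one_re, Complex.I_mul_re, Complex.sub_im, Complex.one_im,
        Complex.I_mul_im]
      nlinarith
    rw [hHne z hz0, norm_div]
    calc ‖G z‖ / ‖z‖ ≤ (1 / ε ^ 2 / ‖z‖ + 1 / ‖z‖) / ‖z‖ := by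
          gcongr; exact (norm_sub_le _ _).trans (add_le_add h1 h2)
      _ = _ := by field_simp
  have hVc : {z : ℂ | 0 ≤ z.im} ⊆ V := fun z hz => by
    have : 0 ≤ z.im := hz
    simp only [hV, Set.mem_ofPred_eq]; linarith
  have hlim := tendsto_integral_of_decay (hHd.continuousOn.mono hVc)
    (hHd.mono ((fun z (hz : 0 < z.im) => hVc hz.le))) hdecay
  have him : ∀ t : ℝ, t ≠ 0 → (H t).im = Real.sin (s * t) * kerK ε t - (1 + t ^ 2)⁻¹ := by
    intro t ht
    have e1 : G t = ((Real.cos (s * t) * Real.sinc (ε * t) ^ 2 - (1 + t ^ 2)⁻¹ : ℝ) : ℂ) +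
        ((Real.sin (s * t) * Real.sinc (ε * t) ^ 2 - t * (1 + t ^ 2)⁻¹ : ℝ) : ℂ) * Complex.I := by
      simp only [hG]
      rw [show Complex.I * s * t = ((s * t : ℝ) : ℂ) * Complex.I by push_cast; ring,
        Complex.exp_mul_I, ← Complex.ofReal_mul ε t, csinc_ofReal, ← Complex.ofReal_cos,
        ← Complex.ofReal_sin]
      have h3 : (1 - Complex.I * t)⁻¹ = (1 + Complex.I * t) * (1 + (t : ℂ) ^ 2)⁻¹ := by
        have h4 : (1 - Complex.I * (t : ℂ)) * (1 + Complex.I * t) = 1 + (t : ℂ) ^ 2 := by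
          linear_combination (-(t : ℂ) ^ 2) * Complex.I_sq
        have h5 : (1 + (t : ℂ) ^ 2) ≠ 0 := by
          have : (1 + t ^ 2 : ℝ) ≠ 0 := by positivity
          exact_mod_cast this
        rw [inv_eq_iff_eq_inv, mul_inv, inv_inv]
        have h6 : 1 + Complex.I * (t : ℂ) ≠ 0 := fun h => h5 (by rw [← h4, h, mul_zero])
        rw [← h4]; field_simp
      rw [h3]; push_cast; ring
    rw [hHne _ (by exact_mod_cast ht), e1, Complex.div_ofReal_im]
    simp only [Complex.add_im, Complex.ofReal_im, Complex.mul_I_im, Complex.ofReal_re, zero_add,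
      kerK]
    field_simp
  have hHcont : Continuous fun t : ℝ => H t := by
    refine hHd.continuousOn.comp_continuous Complex.continuous_ofReal fun t => ?_
    simp [hV]
  have hk : IntegrableOn (fun t => Real.sin (s * t) * kerK ε t) (Set.Ioi 0) :=
    integrableOn_sin_mul_kerK hε s
  have heven : ∀ t, Real.sin (s * -t) * kerK ε (-t) = Real.sin (s * t) * kerK ε t := by
    intro t; simp only [kerK, mul_neg, Real.sin_neg, Real.sinc_neg]; ring
  have hlim2 := intervalIntegral_tendsto_integral_Ioi 0 hk tendsto_id
  have hval : ∀ R : ℝ, 0 < R → 2 * (∫ t in (0 : ℝ)..R, Real.sin (s * t) * kerK ε t) =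
      (∫ t in (-R)..R, H t).im + 2 * Real.arctan R := by
    intro R hR
    have hi : IntervalIntegrable (fun t => Real.sin (s * t) * kerK ε t) volume 0 R := by
      rw [intervalIntegrable_iff_integrableOn_Ioc_of_le hR.le]
      exact hk.mono_set Set.Ioc_subset_Ioi_self
    have hi' : IntervalIntegrable (fun t => Real.sin (s * t) * kerK ε t) volume (-R) 0 := by
      have := hi.comp_sub_left 0
      simp only [zero_sub, heven, sub_zero] at this
      exact this.symm
    have h1 : ∫ t in (-R)..0, Real.sin (s * t) * kerK ε t =
        ∫ t in (0 : ℝ)..R, Real.sin (s * t) * kerK ε t := by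
      have := intervalIntegral.integral_comp_neg (a := -R) (b := 0)
        (fun t => Real.sin (s * t) * kerK ε t)
      simp only [heven, neg_zero, neg_neg] at this
      exact this
    have h2 : (∫ t in (-R)..R, H t).im =
        ∫ t in (-R)..R, (Real.sin (s * t) * kerK ε t - (1 + t ^ 2)⁻¹) := by
      rw [← Complex.imCLM_apply,
        ← Complex.imCLM.intervalIntegral_comp_comm (hHcont.intervalIntegrable _ _)]
      refine intervalIntegral.integral_congr_ae ?_
      have : ∀ᵐ t : ℝ, t ≠ 0 := by simp [ae_iff]
      filter_upwards [this] with t ht _ using him t ht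
    have h3 : IntervalIntegrable (fun t : ℝ => (1 + t ^ 2)⁻¹) volume (-R) R :=
      integrable_inv_one_add_sq.intervalIntegrable
    rw [h2, intervalIntegral.integral_sub (hi'.trans hi) h3, integral_inv_one_add_sq,
      ← intervalIntegral.integral_add_adjacent_intervals hi' hi, h1, Real.arctan_neg]
    ring
  have hlim3 : Tendsto (fun R : ℝ => (∫ t in (-R)..R, H t).im + 2 * Real.arctan R) atTop
      (𝓝 (0 + 2 * (Real.pi / 2))) := by
    have h1 := (Complex.continuous_im.tendsto 0).comp hlim
    have h2 := (tendsto_nhds_of_tendsto_nhdsWithin Real.tendsto_arctan_atTop).const_mul 2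
    simpa using h1.add h2
  have hlim4 := hlim2.const_mul 2
  have := tendsto_nhds_unique (hlim4.congr' ?_) hlim3
  · linarith
  · filter_upwards [eventually_gt_atTop 0] with R hR using hval R hR

/-- The transform of the kernel at low and at high frequencies. -/
lemma integral_sin_add_sin_mul_kerK {ε ρ l : ℝ} (hε : 0 < ε) :
    (|l| ≤ ρ - 2 * ε →
      ∫ t in Set.Ioi (0 : ℝ), 2 * Real.cos (l * t) * (Real.sin (ρ * t) * kerK ε t) = Real.pi) ∧
    (ρ + 2 * ε ≤ |l| → 0 ≤ ρ →
      ∫ t in Set.Ioi (0 : ℝ), 2 * Real.cos (l * t) * (Real.sin (ρ * t) * kerK ε t) = 0) := by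
  -- Product to sum. Both frequencies `ρ ± l` are at least `2ε` when `|l|` is small, giving `π/2 +
  -- π/2`. When `|l|` is large they have opposite signs and the two values cancel.
  have h : ∀ l : ℝ, ∫ t in Set.Ioi (0 : ℝ), 2 * Real.cos (l * t) * (Real.sin (ρ * t) * kerK ε t) =
      (∫ t in Set.Ioi (0 : ℝ), Real.sin ((ρ + l) * t) * kerK ε t) +
        ∫ t in Set.Ioi (0 : ℝ), Real.sin ((ρ - l) * t) * kerK ε t := by
    intro l
    rw [← integral_add (integrableOn_sin_mul_kerK hε _) (integrableOn_sin_mul_kerK hε _)]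
    congr 1 with t
    rw [add_mul, sub_mul, Real.sin_add, Real.sin_sub]; ring
  have hneg : ∀ s : ℝ, ∫ t in Set.Ioi (0 : ℝ), Real.sin (-s * t) * kerK ε t =
      -∫ t in Set.Ioi (0 : ℝ), Real.sin (s * t) * kerK ε t := by
    intro s
    rw [← integral_neg]
    congr 1 with t
    rw [neg_mul, Real.sin_neg]; ring
  constructor
  · intro hl
    have := abs_le.1 hl
    rw [h, integral_sin_mul_kerK hε (by linarith), integral_sin_mul_kerK hε (by linarith)]
    ring
  · intro hl hρ
    have habs : ∫ t in Set.Ioi (0 : ℝ), 2 * Real.cos (l * t) * (Real.sin (ρ * t) * kerK ε t) =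
        ∫ t in Set.Ioi (0 : ℝ), 2 * Real.cos (|l| * t) * (Real.sin (ρ * t) * kerK ε t) := by
      rcases abs_choice l with h' | h' <;> rw [h']
      simp only [neg_mul, Real.cos_neg]
    rw [habs, h, integral_sin_mul_kerK hε (by linarith), show ρ - |l| = -(|l| - ρ) by ring, hneg,
      integral_sin_mul_kerK hε (by linarith)]
    ring

/-! ### Estimates of the oscillating integrals -/

lemma lqNorm_mono {ι : Type*} {Q : ℕ} {S : Finset ι} {c d : ι → ℂ}
    (h : ∀ k ∈ S, ‖c k‖ ≤ ‖d k‖) : lqNorm Q S c ≤ lqNorm Q S d := by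
  unfold lqNorm
  gcongr with k hk
  exact h k hk

lemma lqNorm_le_add {ι : Type*} {Q : ℕ} (hQ : 1 ≤ Q) {S : Finset ι} {c d e : ι → ℂ}
    (h : ∀ k ∈ S, ‖c k‖ ≤ ‖d k‖ + ‖e k‖) : lqNorm Q S c ≤ lqNorm Q S d + lqNorm Q S e := by
  have h1 := lqNorm_add_le (S := S) hQ (fun k => ((‖d k‖ : ℝ) : ℂ)) (fun k => ((‖e k‖ : ℝ) : ℂ))
  have h2 : lqNorm Q S c ≤ lqNorm Q S (fun k => ((‖d k‖ : ℝ) : ℂ) + ((‖e k‖ : ℝ) : ℂ)) := by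
    refine lqNorm_mono fun k hk => ?_
    rw [← Complex.ofReal_add, Complex.norm_real, Real.norm_of_nonneg (by positivity)]
    exact h k hk
  refine h2.trans (h1.trans_eq ?_)
  simp [lqNorm]

lemma integral_Ioi_comp_add {E : Type*} [NormedAddCommGroup E] [NormedSpace ℝ E] (F : ℝ → E)
    (a γ : ℝ) : ∫ t in Set.Ioi a, F (t + γ) = ∫ t in Set.Ioi (a + γ), F t := by
  have h := (measurePreserving_add_right (volume : Measure ℝ) γ).setIntegral_preimage_emb
    (measurableEmbedding_addRight γ) F (Set.Ioi (a + γ))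
  simpa using h

lemma integrableOn_Ioi_comp_add {E : Type*} [NormedAddCommGroup E] {F : ℝ → E}
    {a γ : ℝ} (hγ : 0 ≤ γ) (hF : IntegrableOn F (Set.Ioi a)) :
    IntegrableOn (fun t => F (t + γ)) (Set.Ioi a) := by
  have h := (measurePreserving_add_right (volume : Measure ℝ) γ).integrableOn_comp_preimage
    (measurableEmbedding_addRight γ) (f := F) (s := Set.Ioi (a + γ))
  have h2 := h.2 (hF.mono_set (Set.Ioi_subset_Ioi (by linarith)))
  simpa [Function.comp_def] using h2

lemma integrableOn_mul_expi {F : ℝ → ℂ} {s : Set ℝ} (hF : IntegrableOn F s) (l : ℝ) :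
    IntegrableOn (fun t => F t * expi l t) s := by
  refine Integrable.mono hF (hF.1.mul (continuous_expi l).aestronglyMeasurable)
    (Eventually.of_forall fun t => by simp)

/-- Passing to a difference in an oscillating integral. -/
lemma norm_integral_expi_le_shift {F : ℝ → ℂ} {a γ l : ℝ} (hF : IntegrableOn F (Set.Ioi a))
    (hγ : 0 < γ) (hl : 1 ≤ ‖1 - expi l γ‖) :
    ‖∫ t in Set.Ioi a, F t * expi l t‖ ≤
      ‖∫ t in Set.Ioi a, (F t - F (t + γ)) * expi l t‖ + ∫ t in Set.Ioc a (a + γ), ‖F t‖ := by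
  set J := ∫ t in Set.Ioi a, F t * expi l t with hJ
  set B := ∫ t in Set.Ioc a (a + γ), F t * expi l t with hB
  set u := expi l (-γ) with hu
  have hFe := integrableOn_mul_expi hF l
  have hu1 : u * expi l γ = 1 := by rw [hu, ← expi_add_right]; simp
  have hsplit : J = B + ∫ t in Set.Ioi (a + γ), F t * expi l t := by
    rw [hJ, hB, ← setIntegral_union (Set.Ioc_disjoint_Ioi le_rfl) measurableSet_Ioi
      (hFe.mono_set Set.Ioc_subset_Ioi_self) (hFe.mono_set (Set.Ioi_subset_Ioi (by linarith))),
      Set.Ioc_union_Ioi_eq_Ioi (by linarith)]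
  have hshift : ∫ t in Set.Ioi a, F (t + γ) * expi l t =
      u * ∫ t in Set.Ioi (a + γ), F t * expi l t := by
    rw [← integral_Ioi_comp_add, ← integral_const_mul]
    congr 1 with t
    rw [expi_add_right]
    linear_combination (-(F (t + γ) * expi l t)) * hu1
  -- The right side equals `(1 - u) J + u B`. Since `|1 - u| = |1 - e^{ilγ}| ≥ 1`, the size of `J`
  -- is at most that of the differenced integral plus the boundary piece.
  have hD : ∫ t in Set.Ioi a, (F t - F (t + γ)) * expi l t = J - u * (J - B) := by
    have : ∀ t, (F t - F (t + γ)) * expi l t = F t * expi l t - F (t + γ) * expi l t := by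
      intro t; ring
    simp only [this]
    rw [integral_sub hFe (integrableOn_mul_expi (integrableOn_Ioi_comp_add hγ.le hF) l), hshift,
      ← hJ]
    linear_combination u * hsplit
  have hn : ‖1 - u‖ = ‖1 - expi l γ‖ := by
    have : 1 - u = -(u * (1 - expi l γ)) := by linear_combination -hu1
    rw [this, norm_neg, norm_mul, hu, norm_expi, one_mul]
  have hBn : ‖B‖ ≤ ∫ t in Set.Ioc a (a + γ), ‖F t‖ := by
    refine (norm_integral_le_integral_norm _).trans_eq ?_
    simp
  calc ‖J‖ ≤ ‖1 - u‖ * ‖J‖ := le_mul_of_one_le_left (norm_nonneg _) (hn ▸ hl)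
    _ = ‖(J - u * (J - B)) - u * B‖ := by rw [← norm_mul]; congr 1; ring
    _ ≤ ‖J - u * (J - B)‖ + ‖u * B‖ := norm_sub_le _ _
    _ ≤ _ := by
      rw [hD, norm_mul, hu, norm_expi, one_mul]
      gcongr

lemma integrableOn_div_pow
    {u : ℝ → ℝ} (hum : AEStronglyMeasurable u volume) {M : ℝ} (hu : ∀ t, |u t| ≤ M) {a : ℝ}
    (ha : 0 < a) {n : ℕ} (hn : 2 ≤ n) : IntegrableOn (fun t => u t / t ^ n) (Set.Ioi a) := by
  have h1 : IntegrableOn (fun t : ℝ => M * t ^ (-(n : ℝ))) (Set.Ioi a) :=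
    (integrableOn_Ioi_rpow_of_lt (by
      have : (2 : ℝ) ≤ n := by exact_mod_cast hn
      linarith) ha).const_mul M
  refine Integrable.mono' h1 ?_ ?_
  · exact (hum.aemeasurable.div (measurable_id.pow_const n).aemeasurable).aestronglyMeasurable.restrict
  · refine (ae_restrict_iff' measurableSet_Ioi).2 (Eventually.of_forall fun t ht => ?_)
    have ht0 : 0 < t := ha.trans ht
    rw [Real.norm_eq_abs, abs_div, abs_of_pos (pow_pos ht0 n), Real.rpow_neg ht0.le,
      Real.rpow_natCast, div_eq_mul_inv]
    gcongr
    exact hu t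

/-- A bound for the averages of `u` gives a bound for its weighted integral over a half line. -/
lemma integral_Ioi_div_pow_le {u : ℝ → ℝ} (hum : AEStronglyMeasurable u volume)
    (hu0 : ∀ t, 0 ≤ u t) {M : ℝ} (hu : ∀ t, u t ≤ M) {a A : ℝ} (ha : 0 < a)
    {n : ℕ} (hn : 1 ≤ n) (hA : ∀ s, a ≤ s → ∫ t in Set.Ioc 0 s, u t ≤ A * s ^ n) :
    ∫ t in Set.Ioi a, u t / t ^ (n + 1) ≤ 2 ^ (n + 1) * A / a := by
  have hintg : IntegrableOn (fun t => u t / t ^ (n + 1)) (Set.Ioi a) :=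
    integrableOn_div_pow hum (fun t => by rw [abs_of_nonneg (hu0 t)]; exact hu t) ha (by omega)
  have hA0 : 0 ≤ A := by
    have h1 := hA a le_rfl
    have h2 : 0 ≤ ∫ t in Set.Ioc 0 a, u t := integral_nonneg hu0
    have : 0 ≤ A * a ^ n := h2.trans h1
    exact nonneg_of_mul_nonneg_left this (by positivity)
  have htend : Tendsto (fun N : ℕ => (2 : ℝ) ^ N * a) atTop atTop :=
    (tendsto_pow_atTop_atTop_of_one_lt (by norm_num)).atTop_mul_const ha
  refine le_of_tendsto' (intervalIntegral_tendsto_integral_Ioi a hintg htend) fun N => ?_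
  have hii : ∀ b c : ℝ, a ≤ b → b ≤ c →
      IntervalIntegrable (fun t => u t / t ^ (n + 1)) volume b c := by
    intro b c hab hbc
    rw [intervalIntegrable_iff_integrableOn_Ioc_of_le hbc]
    exact hintg.mono_set (Set.Ioc_subset_Ioi_self.trans (Set.Ioi_subset_Ioi hab))
  have hpow : ∀ k : ℕ, a ≤ 2 ^ k * a := fun k =>
    le_mul_of_one_le_left ha.le (one_le_pow₀ (by norm_num))
  have hpow' : ∀ k : ℕ, (2 : ℝ) ^ k * a ≤ 2 ^ (k + 1) * a := fun k => by
    gcongr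
    · norm_num
    · omega
  have hsum := intervalIntegral.sum_integral_adjacent_intervals (a := fun k : ℕ => (2 : ℝ) ^ k * a)
    (n := N) (f := fun t => u t / t ^ (n + 1)) (μ := volume)
    (fun k _ => hii _ _ (hpow k) (hpow' k))
  simp only [pow_zero, one_mul] at hsum
  rw [← hsum]
  -- On `(l, 2l]` the weight is at most `l^{-(n+1)}` and the integral of `u` at most `A (2l)^n`, so
  -- the pieces decay like `1/l`, geometrically in `k`.
  have hpiece : ∀ k : ℕ, ∫ t in (2 ^ k * a)..(2 ^ (k + 1) * a), u t / t ^ (n + 1) ≤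
      2 ^ n * A / a * (1 / 2) ^ k := by
    intro k
    set l := (2 : ℝ) ^ k * a with hl
    have hl0 : 0 < l := by positivity
    have hl2 : (2 : ℝ) ^ (k + 1) * a = 2 * l := by rw [hl]; ring
    rw [hl2, intervalIntegral.integral_of_le (by linarith)]
    have hui : IntegrableOn u (Set.Ioc 0 (2 * l)) :=
      Integrable.of_bound hum.restrict M (Eventually.of_forall fun t => by
        rw [Real.norm_of_nonneg (hu0 t)]; exact hu t)
    calc ∫ t in Set.Ioc l (2 * l), u t / t ^ (n + 1)
        ≤ ∫ t in Set.Ioc l (2 * l), u t / l ^ (n + 1) := by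
          refine setIntegral_mono_on ?_ ?_ measurableSet_Ioc fun t ht => ?_
          · exact hintg.mono_set (Set.Ioc_subset_Ioi_self.trans (Set.Ioi_subset_Ioi (hpow k)))
          · exact (hui.mono_set (Set.Ioc_subset_Ioc_left hl0.le)).div_const _
          · have := ht.1.le
            have := hu0 t
            gcongr
      _ = (∫ t in Set.Ioc l (2 * l), u t) / l ^ (n + 1) := integral_div _ _
      _ ≤ (∫ t in Set.Ioc 0 (2 * l), u t) / l ^ (n + 1) := by
          refine div_le_div_of_nonneg_right ?_ (by positivity)
          exact setIntegral_mono_set hui (Eventually.of_forall hu0)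
            (Set.Ioc_subset_Ioc_left hl0.le).eventuallyLE
      _ ≤ (A * (2 * l) ^ n) / l ^ (n + 1) := by
          gcongr; exact hA _ (by have := hpow k; linarith)
      _ = 2 ^ n * A / l := by rw [mul_pow]; field_simp; ring
      _ = _ := by rw [hl, one_div, inv_pow]; field_simp
  calc _ ≤ ∑ k ∈ Finset.range N, 2 ^ n * A / a * (1 / 2 : ℝ) ^ k :=
        Finset.sum_le_sum fun k _ => hpiece k
    _ = 2 ^ n * A / a * ∑ k ∈ Finset.range N, (1 / 2 : ℝ) ^ k := by rw [Finset.mul_sum]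
    _ ≤ 2 ^ n * A / a * 2 := by gcongr; exact sum_geometric_two_le N
    _ = _ := by rw [pow_succ]; ring

/-- The data of an averaged smoothness condition at the scale `γ`. -/
structure ShiftBound (r γ W M : ℝ) (φ : ℝ → ℂ) : Prop where
  pos : 0 < γ
  meas : AEStronglyMeasurable φ volume
  bound : ∀ t, ‖φ t‖ ≤ M
  mean : ∀ s, γ ≤ s → ∫ t in Set.Ioc 0 s, ‖φ t‖ ≤ 2 * W / γ * s ^ 2
  shift : ∀ s, 0 < s → ∫ t in Set.Ioc 0 s, ‖φ t - φ (t + γ)‖ ≤ W * s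
  shift_rpow : ∀ s, 0 < s → ∫ t in Set.Ioc 0 s, ‖φ t - φ (t + γ)‖ ^ r ≤ s * W ^ r

lemma aestronglyMeasurable_comp_add {E : Type*} [TopologicalSpace E] {F : ℝ → E}
    (hF : AEStronglyMeasurable F volume) (γ : ℝ) :
    AEStronglyMeasurable (fun t => F (t + γ)) volume :=
  hF.comp_quasiMeasurePreserving (measurePreserving_add_right volume γ).quasiMeasurePreserving

lemma integral_Ioc_comp_add_le {u : ℝ → ℝ} (hum : AEStronglyMeasurable u volume)
    (hu0 : ∀ t, 0 ≤ u t) {M : ℝ} (hu : ∀ t, u t ≤ M) {a s γ : ℝ} (ha : 0 ≤ a) (hγ : 0 ≤ γ) :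
    ∫ t in Set.Ioc a s, u (t + γ) ≤ ∫ t in Set.Ioc 0 (s + γ), u t := by
  have h := (measurePreserving_add_right (volume : Measure ℝ) γ).setIntegral_preimage_emb
    (measurableEmbedding_addRight γ) u (Set.Ioc (a + γ) (s + γ))
  simp only [Set.preimage_add_const_Ioc, add_sub_cancel_right] at h
  rw [h]
  refine setIntegral_mono_set ?_ (Eventually.of_forall hu0)
    (Set.Ioc_subset_Ioc_left (by linarith)).eventuallyLE
  exact Integrable.of_bound hum.restrict M (Eventually.of_forall fun t => by
        rw [Real.norm_of_nonneg (hu0 t)]; exact hu t)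

section shift
variable {r γ W M ε : ℝ} {φ : ℝ → ℂ}

lemma ShiftBound.W_nonneg (h : ShiftBound r γ W M φ) : 0 ≤ W := by
  have h1 := h.shift 1 one_pos
  rw [mul_one] at h1
  exact (integral_nonneg fun _ => norm_nonneg _).trans h1

lemma ShiftBound.M_nonneg (h : ShiftBound r γ W M φ) : 0 ≤ M := (norm_nonneg _).trans (h.bound 0)

lemma ShiftBound.integrableOn_mul_kerK (h : ShiftBound r γ W M φ) (hε : 0 < ε) :
    IntegrableOn (fun t => φ t * (kerK ε t : ℂ)) (Set.Ioi γ) := by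
  have h1 := integrableOn_div_pow h.meas.norm (M := M)
    (fun t => by rw [abs_of_nonneg (norm_nonneg _)]; exact h.bound t) h.pos (n := 3) (by norm_num)
  refine Integrable.mono' (h1.const_mul (1 / ε ^ 2)) ?_ ?_
  · exact (h.meas.mul
      (Complex.measurable_ofReal.comp measurable_kerK).aestronglyMeasurable).restrict
  · refine (ae_restrict_iff' measurableSet_Ioi).2 (Eventually.of_forall fun t ht => ?_)
    have ht0 : 0 < t := h.pos.trans ht
    rw [norm_mul, Complex.norm_real, Real.norm_eq_abs]
    calc ‖φ t‖ * |kerK ε t| ≤ ‖φ t‖ * (1 / (ε ^ 2 * t ^ 3)) := by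
          gcongr; exact abs_kerK_le' hε ht0
      _ = _ := by field_simp

/-- Two passages to differences reduce the oscillating integral of `φ` to that of its
difference. -/
lemma ShiftBound.norm_integral_le (h : ShiftBound r γ W M φ) (hε : 0 < ε) {l : ℝ}
    (hl : 1 ≤ ‖1 - expi l γ‖) :
    ‖∫ t in Set.Ioi γ, φ t * (kerK ε t : ℂ) * expi l t‖ ≤
      ‖∫ t in Set.Ioi γ, (φ t - φ (t + γ)) * (kerK ε t : ℂ) * expi l t‖ + 4000 * W := by
  have hγ := h.pos
  have hW := h.W_nonneg
  have hM := h.M_nonneg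
  set F : ℝ → ℂ := fun t => φ t * (kerK ε t : ℂ) with hF
  have hFi : IntegrableOn F (Set.Ioi γ) := h.integrableOn_mul_kerK hε
  -- The difference of `φ · kerK` splits as `D + G`. The part `D` contains the difference of `φ` and
  -- is kept. The part `G` contains the difference of the kernel and is shifted once more, after
  -- which absolute values suffice.
  set G : ℝ → ℂ := fun t => φ (t + γ) * ((kerK ε t - kerK ε (t + γ) : ℝ) : ℂ) with hG
  have hφm := aestronglyMeasurable_comp_add h.meas
  have hKm : ∀ s : ℝ, Measurable fun t => kerK ε (t + s) := fun s =>
    measurable_kerK.comp (measurable_id.add_const s)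
  have hGb : ∀ t, 0 < t → ‖G t‖ ≤ 5 * γ * (‖φ (t + γ)‖ / t ^ 2) := by
    intro t ht
    rw [hG, norm_mul, Complex.norm_real, Real.norm_eq_abs]
    calc _ ≤ ‖φ (t + γ)‖ * (5 * γ / t ^ 2) := by gcongr; exact abs_kerK_sub_le hε ht hγ
      _ = _ := by ring
  have hGm : AEStronglyMeasurable G volume := (hφm γ).mul
    (Complex.measurable_ofReal.comp (measurable_kerK.sub (hKm γ))).aestronglyMeasurable
  have hdiv : ∀ s : ℝ, ∀ n : ℕ, 2 ≤ n →
      IntegrableOn (fun t => ‖φ (t + s)‖ / t ^ n) (Set.Ioi γ) := fun s n hn =>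
    integrableOn_div_pow (hφm s).norm (M := M)
      (fun t => by rw [abs_of_nonneg (norm_nonneg _)]; exact h.bound _) hγ hn
  have hGi : IntegrableOn G (Set.Ioi γ) := by
    refine Integrable.mono' ((hdiv γ 2 le_rfl).const_mul (5 * γ)) hGm.restrict ?_
    refine (ae_restrict_iff' measurableSet_Ioi).2 (Eventually.of_forall fun t ht => ?_)
    exact hGb t (hγ.trans ht)
  set D : ℝ → ℂ := fun t => (φ t - φ (t + γ)) * (kerK ε t : ℂ) with hD
  have hFD : ∀ t, F t - F (t + γ) = D t + G t := by
    intro t; simp only [hF, hD, hG]; push_cast; ring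
  have hDi : IntegrableOn D (Set.Ioi γ) := by
    have : D = fun t => (F t - F (t + γ)) - G t := by
      funext t; rw [hFD]; ring
    rw [this]
    exact (hFi.sub (integrableOn_Ioi_comp_add hγ.le hFi)).sub hGi
  have s1 := norm_integral_expi_le_shift hFi hγ hl
  have s2 := norm_integral_expi_le_shift hGi hγ hl
  have e1 : ∫ t in Set.Ioi γ, (F t - F (t + γ)) * expi l t =
      (∫ t in Set.Ioi γ, D t * expi l t) + ∫ t in Set.Ioi γ, G t * expi l t := by
    rw [← integral_add (integrableOn_mul_expi hDi l) (integrableOn_mul_expi hGi l)]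
    congr 1 with t
    rw [hFD, add_mul]
  -- boundary terms
  have hφi : ∀ s, IntegrableOn (fun t => ‖φ t‖) (Set.Ioc 0 s) := fun s =>
    Integrable.of_bound h.meas.norm.restrict M (Eventually.of_forall fun t => by
        rw [norm_norm]; exact h.bound t)
  have b1 : ∫ t in Set.Ioc γ (γ + γ), ‖F t‖ ≤ 8 * W := by
    calc _ ≤ ∫ t in Set.Ioc γ (γ + γ), ‖φ t‖ / γ := by
          refine setIntegral_mono_on ?_ ?_ measurableSet_Ioc fun t ht => ?_
          · exact (hFi.mono_set Set.Ioc_subset_Ioi_self).norm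
          · exact ((hφi (γ + γ)).mono_set (Set.Ioc_subset_Ioc_left hγ.le)).div_const _
          · have ht0 : 0 < t := hγ.trans ht.1
            rw [hF, norm_mul, Complex.norm_real, Real.norm_eq_abs, div_eq_mul_inv, ← one_div]
            gcongr
            refine (abs_kerK_le ht0).trans ?_
            gcongr
            exact ht.1.le
      _ = (∫ t in Set.Ioc γ (γ + γ), ‖φ t‖) / γ := integral_div _ _
      _ ≤ (∫ t in Set.Ioc 0 (γ + γ), ‖φ t‖) / γ := by
          refine div_le_div_of_nonneg_right ?_ hγ.le
          exact setIntegral_mono_set (hφi _) (Eventually.of_forall fun _ => norm_nonneg _)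
            (Set.Ioc_subset_Ioc_left hγ.le).eventuallyLE
      _ ≤ (2 * W / γ * (γ + γ) ^ 2) / γ := by gcongr; exact h.mean _ (by linarith)
      _ = 8 * W := by field_simp; ring
  have b2 : ∫ t in Set.Ioc γ (γ + γ), ‖G t‖ ≤ 90 * W := by
    have hi : IntegrableOn (fun t => ‖φ (t + γ)‖) (Set.Ioc γ (γ + γ)) :=
      Integrable.of_bound (hφm γ).norm.restrict M (Eventually.of_forall fun t => by
        rw [norm_norm]; exact h.bound _)
    calc _ ≤ ∫ t in Set.Ioc γ (γ + γ), 5 / γ * ‖φ (t + γ)‖ := by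
          refine setIntegral_mono_on ?_ (hi.const_mul _) measurableSet_Ioc fun t ht => ?_
          · exact (hGi.mono_set Set.Ioc_subset_Ioi_self).norm
          · have ht0 : 0 < t := hγ.trans ht.1
            have := ht.1.le
            calc ‖G t‖ ≤ 5 * γ * (‖φ (t + γ)‖ / t ^ 2) := hGb t ht0
              _ ≤ 5 * γ * (‖φ (t + γ)‖ / γ ^ 2) := by gcongr
              _ = _ := by field_simp
      _ = 5 / γ * ∫ t in Set.Ioc γ (γ + γ), ‖φ (t + γ)‖ := integral_const_mul _ _
      _ ≤ 5 / γ * ∫ t in Set.Ioc 0 (γ + γ + γ), ‖φ t‖ := by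
          gcongr
          exact integral_Ioc_comp_add_le (u := fun t => ‖φ t‖) h.meas.norm
            (fun _ => norm_nonneg _) h.bound hγ.le hγ.le
      _ ≤ 5 / γ * (2 * W / γ * (γ + γ + γ) ^ 2) := by gcongr; exact h.mean _ (by linarith)
      _ = 90 * W := by field_simp; ring
  have hdm : AEStronglyMeasurable (fun t => φ t - φ (t + γ)) volume := h.meas.sub (hφm γ)
  have hdb : ∀ t, ‖φ t - φ (t + γ)‖ ≤ M + M := fun t =>
    (norm_sub_le _ _).trans (add_le_add (h.bound _) (h.bound _))
  have c1 : ∫ t in Set.Ioi γ, ‖φ (t + γ) - φ (t + γ + γ)‖ / t ^ 2 ≤ 2 ^ 2 * (2 * W) / γ := by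
    refine integral_Ioi_div_pow_le (n := 1) (aestronglyMeasurable_comp_add hdm γ).norm
      (fun _ => norm_nonneg _) (M := M + M) (fun t => hdb _) hγ le_rfl fun s hs => ?_
    have h1 := integral_Ioc_comp_add_le (u := fun t => ‖φ t - φ (t + γ)‖) hdm.norm
      (fun _ => norm_nonneg _) hdb (a := 0) (s := s) le_rfl hγ.le
    refine h1.trans ((h.shift _ (by linarith)).trans ?_)
    rw [pow_one]; nlinarith
  have c2 : ∫ t in Set.Ioi γ, ‖φ (t + (γ + γ))‖ / t ^ 3 ≤ 2 ^ 3 * (18 * W / γ) / γ := by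
    refine integral_Ioi_div_pow_le (n := 2) (hφm (γ + γ)).norm
      (fun _ => norm_nonneg _) (M := M) (fun t => h.bound _) hγ (by norm_num) fun s hs => ?_
    have h1 := integral_Ioc_comp_add_le (u := fun t => ‖φ t‖) h.meas.norm
      (fun _ => norm_nonneg _) h.bound (a := 0) (s := s) (γ := γ + γ) le_rfl (by linarith)
    refine h1.trans ((h.mean _ (by linarith)).trans ?_)
    calc 2 * W / γ * (s + (γ + γ)) ^ 2 ≤ 2 * W / γ * (3 * s) ^ 2 := by
          gcongr <;> linarith
      _ = _ := by ring
  have hdi : IntegrableOn (fun t => ‖φ (t + γ) - φ (t + γ + γ)‖ / t ^ 2) (Set.Ioi γ) :=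
    integrableOn_div_pow (aestronglyMeasurable_comp_add hdm γ).norm (M := M + M)
      (fun t => by rw [abs_of_nonneg (norm_nonneg _)]; exact hdb _) hγ le_rfl
  have b3 : ‖∫ t in Set.Ioi γ, (G t - G (t + γ)) * expi l t‖ ≤ 3784 * W := by
    calc _ ≤ ∫ t in Set.Ioi γ, (5 * γ * (‖φ (t + γ) - φ (t + γ + γ)‖ / t ^ 2) +
          26 * γ ^ 2 * (‖φ (t + (γ + γ))‖ / t ^ 3)) := by
          refine norm_integral_le_of_norm_le ((hdi.const_mul _).add
            ((hdiv (γ + γ) 3 (by norm_num)).const_mul _)) ?_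
          refine (ae_restrict_iff' measurableSet_Ioi).2 (Eventually.of_forall fun t ht => ?_)
          have ht0 : 0 < t := hγ.trans ht
          have e : G t - G (t + γ) = (φ (t + γ) - φ (t + γ + γ)) *
              ((kerK ε t - kerK ε (t + γ) : ℝ) : ℂ) + φ (t + (γ + γ)) *
              (((kerK ε t - kerK ε (t + γ)) - (kerK ε (t + γ) - kerK ε (t + γ + γ)) : ℝ) : ℂ) := by
            simp only [hG]; rw [← add_assoc]; push_cast; ring
          rw [norm_mul, norm_expi, mul_one, e]
          refine (norm_add_le _ _).trans ?_
          rw [norm_mul, norm_mul, Complex.norm_real, Complex.norm_real, Real.norm_eq_abs,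
            Real.norm_eq_abs]
          calc _ ≤ ‖φ (t + γ) - φ (t + γ + γ)‖ * (5 * γ / t ^ 2) +
                ‖φ (t + (γ + γ))‖ * (26 * γ ^ 2 / t ^ 3) := by
                gcongr
                · exact abs_kerK_sub_le hε ht0 hγ
                · exact abs_kerK_second_sub_le hε ht0 hγ
            _ = _ := by ring
      _ = 5 * γ * (∫ t in Set.Ioi γ, ‖φ (t + γ) - φ (t + γ + γ)‖ / t ^ 2) +
          26 * γ ^ 2 * ∫ t in Set.Ioi γ, ‖φ (t + (γ + γ))‖ / t ^ 3 := by
          rw [integral_add (hdi.const_mul _) ((hdiv (γ + γ) 3 (by norm_num)).const_mul _),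
            integral_const_mul, integral_const_mul]
      _ ≤ 5 * γ * (2 ^ 2 * (2 * W) / γ) + 26 * γ ^ 2 * (2 ^ 3 * (18 * W / γ) / γ) := by gcongr
      _ = 3784 * W := by field_simp; ring
  -- The two boundary pieces and the twice shifted term add up to `(8 + 90 + 3784) W ≤ 4000 W`.
  rw [e1] at s1
  have s3 := norm_add_le (∫ t in Set.Ioi γ, D t * expi l t) (∫ t in Set.Ioi γ, G t * expi l t)
  linarith

end shift

/-- The extra factor `1 / (t + T)` is designed to cancel the length `l + T` in Bessel's inequality
on `(l, 2l]`, which for short intervals is much larger than `l`. -/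
lemma abs_kerK_le_div {ε : ℝ} (hε : 0 < ε) {T : ℝ} (hT : 0 < T) {t : ℝ} (ht : 0 < t) :
    |kerK ε t| ≤ (1 + T) * (1 + 1 / ε ^ 2) / (t * (t + T)) := by
  have hε2 : 0 < 1 / ε ^ 2 := by positivity
  rw [le_div_iff₀ (by positivity)]
  rcases le_total t 1 with h1 | h1
  · calc |kerK ε t| * (t * (t + T)) ≤ 1 / t * (t * (t + T)) := by gcongr; exact abs_kerK_le ht
      _ = t + T := by field_simp
      _ ≤ 1 + T := by linarith
      _ ≤ (1 + T) * (1 + 1 / ε ^ 2) := le_mul_of_one_le_right (by positivity) (by linarith)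
  · calc |kerK ε t| * (t * (t + T)) ≤ 1 / (ε ^ 2 * t ^ 3) * (t * (t + T)) := by
          gcongr; exact abs_kerK_le' hε ht
      _ = (t + T) / t ^ 2 * (1 / ε ^ 2) := by field_simp
      _ ≤ (1 + T) * (1 / ε ^ 2) := by
          gcongr
          rw [div_le_iff₀ (by positivity)]
          nlinarith [mul_le_mul_of_nonneg_left (one_le_pow₀ h1 (n := 2)) hT.le]
      _ ≤ (1 + T) * (1 + 1 / ε ^ 2) := by gcongr; linarith

/-- The `ℓ^Q` estimate of the oscillating integrals of the difference of `φ`. -/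
theorem exists_lqNorm_integral_shift_le {β r ε : ℝ} (hβ : 0 < β) (hε : 0 < ε) (hr : 1 < r) {Q : ℕ}
    (hQ : 2 ≤ Q) (hrQ : 1 < (r - 1) * ((Q : ℝ) - 1)) :
    ∃ A : ℝ, 0 ≤ A ∧ ∀ (ι : Type) (S : Finset ι) (κ : ι → ℤ), Function.Injective κ →
      ∀ (θ γ W M : ℝ) (φ : ℝ → ℂ), ShiftBound r γ W M φ →
      lqNorm Q S (fun k => ∫ t in Set.Ioi γ,
        (φ t - φ (t + γ)) * (kerK ε t : ℂ) * expi (β * κ k + θ) t) ≤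
        A * W * (1 / γ) ^ (1 / (Q : ℝ)) := by
  obtain ⟨A, hA0, hA⟩ := exists_lqNorm_integral_expi_le hβ hr hQ hrQ
  have hQ0 : (0 : ℝ) < Q := by exact_mod_cast (by omega : 0 < Q)
  set T := 2 * Real.pi / β with hT
  have hTpos : 0 < T := by positivity
  set B := (1 + T) * (1 + 1 / ε ^ 2) with hB
  have hB0 : 0 < B := by positivity
  set ξ : ℝ := (1 / 2) ^ (1 / (Q : ℝ)) with hξ
  have hξ0 : 0 < ξ := by positivity
  have hξ1 : ξ < 1 := Real.rpow_lt_one (by norm_num) (by norm_num) (by positivity)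
  have hZ : 0 < 1 - ξ := by linarith
  refine ⟨2 * A * B ^ (1 / (Q : ℝ)) * (1 - ξ)⁻¹, by positivity, ?_⟩
  intro ι S κ hκ θ γ W M φ h
  have hγ := h.pos
  have hW := h.W_nonneg
  have hM := h.M_nonneg
  have hdm : AEStronglyMeasurable (fun t => φ t - φ (t + γ)) volume :=
    h.meas.sub (aestronglyMeasurable_comp_add h.meas γ)
  have hdb : ∀ t, ‖φ t - φ (t + γ)‖ ≤ M + M := fun t =>
    (norm_sub_le _ _).trans (add_le_add (h.bound _) (h.bound _))
  set D : ℝ → ℂ := fun t => (φ t - φ (t + γ)) * (kerK ε t : ℂ) with hD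
  have hDm : AEStronglyMeasurable D volume :=
    hdm.mul (Complex.measurable_ofReal.comp measurable_kerK).aestronglyMeasurable
  have hDi : IntegrableOn D (Set.Ioi γ) := by
    have h1 := integrableOn_div_pow hdm.norm (M := M + M)
      (fun t => by rw [abs_of_nonneg (norm_nonneg _)]; exact hdb t) hγ (n := 3) (by norm_num)
    refine Integrable.mono' (h1.const_mul (1 / ε ^ 2)) hDm.restrict ?_
    refine (ae_restrict_iff' measurableSet_Ioi).2 (Eventually.of_forall fun t ht => ?_)
    have ht0 : 0 < t := hγ.trans ht
    rw [hD, norm_mul, Complex.norm_real, Real.norm_eq_abs]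
    calc _ ≤ ‖φ t - φ (t + γ)‖ * (1 / (ε ^ 2 * t ^ 3)) := by
          gcongr; exact abs_kerK_le' hε ht0
      _ = _ := by field_simp
  set u : ℝ → ℂ := (Set.Ioi γ).indicator D with hu
  have hum : AEStronglyMeasurable u volume := hDm.indicator measurableSet_Ioi
  have hub : ∀ t, ‖u t‖ ≤ (M + M) * (1 / γ) := by
    intro t
    by_cases ht : t ∈ Set.Ioi γ
    · rw [hu, Set.indicator_of_mem ht, hD, norm_mul, Complex.norm_real, Real.norm_eq_abs]
      have ht' : γ < t := ht
      gcongr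
      · exact hdb t
      · exact (abs_kerK_le (hγ.trans ht')).trans (by gcongr)
    · rw [hu, Set.indicator_of_notMem ht, norm_zero]; positivity
  -- one dyadic interval
  have hpiece : ∀ j : ℕ, lqNorm Q S (fun k => ∫ t in Set.Ioc (2 ^ j * γ) (2 ^ j * γ + 2 ^ j * γ),
      D t * expi (β * κ k + θ) t) ≤
      2 * A * B ^ (1 / (Q : ℝ)) * W * (1 / γ) ^ (1 / (Q : ℝ)) * ξ ^ j := by
    intro j
    set l := (2 : ℝ) ^ j * γ with hl
    have hl0 : 0 < l := by positivity
    have hγl : γ ≤ l := le_mul_of_one_le_left hγ.le (one_le_pow₀ (by norm_num))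
    have hsub : Set.Ioc l (l + l) ⊆ Set.Ioi γ := fun t ht => hγl.trans_lt ht.1
    -- Of the `Q` factors `k₀` in the `Q`-th power, `Q - 1` are estimated by `1/l`, absorbing
    -- `l^(Q-1)`. The last one is estimated by the second entry, absorbing `l + T`. What remains is
    -- `B/l`, geometric in `j`.
    set k₀ := min (1 / l) (B / (l * (l + T))) with hk₀
    have hk₀0 : 0 < k₀ := lt_min (by positivity) (by positivity)
    have hKle : ∀ t ∈ Set.Ioc l (l + l), |kerK ε t| ≤ k₀ := by
      intro t ht
      have hlt := ht.1.le
      have ht0 : 0 < t := hl0.trans ht.1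
      refine le_min ((abs_kerK_le ht0).trans (by gcongr)) ((abs_kerK_le_div hε hTpos ht0).trans ?_)
      gcongr
    have hdr : IntegrableOn (fun t => ‖φ t - φ (t + γ)‖ ^ r) (Set.Ioc 0 (l + l)) := by
      refine Integrable.of_bound ?_ ((M + M) ^ r) (Eventually.of_forall fun t => ?_)
      · exact (hdm.norm.aemeasurable.pow_const r).aestronglyMeasurable.restrict
      · rw [Real.norm_of_nonneg (by positivity)]
        exact Real.rpow_le_rpow (norm_nonneg _) (hdb t) (by linarith)
    have hmean : ∫ t in Set.Ioc l (l + l), ‖u t‖ ^ r ≤ l * (2 * k₀ * W) ^ r := by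
      calc ∫ t in Set.Ioc l (l + l), ‖u t‖ ^ r
          ≤ ∫ t in Set.Ioc l (l + l), k₀ ^ r * ‖φ t - φ (t + γ)‖ ^ r := by
            refine setIntegral_mono_on ?_ ?_ measurableSet_Ioc fun t ht => ?_
            · refine Integrable.of_bound ?_ (((M + M) * (1 / γ)) ^ r)
                (Eventually.of_forall fun t => ?_)
              · exact (hum.norm.aemeasurable.pow_const r).aestronglyMeasurable.restrict
              · rw [Real.norm_of_nonneg (by positivity)]
                exact Real.rpow_le_rpow (norm_nonneg _) (hub t) (by linarith)
            · exact (hdr.mono_set (Set.Ioc_subset_Ioc_left hl0.le)).const_mul _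
            · rw [hu, Set.indicator_of_mem (hsub ht), hD, norm_mul, Complex.norm_real,
                Real.norm_eq_abs, mul_comm, Real.mul_rpow (abs_nonneg _) (norm_nonneg _)]
              gcongr
              exact hKle t ht
        _ = k₀ ^ r * ∫ t in Set.Ioc l (l + l), ‖φ t - φ (t + γ)‖ ^ r := integral_const_mul _ _
        _ ≤ k₀ ^ r * ∫ t in Set.Ioc 0 (l + l), ‖φ t - φ (t + γ)‖ ^ r := by
            refine mul_le_mul_of_nonneg_left ?_ (by positivity)
            exact setIntegral_mono_set hdr (Eventually.of_forall fun _ => by positivity)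
              (Set.Ioc_subset_Ioc_left hl0.le).eventuallyLE
        _ ≤ k₀ ^ r * ((l + l) * W ^ r) := by gcongr; exact h.shift_rpow _ (by linarith)
        _ = l * (2 ^ (1 : ℝ) * k₀ ^ r * W ^ r) := by rw [Real.rpow_one]; ring
        _ ≤ l * (2 ^ r * k₀ ^ r * W ^ r) := by
            gcongr
            · norm_num
        _ = l * (2 * k₀ * W) ^ r := by
            rw [Real.mul_rpow (by positivity) hW, Real.mul_rpow (by norm_num) hk₀0.le]
    have h1 := hA ι S κ hκ l l θ (2 * k₀ * W) _ u hl0 (by positivity) hum.restrict hub hmean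
    have h2 : (fun k => ∫ t in Set.Ioc l (l + l), u t * expi (β * κ k + θ) t) =
        fun k => ∫ t in Set.Ioc l (l + l), D t * expi (β * κ k + θ) t := by
      funext k
      refine setIntegral_congr_fun measurableSet_Ioc fun t ht => ?_
      simp only [hu, Set.indicator_of_mem (hsub ht)]
    rw [h2] at h1
    refine h1.trans ?_
    have h3 : k₀ * (l ^ (Q - 1) * (l + T)) ^ (1 / (Q : ℝ)) ≤ (B / l) ^ (1 / (Q : ℝ)) := by
      have e : k₀ = (k₀ ^ Q) ^ (1 / (Q : ℝ)) := by
        rw [← Real.rpow_natCast, ← Real.rpow_mul hk₀0.le, mul_one_div_cancel hQ0.ne', Real.rpow_one]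
      rw [e, ← Real.mul_rpow (by positivity) (by positivity)]
      gcongr
      have e2 : k₀ ^ Q = k₀ ^ (Q - 1) * k₀ := by
        rw [← pow_succ]; congr 1; omega
      calc k₀ ^ Q * (l ^ (Q - 1) * (l + T)) = (k₀ * l) ^ (Q - 1) * (k₀ * (l + T)) := by
            rw [e2, mul_pow]; ring
        _ ≤ 1 * (B / (l * (l + T)) * (l + T)) := by
            gcongr
            · refine pow_le_one₀ (by positivity) ?_
              calc k₀ * l ≤ 1 / l * l := by gcongr; exact min_le_left _ _
                _ = 1 := by field_simp
            · exact min_le_right _ _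
        _ = B / l := by field_simp
    have h4 : (B / l) ^ (1 / (Q : ℝ)) =
        B ^ (1 / (Q : ℝ)) * (1 / γ) ^ (1 / (Q : ℝ)) * ξ ^ j := by
      have e : ξ ^ j = ((1 / 2) ^ j) ^ (1 / (Q : ℝ)) := by
        rw [hξ, ← Real.rpow_natCast, ← Real.rpow_natCast, ← Real.rpow_mul (by norm_num),
          ← Real.rpow_mul (by norm_num), mul_comm]
      rw [e, ← Real.mul_rpow (by positivity) (by positivity),
        ← Real.mul_rpow (by positivity) (by positivity)]
      congr 1
      rw [hl, one_div_pow]; field_simp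
    calc A * (2 * k₀ * W) * (l ^ (Q - 1) * (l + T)) ^ (1 / (Q : ℝ))
        = 2 * A * W * (k₀ * (l ^ (Q - 1) * (l + T)) ^ (1 / (Q : ℝ))) := by ring
      _ ≤ 2 * A * W * (B ^ (1 / (Q : ℝ)) * (1 / γ) ^ (1 / (Q : ℝ)) * ξ ^ j) := by
          rw [← h4]; gcongr
      _ = _ := by ring
  have hgeo : ∀ N, ∑ j ∈ Finset.range N, ξ ^ j ≤ (1 - ξ)⁻¹ := by
    intro N
    rw [← tsum_geometric_of_lt_one hξ0.le hξ1]
    exact (summable_geometric_of_lt_one hξ0.le hξ1).sum_le_tsum _ (fun _ _ => by positivity)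
  have htend : Tendsto (fun N : ℕ => (2 : ℝ) ^ N * γ) atTop atTop :=
    (tendsto_pow_atTop_atTop_of_one_lt (by norm_num)).atTop_mul_const hγ
  have hDe : ∀ l, IntegrableOn (fun t => D t * expi l t) (Set.Ioi γ) := integrableOn_mul_expi hDi
  have hlim : Tendsto (fun N : ℕ => lqNorm Q S (fun k => ∫ t in γ..(2 ^ N * γ),
      D t * expi (β * κ k + θ) t)) atTop
      (𝓝 (lqNorm Q S (fun k => ∫ t in Set.Ioi γ, D t * expi (β * κ k + θ) t))) := by
    unfold lqNorm
    refine Tendsto.rpow_const ?_ (Or.inr (by positivity))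
    refine tendsto_finsetSum _ fun k _ => ?_
    exact ((intervalIntegral_tendsto_integral_Ioi γ (hDe _) htend).norm).pow Q
  refine le_of_tendsto' hlim fun N => ?_
  have hpow : ∀ k : ℕ, γ ≤ 2 ^ k * γ := fun k =>
    le_mul_of_one_le_left hγ.le (one_le_pow₀ (by norm_num))
  have hdec : (fun k => ∫ t in γ..(2 ^ N * γ), D t * expi (β * κ k + θ) t) = fun k =>
      ∑ j ∈ Finset.range N, ∫ t in Set.Ioc (2 ^ j * γ) (2 ^ j * γ + 2 ^ j * γ),
        D t * expi (β * κ k + θ) t := by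
    funext k
    have hsum := intervalIntegral.sum_integral_adjacent_intervals
      (a := fun j : ℕ => (2 : ℝ) ^ j * γ) (n := N) (f := fun t => D t * expi (β * κ k + θ) t)
      (μ := volume) (fun j _ => by
        rw [intervalIntegrable_iff_integrableOn_Ioc_of_le (by
          rw [pow_succ]; have := hpow j; linarith)]
        exact (hDe _).mono_set (Set.Ioc_subset_Ioi_self.trans (Set.Ioi_subset_Ioi (hpow j))))
    simp only [pow_zero, one_mul] at hsum
    rw [← hsum]
    refine Finset.sum_congr rfl fun j _ => ?_
    rw [intervalIntegral.integral_of_le (by rw [pow_succ]; have := hpow j; linarith)]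
    congr 3
    rw [pow_succ]; ring
  rw [hdec]
  refine (lqNorm_sum_le (by omega) _ _).trans ((Finset.sum_le_sum fun j _ => hpiece j).trans ?_)
  rw [← Finset.mul_sum]
  calc _ ≤ 2 * A * B ^ (1 / (Q : ℝ)) * W * (1 / γ) ^ (1 / (Q : ℝ)) * (1 - ξ)⁻¹ := by
        gcongr; exact hgeo N
    _ = _ := by ring

lemma integrableOn_mul_sin_mul_kerK {M ε : ℝ} {φ : ℝ → ℂ} (hm : AEStronglyMeasurable φ volume)
    (hb : ∀ t, ‖φ t‖ ≤ M) (hε : 0 < ε) (ρ : ℝ) :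
    IntegrableOn (fun t => φ t * ((Real.sin (ρ * t) * kerK ε t : ℝ) : ℂ)) (Set.Ioi 0) := by
  have h1 := (integrableOn_sin_mul_kerK hε ρ).ofReal (𝕜 := ℂ)
  exact h1.bdd_mul hm.restrict (Eventually.of_forall hb)

/-- `|1 - e^{iθ}|² = 2 - 2 cos θ`, which is at least `1` as soon as `cos θ ≤ 1/2`. -/
lemma one_le_norm_one_sub_expi {l γ : ℝ} (h1 : Real.pi / 3 ≤ l * γ) (h2 : l * γ ≤ 4 * Real.pi / 3) :
    1 ≤ ‖1 - expi l γ‖ := by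
  have hre : (expi l γ).re = Real.cos (l * γ) := by
    rw [expi_eq, Complex.exp_ofReal_mul_I_re]
  have hcos : Real.cos (l * γ) ≤ 1 / 2 := by
    have hpi := Real.pi_pos
    rcases le_total (l * γ) Real.pi with h | h
    · rw [← Real.cos_pi_div_three]
      exact Real.cos_le_cos_of_nonneg_of_le_pi (by positivity) h h1
    · refine (Real.cos_nonpos_of_pi_div_two_le_of_le (by linarith) (by linarith)).trans (by norm_num)
  have h3 : ‖1 - expi l γ‖ ^ 2 = 2 - 2 * Real.cos (l * γ) := by
    have h4 : (expi l γ).re ^ 2 + (expi l γ).im ^ 2 = 1 := by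
      have := norm_expi l γ
      rw [← sq_eq_sq₀ (norm_nonneg _) zero_le_one, Complex.sq_norm, Complex.normSq_apply] at this
      linarith
    rw [Complex.sq_norm, Complex.normSq_apply, ← hre]
    simp only [Complex.sub_re, Complex.one_re, Complex.sub_im, Complex.one_im]
    linarith
  nlinarith [norm_nonneg (1 - expi l γ)]

lemma norm_one_sub_expi_neg (l γ : ℝ) : ‖1 - expi (-l) γ‖ = ‖1 - expi l γ‖ := by
  have h : expi (-l) γ * expi l γ = 1 := by rw [← expi_add_left]; simp
  have : 1 - expi (-l) γ = -(expi (-l) γ * (1 - expi l γ)) := by linear_combination -h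
  rw [this, norm_neg, norm_mul, norm_expi, one_mul]

/-- Pointwise reduction of the singular integral to the oscillating integrals of the difference. -/
lemma ShiftBound.norm_integral_sin_le {r γ W M ε : ℝ} {φ : ℝ → ℂ} (h : ShiftBound r γ W M φ)
    (hε : 0 < ε) {ρ : ℝ} (h1 : Real.pi / 3 ≤ ρ * γ) (h2 : ρ * γ ≤ 4 * Real.pi / 3) :
    ‖∫ t in Set.Ioi (0 : ℝ), φ t * ((Real.sin (ρ * t) * kerK ε t : ℝ) : ℂ)‖ ≤
      5000 * W +
      ‖∫ t in Set.Ioi γ, (φ t - φ (t + γ)) * (kerK ε t : ℂ) * expi ρ t‖ +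
      ‖∫ t in Set.Ioi γ, (φ t - φ (t + γ)) * (kerK ε t : ℂ) * expi (-ρ) t‖ := by
  have hγ := h.pos
  have hW := h.W_nonneg
  have hρ : 0 < ρ := by
    have : 0 < ρ * γ := lt_of_lt_of_le (by positivity) h1
    exact pos_of_mul_pos_left this hγ.le
  have hang := one_le_norm_one_sub_expi h1 h2
  have hJ1 := h.norm_integral_le hε hang
  have hJ2 := h.norm_integral_le hε (l := -ρ) (by rw [norm_one_sub_expi_neg]; exact hang)
  have hintg := integrableOn_mul_sin_mul_kerK h.meas h.bound hε ρ
  have hsplit : ∫ t in Set.Ioi (0 : ℝ), φ t * ((Real.sin (ρ * t) * kerK ε t : ℝ) : ℂ) =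
      (∫ t in Set.Ioc 0 γ, φ t * ((Real.sin (ρ * t) * kerK ε t : ℝ) : ℂ)) +
      ∫ t in Set.Ioi γ, φ t * ((Real.sin (ρ * t) * kerK ε t : ℝ) : ℂ) := by
    rw [← setIntegral_union (Set.Ioc_disjoint_Ioi le_rfl) measurableSet_Ioi
      (hintg.mono_set Set.Ioc_subset_Ioi_self) (hintg.mono_set (Set.Ioi_subset_Ioi hγ.le)),
      Set.Ioc_union_Ioi_eq_Ioi hγ.le]
  have hnear : ‖∫ t in Set.Ioc 0 γ, φ t * ((Real.sin (ρ * t) * kerK ε t : ℝ) : ℂ)‖ ≤ 10 * W := by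
    have hφi : IntegrableOn (fun t => ‖φ t‖) (Set.Ioc 0 γ) :=
      Integrable.of_bound h.meas.norm.restrict M (Eventually.of_forall fun t => by
        rw [norm_norm]; exact h.bound t)
    calc _ ≤ ∫ t in Set.Ioc 0 γ, ρ * ‖φ t‖ := by
          refine norm_integral_le_of_norm_le (hφi.const_mul _) ?_
          refine (ae_restrict_iff' measurableSet_Ioc).2 (Eventually.of_forall fun t ht => ?_)
          rw [norm_mul, Complex.norm_real, Real.norm_eq_abs, mul_comm, abs_mul]
          gcongr
          calc |Real.sin (ρ * t)| * |kerK ε t| ≤ (ρ * t) * (1 / t) := by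
                gcongr
                · exact mul_nonneg hρ.le ht.1.le
                · exact abs_sin_mul_le hρ ht.1
                · exact abs_kerK_le ht.1
            _ = ρ := by have := ht.1.ne'; field_simp
      _ = ρ * ∫ t in Set.Ioc 0 γ, ‖φ t‖ := integral_const_mul _ _
      _ ≤ ρ * (2 * W / γ * γ ^ 2) := by gcongr; exact h.mean γ le_rfl
      _ = 2 * (ρ * γ) * W := by field_simp
      _ ≤ 2 * 5 * W := by
          gcongr
          have := Real.pi_lt_d2
          linarith
      _ = 10 * W := by ring
  have hfar : ∫ t in Set.Ioi γ, φ t * ((Real.sin (ρ * t) * kerK ε t : ℝ) : ℂ) =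
      (2 * Complex.I)⁻¹ * ((∫ t in Set.Ioi γ, φ t * (kerK ε t : ℂ) * expi ρ t) -
        ∫ t in Set.Ioi γ, φ t * (kerK ε t : ℂ) * expi (-ρ) t) := by
    have hi := h.integrableOn_mul_kerK hε
    rw [← integral_sub (integrableOn_mul_expi hi _) (integrableOn_mul_expi hi _),
      ← integral_const_mul]
    congr 1 with t
    have : expi ρ t - expi (-ρ) t = 2 * Complex.I * (Real.sin (ρ * t) : ℂ) := by
      rw [expi_eq, expi_eq, Complex.exp_mul_I, Complex.exp_mul_I, neg_mul, Complex.ofReal_neg,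
        Complex.cos_neg, Complex.sin_neg, Complex.ofReal_sin]
      ring
    rw [← mul_sub, this]
    push_cast
    field_simp
  rw [hsplit, hfar]
  -- The piece over `(0, γ]` gives `10 W`, and the two exponentials, weighted by `1/2`, give `4000
  -- W`; `5000 W` is a rounded total.
  refine (norm_add_le _ _).trans ?_
  rw [norm_mul, norm_inv, norm_mul, Complex.norm_two, Complex.norm_I, mul_one]
  have h5 := norm_sub_le (∫ t in Set.Ioi γ, φ t * (kerK ε t : ℂ) * expi ρ t)
    (∫ t in Set.Ioi γ, φ t * (kerK ε t : ℂ) * expi (-ρ) t)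
  have h6 := norm_nonneg (∫ t in Set.Ioi γ, (φ t - φ (t + γ)) * (kerK ε t : ℂ) * expi ρ t)
  have h7 := norm_nonneg (∫ t in Set.Ioi γ, (φ t - φ (t + γ)) * (kerK ε t : ℂ) * expi (-ρ) t)
  linarith

/-- The `ℓ^Q` estimate of the singular integrals over a block of frequencies, each of which lies on
one of two arithmetic progressions. -/
theorem exists_lqNorm_integral_sin_le {β r ε : ℝ} (θ : ℝ) (hβ : 0 < β) (hε : 0 < ε) (hr : 1 < r)
    {Q : ℕ} (hQ : 2 ≤ Q) (hrQ : 1 < (r - 1) * ((Q : ℝ) - 1)) :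
    ∃ A : ℝ, 0 ≤ A ∧ ∀ (S : Finset ℕ) (ρ : ℕ → ℝ) (γ W M : ℝ) (φ : ℝ → ℂ),
      ShiftBound r γ W M φ →
      (∀ k ∈ S, ρ k = β * k + θ ∨ ρ k = β * k - θ) →
      (∀ k ∈ S, Real.pi / 3 ≤ ρ k * γ ∧ ρ k * γ ≤ 4 * Real.pi / 3) →
      lqNorm Q S (fun k => ∫ t in Set.Ioi (0 : ℝ),
        φ t * ((Real.sin (ρ k * t) * kerK ε t : ℝ) : ℂ)) ≤
        A * W * ((S.card : ℝ) ^ (1 / (Q : ℝ)) + (1 / γ) ^ (1 / (Q : ℝ))) := by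
  obtain ⟨A, hA0, hA⟩ := exists_lqNorm_integral_shift_le hβ hε hr hQ hrQ
  have hQ0 : (0 : ℝ) < Q := by exact_mod_cast (by omega : 0 < Q)
  have hQ1 : 1 ≤ Q := by omega
  refine ⟨5000 + 4 * A, by positivity, ?_⟩
  intro S ρ γ W M φ h hρ hang
  have hW := h.W_nonneg
  have hγ := h.pos
  set E : ℝ → ℂ := fun l => ∫ t in Set.Ioi γ, (φ t - φ (t + γ)) * (kerK ε t : ℂ) * expi l t with hE
  have hκ1 : Function.Injective (fun k : ℕ => (k : ℤ)) := Nat.cast_injective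
  have hκ2 : Function.Injective (fun k : ℕ => -(k : ℤ)) := fun a b hab => by simpa using hab
  have a1 := hA ℕ S _ hκ1 θ γ W M φ h
  have a2 := hA ℕ S _ hκ1 (-θ) γ W M φ h
  have a3 := hA ℕ S _ hκ2 θ γ W M φ h
  have a4 := hA ℕ S _ hκ2 (-θ) γ W M φ h
  have a0 : lqNorm Q S (fun _ => ((5000 * W : ℝ) : ℂ)) = 5000 * W * (S.card : ℝ) ^ (1 / (Q : ℝ)) := by
    unfold lqNorm
    rw [Finset.sum_const, nsmul_eq_mul, Complex.norm_real, Real.norm_of_nonneg (by positivity),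
      Real.mul_rpow (by positivity) (by positivity), ← Real.rpow_natCast,
      ← Real.rpow_mul (by positivity), mul_one_div_cancel hQ0.ne', Real.rpow_one, mul_comm]
  -- The numbers `±ρ k` lie among `±βk ± θ`. Bounding by all four families at once avoids splitting
  -- `S` according to the sign in `hρ`, and each family has equidistant frequencies.
  have hmain : ∀ k ∈ S, ‖∫ t in Set.Ioi (0 : ℝ),
      φ t * ((Real.sin (ρ k * t) * kerK ε t : ℝ) : ℂ)‖ ≤ 5000 * W +
        (‖E (β * ((k : ℤ) : ℝ) + θ)‖ + (‖E (β * ((k : ℤ) : ℝ) + -θ)‖ +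
        (‖E (β * ((-(k : ℤ) : ℤ) : ℝ) + θ)‖ + ‖E (β * ((-(k : ℤ) : ℤ) : ℝ) + -θ)‖))) := by
    intro k hk
    have h0 := h.norm_integral_sin_le hε (hang k hk).1 (hang k hk).2
    have n1 := norm_nonneg (E (β * ((k : ℤ) : ℝ) + θ))
    have n2 := norm_nonneg (E (β * ((k : ℤ) : ℝ) + -θ))
    have n3 := norm_nonneg (E (β * ((-(k : ℤ) : ℤ) : ℝ) + θ))
    have n4 := norm_nonneg (E (β * ((-(k : ℤ) : ℤ) : ℝ) + -θ))
    rcases hρ k hk with e | e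
    · have e1 : ρ k = β * ((k : ℤ) : ℝ) + θ := by rw [e]; push_cast; ring
      have e2 : -ρ k = β * ((-(k : ℤ) : ℤ) : ℝ) + -θ := by rw [e]; push_cast; ring
      have f1 : ‖E (ρ k)‖ = ‖E (β * ((k : ℤ) : ℝ) + θ)‖ := by rw [e1]
      have f2 : ‖E (-ρ k)‖ = ‖E (β * ((-(k : ℤ) : ℤ) : ℝ) + -θ)‖ := by rw [e2]
      have : ‖∫ t in Set.Ioi (0 : ℝ), φ t * ((Real.sin (ρ k * t) * kerK ε t : ℝ) : ℂ)‖ ≤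
        5000 * W + ‖E (ρ k)‖ + ‖E (-ρ k)‖ := h0
      linarith
    · have e1 : ρ k = β * ((k : ℤ) : ℝ) + -θ := by rw [e]; push_cast; ring
      have e2 : -ρ k = β * ((-(k : ℤ) : ℤ) : ℝ) + θ := by rw [e]; push_cast; ring
      have f1 : ‖E (ρ k)‖ = ‖E (β * ((k : ℤ) : ℝ) + -θ)‖ := by rw [e1]
      have f2 : ‖E (-ρ k)‖ = ‖E (β * ((-(k : ℤ) : ℤ) : ℝ) + θ)‖ := by rw [e2]
      have : ‖∫ t in Set.Ioi (0 : ℝ), φ t * ((Real.sin (ρ k * t) * kerK ε t : ℝ) : ℂ)‖ ≤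
        5000 * W + ‖E (ρ k)‖ + ‖E (-ρ k)‖ := h0
      linarith
  have hn : ∀ x : ℂ, ‖((‖x‖ : ℝ) : ℂ)‖ = ‖x‖ := fun x => by simp
  have l4 := lqNorm_le_add (S := S) hQ1
    (c := fun k : ℕ => ((‖E (β * ((-(k : ℤ) : ℤ) : ℝ) + θ)‖ +
      ‖E (β * ((-(k : ℤ) : ℤ) : ℝ) + -θ)‖ : ℝ) : ℂ))
    (d := fun k : ℕ => E (β * ((-(k : ℤ) : ℤ) : ℝ) + θ))
    (e := fun k : ℕ => E (β * ((-(k : ℤ) : ℤ) : ℝ) + -θ))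
    (fun k _ => by rw [Complex.norm_real, Real.norm_of_nonneg (by positivity)])
  have l3 := lqNorm_le_add (S := S) hQ1
    (c := fun k : ℕ => ((‖E (β * ((k : ℤ) : ℝ) + -θ)‖ + (‖E (β * ((-(k : ℤ) : ℤ) : ℝ) + θ)‖ +
      ‖E (β * ((-(k : ℤ) : ℤ) : ℝ) + -θ)‖) : ℝ) : ℂ))
    (d := fun k : ℕ => E (β * ((k : ℤ) : ℝ) + -θ))
    (e := fun k : ℕ => ((‖E (β * ((-(k : ℤ) : ℤ) : ℝ) + θ)‖ +
      ‖E (β * ((-(k : ℤ) : ℤ) : ℝ) + -θ)‖ : ℝ) : ℂ))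
    (fun k _ => by
      rw [Complex.norm_real, Complex.norm_real, Real.norm_of_nonneg (by positivity),
        Real.norm_of_nonneg (by positivity)])
  have l2 := lqNorm_le_add (S := S) hQ1
    (c := fun k : ℕ => ((‖E (β * ((k : ℤ) : ℝ) + θ)‖ + (‖E (β * ((k : ℤ) : ℝ) + -θ)‖ +
      (‖E (β * ((-(k : ℤ) : ℤ) : ℝ) + θ)‖ + ‖E (β * ((-(k : ℤ) : ℤ) : ℝ) + -θ)‖)) : ℝ) : ℂ))
    (d := fun k : ℕ => E (β * ((k : ℤ) : ℝ) + θ))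
    (e := fun k : ℕ => ((‖E (β * ((k : ℤ) : ℝ) + -θ)‖ + (‖E (β * ((-(k : ℤ) : ℤ) : ℝ) + θ)‖ +
      ‖E (β * ((-(k : ℤ) : ℤ) : ℝ) + -θ)‖) : ℝ) : ℂ))
    (fun k _ => by
      rw [Complex.norm_real, Complex.norm_real, Real.norm_of_nonneg (by positivity),
        Real.norm_of_nonneg (by positivity)])
  have l1 := lqNorm_le_add (S := S) hQ1
    (c := fun k => ∫ t in Set.Ioi (0 : ℝ), φ t * ((Real.sin (ρ k * t) * kerK ε t : ℝ) : ℂ))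
    (d := fun _ => ((5000 * W : ℝ) : ℂ))
    (e := fun k : ℕ => ((‖E (β * ((k : ℤ) : ℝ) + θ)‖ + (‖E (β * ((k : ℤ) : ℝ) + -θ)‖ +
      (‖E (β * ((-(k : ℤ) : ℤ) : ℝ) + θ)‖ + ‖E (β * ((-(k : ℤ) : ℤ) : ℝ) + -θ)‖)) : ℝ) : ℂ))
    (fun k hk => by
      rw [Complex.norm_real, Complex.norm_real, Real.norm_of_nonneg (by positivity),
        Real.norm_of_nonneg (by positivity)]
      exact hmain k hk)
  rw [a0] at l1
  set X := (S.card : ℝ) ^ (1 / (Q : ℝ)) with hX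
  set Y := (1 / γ) ^ (1 / (Q : ℝ)) with hY
  have hX0 : 0 ≤ X := by positivity
  have hY0 : 0 ≤ Y := by positivity
  have p1 : 0 ≤ A * W * X := by positivity
  have p2 : 0 ≤ W * Y := by positivity
  calc _ ≤ 5000 * W * X + (A * W * Y + (A * W * Y + (A * W * Y + A * W * Y))) :=
        l1.trans (by
          gcongr
          refine l2.trans (add_le_add a1 (l3.trans (add_le_add a2 (l4.trans (add_le_add a3 a4))))))
    _ ≤ _ := by nlinarith

/-! ### Almost periodic functions -/

/-- The average of `g` over `[0, L]`. -/
def avg (g : ℝ → ℂ) (L : ℝ) : ℂ := (1 / (L : ℂ)) * ∫ t in (0 : ℝ)..L, g t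

lemma trigPoly_eq (s : Finset ℝ) (b : ℝ → ℂ) (t : ℝ) :
    trigPoly s b t = ∑ l ∈ s, b l * expi l t := rfl

lemma continuous_trigPoly (s : Finset ℝ) (b : ℝ → ℂ) : Continuous (trigPoly s b) := by
  have : trigPoly s b = fun t => ∑ l ∈ s, b l * expi l t := rfl
  rw [this]; fun_prop

lemma norm_trigPoly_le (s : Finset ℝ) (b : ℝ → ℂ) (t : ℝ) :
    ‖trigPoly s b t‖ ≤ ∑ l ∈ s, ‖b l‖ := by
  rw [trigPoly_eq]
  refine (norm_sum_le _ _).trans (Finset.sum_le_sum fun l _ => ?_)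
  simp

lemma tendsto_avg_expi (l : ℝ) : Tendsto (avg (expi l)) atTop (𝓝 (if l = 0 then 1 else 0)) := by
  by_cases hl : l = 0
  · subst hl
    simp only [if_true]
    refine tendsto_const_nhds.congr' ?_
    filter_upwards [eventually_gt_atTop 0] with L hL
    simp only [avg, expi_zero_left, intervalIntegral.integral_const, sub_zero, Complex.real_smul,
      mul_one]
    have : (L : ℂ) ≠ 0 := by exact_mod_cast hL.ne'
    field_simp
  · simp only [hl, if_false]
    have hc : Complex.I * l ≠ 0 := mul_ne_zero Complex.I_ne_zero (by exact_mod_cast hl)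
    refine squeeze_zero_norm' (a := fun L => (2 / |l|) / L) ?_
      (tendsto_const_nhds.div_atTop tendsto_id)
    filter_upwards [eventually_gt_atTop 0] with L hL
    have h1 : ∫ t in (0 : ℝ)..L, expi l t = (expi l L - 1) / (Complex.I * l) := by
      have := integral_exp_mul_complex (a := 0) (b := L) hc
      simpa [expi] using this
    rw [avg, h1, norm_mul, norm_div, norm_div, norm_mul, Complex.norm_I, Complex.norm_real,
      Complex.norm_real, Real.norm_eq_abs, Real.norm_eq_abs, abs_of_pos hL, norm_one, one_mul]
    have h2 : ‖expi l L - 1‖ ≤ 2 := by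
      refine (norm_sub_le _ _).trans ?_
      simp; norm_num
    have : 0 < |l| := abs_pos.2 hl
    calc 1 / L * (‖expi l L - 1‖ / |l|) ≤ 1 / L * (2 / |l|) := by gcongr
      _ = _ := by ring

lemma avg_sub {g h : ℝ → ℂ} {L : ℝ} (hg : IntervalIntegrable g volume 0 L)
    (hh : IntervalIntegrable h volume 0 L) : avg (fun t => g t - h t) L = avg g L - avg h L := by
  rw [avg, intervalIntegral.integral_sub hg hh, mul_sub]; rfl

lemma avg_const_mul (c : ℂ) (g : ℝ → ℂ) (L : ℝ) : avg (fun t => c * g t) L = c * avg g L := by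
  rw [avg, intervalIntegral.integral_const_mul, avg]; ring

lemma avg_sum {ι : Type*} (s : Finset ι) {g : ι → ℝ → ℂ} {L : ℝ}
    (hg : ∀ i ∈ s, IntervalIntegrable (g i) volume 0 L) :
    avg (fun t => ∑ i ∈ s, g i t) L = ∑ i ∈ s, avg (g i) L := by
  rw [avg, intervalIntegral.integral_finsetSum hg, Finset.mul_sum]; rfl

lemma tendsto_avg_trigPoly (s : Finset ℝ) (b : ℝ → ℂ) (l : ℝ) :
    Tendsto (avg (fun t => trigPoly s b t * expi (-l) t)) atTop
      (𝓝 (if l ∈ s then b l else 0)) := by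
  have h1 : ∀ L, avg (fun t => trigPoly s b t * expi (-l) t) L =
      ∑ m ∈ s, b m * avg (expi (m - l)) L := by
    intro L
    have : (fun t => trigPoly s b t * expi (-l) t) =
        fun t => ∑ m ∈ s, b m * expi (m - l) t := by
      funext t
      rw [trigPoly_eq, Finset.sum_mul]
      refine Finset.sum_congr rfl fun m _ => ?_
      rw [sub_eq_add_neg, expi_add_left]; ring
    rw [this, avg_sum]
    · exact Finset.sum_congr rfl fun m _ => avg_const_mul _ _ _
    · intro m _
      exact ((continuous_expi _).const_mul (b m)).intervalIntegrable _ _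
  have h2 : Tendsto (fun L => ∑ m ∈ s, b m * avg (expi (m - l)) L) atTop
      (𝓝 (∑ m ∈ s, b m * if m - l = 0 then 1 else 0)) :=
    tendsto_finsetSum _ fun m _ => (tendsto_avg_expi (m - l)).const_mul (b m)
  have h3 : (∑ m ∈ s, b m * if m - l = 0 then (1 : ℂ) else 0) = if l ∈ s then b l else 0 := by
    simp only [sub_eq_zero, mul_ite, mul_one, mul_zero]
    rw [Finset.sum_ite_eq' s l b]
  rw [← h3]
  exact h2.congr fun L => (h1 L).symm

/-- Bounded measurable functions which are limits of trigonometric polynomials in the Stepanov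
`S^1` norm. -/
structure IsS1AP (M : ℝ) (f : ℝ → ℂ) : Prop where
  meas : AEStronglyMeasurable f volume
  bound : ∀ t, ‖f t‖ ≤ M
  approx : ∀ η : ℝ, 0 < η → ∃ (s : Finset ℝ) (b : ℝ → ℂ),
    ∀ u, ∫ t in Set.Ioc u (u + Real.pi), ‖f t - trigPoly s b t‖ ≤ η

lemma intervalIntegrable_of_bound {E : Type*} [NormedAddCommGroup E] {g : ℝ → E}
    (hm : AEStronglyMeasurable g volume) {M : ℝ} (hb : ∀ t, ‖g t‖ ≤ M) (a b : ℝ) :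
    IntervalIntegrable g volume a b := by
  rw [intervalIntegrable_iff, Set.uIoc]
  exact Integrable.of_bound hm.restrict M (Eventually.of_forall hb)

lemma integral_norm_le_of_stepanov {g : ℝ → ℂ} (hm : AEStronglyMeasurable g volume) {M : ℝ}
    (hb : ∀ t, ‖g t‖ ≤ M) {η : ℝ} (hη : ∀ u, ∫ t in Set.Ioc u (u + Real.pi), ‖g t‖ ≤ η) (u : ℝ)
    {s : ℝ} (hs : 0 ≤ s) : ∫ t in u..(u + s), ‖g t‖ ≤ (s / Real.pi + 1) * η := by
  have hpi := Real.pi_pos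
  have hη0 : 0 ≤ η := (integral_nonneg fun _ => norm_nonneg _).trans (hη 0)
  have hi : ∀ a b, IntervalIntegrable (fun t => ‖g t‖) volume a b := fun a b =>
    intervalIntegrable_of_bound hm.norm (M := M) (fun t => by rw [norm_norm]; exact hb t) a b
  set n := ⌈s / Real.pi⌉₊ with hn
  have hn1 : s ≤ n * Real.pi := by
    have := Nat.le_ceil (s / Real.pi)
    rwa [div_le_iff₀ hpi] at this
  have hn2 : (n : ℝ) ≤ s / Real.pi + 1 := (Nat.ceil_lt_add_one (by positivity)).le
  have h1 : ∫ t in u..(u + s), ‖g t‖ ≤ ∫ t in u..(u + n * Real.pi), ‖g t‖ :=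
    intervalIntegral.integral_mono_interval le_rfl (by linarith) (by linarith)
      (Eventually.of_forall fun _ => norm_nonneg _) (hi _ _)
  have h2 := intervalIntegral.sum_integral_adjacent_intervals
    (a := fun j : ℕ => u + j * Real.pi) (n := n) (f := fun t => ‖g t‖) (μ := volume)
    (fun j _ => hi _ _)
  simp only [Nat.cast_zero, zero_mul, add_zero] at h2
  rw [← h2] at h1
  refine h1.trans ?_
  calc _ ≤ ∑ j ∈ Finset.range n, η := by
        refine Finset.sum_le_sum fun j _ => ?_
        have e : u + ((j + 1 : ℕ) : ℝ) * Real.pi = u + j * Real.pi + Real.pi := by push_cast; ring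
        rw [e, intervalIntegral.integral_of_le (by linarith)]
        exact hη _
    _ = n * η := by simp
    _ ≤ _ := by gcongr

/-- `[0, L]` is covered by at most `L/π + 1 ≤ L` intervals of length `π`. Being uniform in `L ≥ π`,
the bound passes to mean values. -/
lemma norm_avg_le_of_stepanov {g : ℝ → ℂ} (hm : AEStronglyMeasurable g volume) {M : ℝ}
    (hb : ∀ t, ‖g t‖ ≤ M) {η : ℝ} (hη : ∀ u, ∫ t in Set.Ioc u (u + Real.pi), ‖g t‖ ≤ η) {L : ℝ}
    (hL : Real.pi ≤ L) : ‖avg g L‖ ≤ η := by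
  have hpi := Real.pi_pos
  have hL0 : 0 < L := hpi.trans_le hL
  have hη0 : 0 ≤ η := (integral_nonneg fun _ => norm_nonneg _).trans (hη 0)
  have h1 := integral_norm_le_of_stepanov hm hb hη 0 hL0.le
  rw [zero_add] at h1
  rw [avg, norm_mul, norm_div, norm_one, Complex.norm_real, Real.norm_of_nonneg hL0.le]
  calc 1 / L * ‖∫ t in (0 : ℝ)..L, g t‖ ≤ 1 / L * ((L / Real.pi + 1) * η) := by
        gcongr
        exact (intervalIntegral.norm_integral_le_integral_norm hL0.le).trans h1
    _ ≤ 1 / L * (L * η) := by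
        gcongr
        have h3 : L / Real.pi ≤ L / 3 := by gcongr; exact Real.pi_gt_three.le
        have h4 := Real.pi_gt_three
        linarith
    _ = η := by field_simp

namespace IsS1AP
variable {M : ℝ} {f : ℝ → ℂ}

lemma norm_avg_sub_le (hf : IsS1AP M f) {s : Finset ℝ} {b : ℝ → ℂ} {η : ℝ}
    (hη : ∀ u, ∫ t in Set.Ioc u (u + Real.pi), ‖f t - trigPoly s b t‖ ≤ η) (l : ℝ) {L : ℝ}
    (hL : Real.pi ≤ L) :
    ‖avg (fun t => f t * expi (-l) t) L - avg (fun t => trigPoly s b t * expi (-l) t) L‖ ≤ η := by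
  have hfe : AEStronglyMeasurable (fun t => f t * expi (-l) t) volume :=
    hf.meas.mul (continuous_expi _).aestronglyMeasurable
  have hpe : Continuous (fun t => trigPoly s b t * expi (-l) t) :=
    (continuous_trigPoly s b).mul (continuous_expi _)
  rw [← avg_sub (intervalIntegrable_of_bound hfe (M := M) (fun t => by simpa using hf.bound t) _ _)
    (hpe.intervalIntegrable _ _)]
  refine norm_avg_le_of_stepanov (hfe.sub hpe.aestronglyMeasurable)
    (M := M + ∑ l ∈ s, ‖b l‖) (fun t => ?_) (fun u => ?_) hL
  · rw [Pi.sub_apply, ← sub_mul, norm_mul, norm_expi, mul_one]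
    exact (norm_sub_le _ _).trans (add_le_add (hf.bound t) (norm_trigPoly_le s b t))
  · simpa [← sub_mul] using hη u

/-- The averages are uniformly close to those of an approximating polynomial, which converge; hence
they are Cauchy. -/
lemma exists_tendsto_avg (hf : IsS1AP M f) (l : ℝ) :
    ∃ c, Tendsto (avg (fun t => f t * expi (-l) t)) atTop (𝓝 c) := by
  refine cauchySeq_tendsto_of_complete (Metric.cauchySeq_iff'.2 fun ε hε => ?_)
  obtain ⟨s, b, hη⟩ := hf.approx (ε / 5) (by positivity)
  have h1 := tendsto_avg_trigPoly s b l
  rw [Metric.tendsto_atTop] at h1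
  obtain ⟨N, hN⟩ := h1 (ε / 5) (by positivity)
  refine ⟨max N Real.pi, fun L hL => ?_⟩
  set c := (if l ∈ s then b l else 0)
  have key : ∀ L ≥ max N Real.pi, dist (avg (fun t => f t * expi (-l) t) L) c ≤ 2 * (ε / 5) := by
    intro L hL
    have h2 := hf.norm_avg_sub_le hη l ((le_max_right _ _).trans hL)
    have h3 := (hN L ((le_max_left _ _).trans hL)).le
    rw [← dist_eq_norm] at h2
    linarith [dist_triangle (avg (fun t => f t * expi (-l) t) L)
      (avg (fun t => trigPoly s b t * expi (-l) t) L) c]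
  have h4 := key L hL
  have h5 := key _ le_rfl
  have h6 := dist_triangle_right (avg (fun t => f t * expi (-l) t) L)
    (avg (fun t => f t * expi (-l) t) (max N Real.pi)) c
  linarith

lemma tendsto_avg_fourierCoef (hf : IsS1AP M f) (l : ℝ) :
    Tendsto (avg (fun t => f t * expi (-l) t)) atTop (𝓝 (fourierCoef f l)) := by
  obtain ⟨c, hc⟩ := hf.exists_tendsto_avg l
  have h1 : fourierCoef f l = limUnder atTop (avg (fun t => f t * expi (-l) t)) := by
    unfold fourierCoef avg
    congr 1
    funext L
    congr 2
    funext t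
    simp only [expi]
    congr 2
    push_cast; ring
  rw [h1, hc.limUnder_eq]
  exact hc

lemma norm_coef_sub_le (hf : IsS1AP M f) {s : Finset ℝ} {b : ℝ → ℂ} {η : ℝ}
    (hη : ∀ u, ∫ t in Set.Ioc u (u + Real.pi), ‖f t - trigPoly s b t‖ ≤ η) (l : ℝ) :
    ‖fourierCoef f l - (if l ∈ s then b l else 0)‖ ≤ η := by
  refine le_of_tendsto ((hf.tendsto_avg_fourierCoef l).sub (tendsto_avg_trigPoly s b l)).norm ?_
  filter_upwards [eventually_ge_atTop Real.pi] with L hL using hf.norm_avg_sub_le hη l hL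

end IsS1AP

/-! ### Uniformly almost periodic functions and the uniqueness theorem -/

/-- Uniform limits of trigonometric polynomials. -/
def IsUniformAP (F : ℝ → ℂ) : Prop :=
  ∀ η : ℝ, 0 < η → ∃ (s : Finset ℝ) (b : ℝ → ℂ), ∀ t, ‖F t - trigPoly s b t‖ ≤ η

namespace IsUniformAP
variable {F : ℝ → ℂ}

lemma continuous (hF : IsUniformAP F) : Continuous F := by
  refine continuous_of_uniform_approx_of_continuous fun u hu => ?_
  obtain ⟨ε, hε, h⟩ := Metric.mem_uniformity_dist.1 hu
  obtain ⟨s, b, hsb⟩ := hF (ε / 2) (by positivity)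
  refine ⟨trigPoly s b, continuous_trigPoly s b, fun t => h ?_⟩
  rw [dist_eq_norm]
  exact (hsb t).trans_lt (by linarith)

lemma bounded (hF : IsUniformAP F) : ∃ B, 0 ≤ B ∧ ∀ t, ‖F t‖ ≤ B := by
  obtain ⟨s, b, hsb⟩ := hF 1 one_pos
  refine ⟨1 + ∑ l ∈ s, ‖b l‖, by positivity, fun t => ?_⟩
  calc ‖F t‖ = ‖(F t - trigPoly s b t) + trigPoly s b t‖ := by rw [sub_add_cancel]
    _ ≤ _ := (norm_add_le _ _).trans (add_le_add (hsb t) (norm_trigPoly_le s b t))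

/-- Finitely many translates are `η`-dense among all translates. -/
lemma exists_finite_translates (hF : IsUniformAP F) {η : ℝ} (hη : 0 < η) :
    ∃ τ : Finset ℝ, ∀ s, ∃ t₀ ∈ τ, ∀ t, ‖F (s + t) - F (t₀ + t)‖ ≤ η := by
  obtain ⟨S, b, hsb⟩ := hF (η / 4) (by positivity)
  set B := ∑ l ∈ S, ‖b l‖ with hB
  have hB0 : 0 ≤ B := by positivity
  set δ := η / (2 * (B + 1)) with hδ
  have hδ0 : 0 < δ := by positivity
  -- A translate of the polynomial is determined by the phases `e^{ils}` at its finitely many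
  -- frequencies. These vectors form a bounded, hence totally bounded, set in a finite dimensional
  -- space.
  set v : ℝ → (S → ℂ) := fun s l => expi l s with hv
  have htb : TotallyBounded (Set.range v) := by
    refine Bornology.IsBounded.isCompact_closure ?_ |>.totallyBounded.subset subset_closure
    rw [isBounded_iff_forall_norm_le]
    refine ⟨1, ?_⟩
    rintro _ ⟨s, rfl⟩
    rw [pi_norm_le_iff_of_nonneg zero_le_one]
    intro l; simp [hv]
  obtain ⟨Y, hYsub, hYfin, hYcov⟩ := Metric.finite_approx_of_totallyBounded htb δ hδ0
  choose! g hg using fun y (hy : y ∈ Y) => hYsub hy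
  refine ⟨hYfin.toFinset.image g, fun s => ?_⟩
  obtain ⟨y, hyY, hy⟩ := Set.mem_iUnion₂.1 (hYcov ⟨s, rfl⟩)
  refine ⟨g y, Finset.mem_image_of_mem _ (by simpa using hyY), fun t => ?_⟩
  have hd : ∀ l : S, ‖expi l s - expi l (g y)‖ ≤ δ := by
    intro l
    rw [Metric.mem_ball, ← hg y hyY, dist_eq_norm] at hy
    exact (norm_le_pi_norm (v s - v (g y)) l).trans hy.le
  have hP : ‖trigPoly S b (s + t) - trigPoly S b (g y + t)‖ ≤ B * δ := by
    rw [trigPoly_eq, trigPoly_eq, ← Finset.sum_sub_distrib, hB, Finset.sum_mul]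
    refine (norm_sum_le _ _).trans (Finset.sum_le_sum fun l hl => ?_)
    rw [expi_add_right, expi_add_right, ← mul_sub, ← sub_mul, norm_mul, norm_mul, norm_expi, mul_one]
    gcongr
    exact hd ⟨l, hl⟩
  have hBδ : B * δ ≤ η / 2 := by
    rw [hδ]
    calc B * (η / (2 * (B + 1))) = η / 2 * (B / (B + 1)) := by field_simp
      _ ≤ η / 2 * 1 := by
        gcongr
        rw [div_le_one (by positivity)]; linarith
      _ = η / 2 := mul_one _
  have e : F (s + t) - F (g y + t) = (F (s + t) - trigPoly S b (s + t)) +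
      (trigPoly S b (s + t) - trigPoly S b (g y + t)) - (F (g y + t) - trigPoly S b (g y + t)) := by
    ring
  rw [e]
  refine (norm_sub_le _ _).trans ((add_le_add_left (norm_add_le _ _) _).trans ?_)
  linarith [hsb (s + t), hsb (g y + t)]

/-- With `P` a polynomial close to `F`, write `|F|² = F conj(P) + F conj(F - P)`. The first mean is
a finite combination of vanishing Fourier coefficients, and the second is uniformly small. -/
lemma tendsto_mean_sq (hF : IsUniformAP F)
    (h0 : ∀ l, Tendsto (avg (fun t => F t * expi (-l) t)) atTop (𝓝 0)) :
    Tendsto (fun L : ℝ => (1 / L) * ∫ t in (0 : ℝ)..L, ‖F t‖ ^ 2) atTop (𝓝 0) := by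
  obtain ⟨B, hB0, hB⟩ := hF.bounded
  have hFc := hF.continuous
  rw [Metric.tendsto_atTop]
  intro ε hε
  obtain ⟨s, b, hsb⟩ := hF (ε / (2 * (B + 1))) (by positivity)
  have h1 : Tendsto (avg (fun t => F t * (starRingEnd ℂ) (trigPoly s b t))) atTop (𝓝 0) := by
    have e : (fun t => F t * (starRingEnd ℂ) (trigPoly s b t)) =
        fun t => ∑ l ∈ s, (starRingEnd ℂ) (b l) * (F t * expi (-l) t) := by
      funext t
      rw [trigPoly_eq, map_sum, Finset.mul_sum]
      refine Finset.sum_congr rfl fun l _ => ?_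
      have : (starRingEnd ℂ) (expi l t) = expi (-l) t := by
        rw [expi, ← Complex.exp_conj, expi]; simp
      rw [map_mul, this]; ring
    rw [e]
    have h2 : Tendsto (fun L => ∑ l ∈ s, (starRingEnd ℂ) (b l) * avg (fun t => F t * expi (-l) t) L)
        atTop (𝓝 (∑ l ∈ s, (starRingEnd ℂ) (b l) * 0)) :=
      tendsto_finsetSum _ fun l _ => (h0 l).const_mul _
    simp only [mul_zero, Finset.sum_const_zero] at h2
    refine h2.congr fun L => ?_
    rw [avg_sum]
    · exact Finset.sum_congr rfl fun l _ => (avg_const_mul _ _ _).symm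
    · intro l _
      exact ((hFc.mul (continuous_expi _)).const_mul _).intervalIntegrable _ _
  rw [Metric.tendsto_atTop] at h1
  obtain ⟨N, hN⟩ := h1 (ε / 2) (by positivity)
  refine ⟨max N 1, fun L hL => ?_⟩
  have hL1 : 1 ≤ L := (le_max_right _ _).trans hL
  have hL0 : 0 < L := by linarith
  have hN' := hN L ((le_max_left _ _).trans hL)
  rw [dist_zero_right] at hN' ⊢
  have hnn : 0 ≤ ∫ t in (0 : ℝ)..L, ‖F t‖ ^ 2 :=
    intervalIntegral.integral_nonneg hL0.le fun _ _ => by positivity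
  rw [Real.norm_of_nonneg (by positivity)]
  have hPc := continuous_trigPoly s b
  have e1 : ((∫ t in (0 : ℝ)..L, ‖F t‖ ^ 2 : ℝ) : ℂ) =
      (∫ t in (0 : ℝ)..L, F t * (starRingEnd ℂ) (trigPoly s b t)) +
      ∫ t in (0 : ℝ)..L, F t * (starRingEnd ℂ) (F t - trigPoly s b t) := by
    rw [← intervalIntegral.integral_add, ← intervalIntegral.integral_ofReal]
    · congr 1 with t
      rw [← mul_add, ← map_add, add_sub_cancel, Complex.mul_conj, Complex.normSq_eq_norm_sq]
    · exact (hFc.mul (Complex.continuous_conj.comp hPc)).intervalIntegrable _ _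
    · exact (hFc.mul (Complex.continuous_conj.comp (hFc.sub hPc))).intervalIntegrable _ _
  have h3 : ‖∫ t in (0 : ℝ)..L, F t * (starRingEnd ℂ) (F t - trigPoly s b t)‖ ≤
      (B * (ε / (2 * (B + 1)))) * |L - 0| := by
    refine intervalIntegral.norm_integral_le_of_norm_le_const fun t _ => ?_
    rw [norm_mul, RCLike.norm_conj]
    gcongr
    · exact hB t
    · exact hsb t
  rw [sub_zero, abs_of_pos hL0] at h3
  have h4 : B * (ε / (2 * (B + 1))) ≤ ε / 2 := by
    calc B * (ε / (2 * (B + 1))) = ε / 2 * (B / (B + 1)) := by field_simp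
      _ ≤ ε / 2 * 1 := by
        gcongr
        rw [div_le_one (by positivity)]; linarith
      _ = ε / 2 := mul_one _
  have h5 : ‖∫ t in (0 : ℝ)..L, F t * (starRingEnd ℂ) (trigPoly s b t)‖ < ε / 2 * L := by
    rw [avg, norm_mul, norm_div, norm_one, Complex.norm_real, Real.norm_of_nonneg hL0.le,
      one_div, inv_mul_lt_iff₀ hL0] at hN'
    linarith
  have h6 : ∫ t in (0 : ℝ)..L, ‖F t‖ ^ 2 < ε * L := by
    calc ∫ t in (0 : ℝ)..L, ‖F t‖ ^ 2 = ‖((∫ t in (0 : ℝ)..L, ‖F t‖ ^ 2 : ℝ) : ℂ)‖ := by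
          rw [Complex.norm_real, Real.norm_of_nonneg hnn]
      _ ≤ ‖∫ t in (0 : ℝ)..L, F t * (starRingEnd ℂ) (trigPoly s b t)‖ +
          ‖∫ t in (0 : ℝ)..L, F t * (starRingEnd ℂ) (F t - trigPoly s b t)‖ := by
          rw [e1]; exact norm_add_le _ _
      _ < ε / 2 * L + ε / 2 * L := by
          refine add_lt_add_of_lt_of_le h5 (h3.trans (by gcongr))
      _ = ε * L := by ring
  rw [one_div, inv_mul_lt_iff₀ hL0]
  linarith

/-- A translation changes the integral over `[0, L]` only on two intervals of length `|s|`, which is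
negligible against `L`. -/
lemma tendsto_mean_sq_translate (hF : IsUniformAP F)
    (h : Tendsto (fun L : ℝ => (1 / L) * ∫ t in (0 : ℝ)..L, ‖F t‖ ^ 2) atTop (𝓝 0)) (s : ℝ) :
    Tendsto (fun L : ℝ => (1 / L) * ∫ t in (0 : ℝ)..L, ‖F (t + s)‖ ^ 2) atTop (𝓝 0) := by
  obtain ⟨B, hB0, hB⟩ := hF.bounded
  have hc : Continuous fun t => ‖F t‖ ^ 2 := hF.continuous.norm.pow 2
  have h2 : Tendsto (fun L : ℝ => (1 / L) * (∫ t in (0 : ℝ)..L, ‖F t‖ ^ 2) +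
      (2 * B ^ 2 * |s|) / L) atTop (𝓝 0) := by
    have := h.add ((tendsto_const_nhds (x := 2 * B ^ 2 * |s|)).div_atTop tendsto_id)
    simpa using this
  refine squeeze_zero' ?_ ?_ h2
  · filter_upwards [eventually_gt_atTop 0] with L hL
    have : 0 ≤ ∫ t in (0 : ℝ)..L, ‖F (t + s)‖ ^ 2 :=
      intervalIntegral.integral_nonneg hL.le fun _ _ => by positivity
    positivity
  · filter_upwards [eventually_gt_atTop 0] with L hL
    have hbd : ∀ a b : ℝ, ‖∫ t in a..b, ‖F t‖ ^ 2‖ ≤ B ^ 2 * |b - a| := fun a b =>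
      intervalIntegral.norm_integral_le_of_norm_le_const fun t _ => by
        rw [norm_pow, norm_norm]; gcongr; exact hB t
    have e : ∫ t in (0 : ℝ)..L, ‖F (t + s)‖ ^ 2 = (∫ t in (0 : ℝ)..L, ‖F t‖ ^ 2) +
        (∫ t in L..(L + s), ‖F t‖ ^ 2) - ∫ t in (0 : ℝ)..s, ‖F t‖ ^ 2 := by
      rw [intervalIntegral.integral_comp_add_right (fun t => ‖F t‖ ^ 2), zero_add,
        intervalIntegral.integral_add_adjacent_intervals (hc.intervalIntegrable _ _)
          (hc.intervalIntegrable _ _),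
        ← intervalIntegral.integral_add_adjacent_intervals (hc.intervalIntegrable 0 s)
          (hc.intervalIntegrable s (L + s))]
      ring
    have b1 := hbd L (L + s)
    have b2 := hbd 0 s
    rw [add_sub_cancel_left] at b1
    rw [sub_zero] at b2
    have b1' := (le_abs_self _).trans b1
    have b2' := (neg_le_abs _).trans b2
    rw [e]
    calc _ ≤ 1 / L * ((∫ t in (0 : ℝ)..L, ‖F t‖ ^ 2) + 2 * B ^ 2 * |s|) := by
          gcongr; linarith
      _ = _ := by ring

/-- The uniqueness theorem for almost periodic functions. -/
theorem eq_zero (hF : IsUniformAP F)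
    (h0 : ∀ l, Tendsto (avg (fun t => F t * expi (-l) t)) atTop (𝓝 0)) (t₀ : ℝ) : F t₀ = 0 := by
  by_contra hne
  have hε : 0 < ‖F t₀‖ := norm_pos_iff.2 hne
  set ε := ‖F t₀‖ with hεdef
  obtain ⟨τ, hτ⟩ := hF.exists_finite_translates (η := ε / 2) (by positivity)
  have hms := hF.tendsto_mean_sq h0
  -- Every translate of `F` is close to one by some `u` in the finite set `τ`, so at the point `t₀ -
  -- u` it nearly attains `F t₀`. A finite sum of functions with mean square zero would then stay
  -- bounded below.
  have hlow : ∀ s, (ε / 2) ^ 2 ≤ ∑ u ∈ τ, ‖F (s + (t₀ - u))‖ ^ 2 := by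
    intro s
    obtain ⟨u, hu, h⟩ := hτ s
    have h1 := h (t₀ - u)
    rw [add_sub_cancel] at h1
    have h2 : ε / 2 ≤ ‖F (s + (t₀ - u))‖ := by
      have := norm_sub_norm_le (F t₀) (F (s + (t₀ - u)))
      rw [norm_sub_rev] at h1
      linarith
    calc (ε / 2) ^ 2 ≤ ‖F (s + (t₀ - u))‖ ^ 2 := by gcongr
      _ ≤ _ := Finset.single_le_sum (f := fun u => ‖F (s + (t₀ - u))‖ ^ 2)
        (fun _ _ => by positivity) hu
  have hlim : Tendsto (fun L : ℝ => ∑ u ∈ τ, (1 / L) * ∫ t in (0 : ℝ)..L, ‖F (t + (t₀ - u))‖ ^ 2)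
      atTop (𝓝 (∑ u ∈ τ, 0)) :=
    tendsto_finsetSum _ fun u _ => hF.tendsto_mean_sq_translate hms _
  rw [Finset.sum_const_zero] at hlim
  have hc : ∀ u, Continuous fun t => ‖F (t + (t₀ - u))‖ ^ 2 := fun u =>
    ((hF.continuous.comp (continuous_id.add continuous_const)).norm).pow 2
  have hge : (ε / 2) ^ 2 ≤ 0 := by
    refine ge_of_tendsto hlim ?_
    filter_upwards [eventually_gt_atTop 0] with L hL
    rw [← Finset.mul_sum, ← intervalIntegral.integral_finsetSum
      (fun u _ => (hc u).intervalIntegrable _ _)]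
    have h3 : ∫ _ in (0 : ℝ)..L, (ε / 2) ^ 2 ≤
        ∫ t in (0 : ℝ)..L, ∑ u ∈ τ, ‖F (t + (t₀ - u))‖ ^ 2 :=
      intervalIntegral.integral_mono_on hL.le (continuous_const.intervalIntegrable _ _)
        ((continuous_finsetSum _ fun u _ => hc u).intervalIntegrable _ _) fun t _ => hlow t
    rw [intervalIntegral.integral_const, sub_zero, smul_eq_mul] at h3
    rw [one_div, le_inv_mul_iff₀ hL]
    exact h3
  have : 0 < (ε / 2) ^ 2 := by positivity
  linarith

end IsUniformAP

/-! ### The integral representation of the partial sums -/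

/-- The convolution of `g` with the summation kernel. -/
def kerConv (ε ρ : ℝ) (g : ℝ → ℂ) (x : ℝ) : ℂ :=
  (1 / Real.pi : ℂ) * ∫ t in Set.Ioi (0 : ℝ),
    (g (x + t) + g (x - t)) * ((Real.sin (ρ * t) * kerK ε t : ℝ) : ℂ)

/-- The multiplier of the summation kernel. -/
def kerMult (ε ρ l : ℝ) : ℂ :=
  (1 / Real.pi : ℂ) * ((∫ t in Set.Ioi (0 : ℝ),
    2 * Real.cos (l * t) * (Real.sin (ρ * t) * kerK ε t) : ℝ) : ℂ)

section conv
variable {ε ρ : ℝ}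

lemma kerMult_eq_one (hε : 0 < ε) {l : ℝ} (hl : |l| ≤ ρ - 2 * ε) : kerMult ε ρ l = 1 := by
  rw [kerMult, (integral_sin_add_sin_mul_kerK hε).1 hl]
  have : (Real.pi : ℂ) ≠ 0 := by exact_mod_cast Real.pi_ne_zero
  field_simp

lemma kerMult_eq_zero (hε : 0 < ε) {l : ℝ} (hρ : 0 ≤ ρ) (hl : ρ + 2 * ε ≤ |l|) :
    kerMult ε ρ l = 0 := by
  rw [kerMult, (integral_sin_add_sin_mul_kerK hε).2 hl hρ]; simp

lemma exists_norm_kerMult_le (hε : 0 < ε) (ρ : ℝ) : ∃ B, 0 ≤ B ∧ ∀ l, ‖kerMult ε ρ l‖ ≤ B := by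
  have hi := (integrableOn_sin_mul_kerK hε ρ).norm.const_mul 2
  refine ⟨(1 / Real.pi) * ∫ t in Set.Ioi (0 : ℝ), 2 * ‖Real.sin (ρ * t) * kerK ε t‖, ?_, fun l => ?_⟩
  · have : 0 ≤ ∫ t in Set.Ioi (0 : ℝ), 2 * ‖Real.sin (ρ * t) * kerK ε t‖ :=
      integral_nonneg fun _ => by positivity
    positivity
  · rw [kerMult, norm_mul, norm_div, norm_one, Complex.norm_real, Complex.norm_real,
      Real.norm_of_nonneg Real.pi_pos.le]
    gcongr
    refine norm_integral_le_of_norm_le hi (Eventually.of_forall fun t => ?_)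
    rw [norm_mul]
    gcongr
    rw [norm_mul, Real.norm_two]
    have := Real.abs_cos_le_one (l * t)
    rw [Real.norm_eq_abs]; linarith

lemma aestronglyMeasurable_add_left {g : ℝ → ℂ} (hg : AEStronglyMeasurable g volume) (x : ℝ) :
    AEStronglyMeasurable (fun t => g (x + t)) volume :=
  hg.comp_quasiMeasurePreserving (measurePreserving_add_left volume x).quasiMeasurePreserving

lemma aestronglyMeasurable_sub_left {g : ℝ → ℂ} (hg : AEStronglyMeasurable g volume) (x : ℝ) :
    AEStronglyMeasurable (fun t => g (x - t)) volume :=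
  hg.comp_quasiMeasurePreserving (Measure.measurePreserving_sub_left volume x).quasiMeasurePreserving

lemma integrableOn_kerConv (hε : 0 < ε) (ρ : ℝ) {g : ℝ → ℂ} (hg : AEStronglyMeasurable g volume)
    {M : ℝ} (hb : ∀ t, ‖g t‖ ≤ M) (x : ℝ) :
    IntegrableOn (fun t => (g (x + t) + g (x - t)) * ((Real.sin (ρ * t) * kerK ε t : ℝ) : ℂ))
      (Set.Ioi 0) :=
  integrableOn_mul_sin_mul_kerK (M := M + M)
    ((aestronglyMeasurable_add_left hg x).add (aestronglyMeasurable_sub_left hg x))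
    (fun _ => (norm_add_le _ _).trans (add_le_add (hb _) (hb _))) hε ρ

lemma kerConv_sub (hε : 0 < ε) (ρ : ℝ) {g h : ℝ → ℂ} (hg : AEStronglyMeasurable g volume)
    {M : ℝ} (hb : ∀ t, ‖g t‖ ≤ M) (hh : AEStronglyMeasurable h volume) {M' : ℝ}
    (hb' : ∀ t, ‖h t‖ ≤ M') (x : ℝ) :
    kerConv ε ρ (fun t => g t - h t) x = kerConv ε ρ g x - kerConv ε ρ h x := by
  rw [kerConv, kerConv, kerConv, ← mul_sub,
    ← integral_sub (integrableOn_kerConv hε ρ hg hb x) (integrableOn_kerConv hε ρ hh hb' x)]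
  congr 2 with t
  ring

lemma kerConv_trigPoly (hε : 0 < ε) (ρ : ℝ) (s : Finset ℝ) (b : ℝ → ℂ) (x : ℝ) :
    kerConv ε ρ (trigPoly s b) x = trigPoly s (fun l => b l * kerMult ε ρ l) x := by
  have h1 : ∀ l, IntegrableOn (fun t => ((2 * Real.cos (l * t) * (Real.sin (ρ * t) * kerK ε t) : ℝ) : ℂ))
      (Set.Ioi 0) := by
    intro l
    refine Integrable.ofReal ?_
    refine (integrableOn_sin_mul_kerK hε ρ).bdd_mul (c := 2)
      (by fun_prop) (Eventually.of_forall fun t => ?_)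
    have := Real.abs_cos_le_one (l * t)
    rw [norm_mul, Real.norm_two, Real.norm_eq_abs]; linarith
  have h2 : ∀ t, (trigPoly s b (x + t) + trigPoly s b (x - t)) *
      ((Real.sin (ρ * t) * kerK ε t : ℝ) : ℂ) = ∑ l ∈ s, b l * expi l x *
        ((2 * Real.cos (l * t) * (Real.sin (ρ * t) * kerK ε t) : ℝ) : ℂ) := by
    intro t
    rw [trigPoly_eq, trigPoly_eq, ← Finset.sum_add_distrib, Finset.sum_mul]
    refine Finset.sum_congr rfl fun l _ => ?_
    have e : expi l t + expi l (-t) = 2 * (Real.cos (l * t) : ℂ) := by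
      rw [expi_eq, expi_eq, Complex.exp_mul_I, Complex.exp_mul_I, mul_neg, Complex.ofReal_neg,
        Complex.cos_neg, Complex.sin_neg, Complex.ofReal_cos]
      ring
    rw [sub_eq_add_neg, expi_add_right, expi_add_right]
    push_cast at e ⊢
    linear_combination (b l * expi l x * (Complex.sin (ρ * t) * (kerK ε t : ℂ))) * e
  rw [kerConv, trigPoly_eq]
  simp only [h2]
  rw [integral_finsetSum _ (fun l _ => (h1 l).const_mul _), Finset.mul_sum]
  refine Finset.sum_congr rfl fun l _ => ?_
  rw [integral_const_mul, kerMult, integral_complex_ofReal]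
  ring

/-- The kernel is dominated by a multiple of `1 / (1 + t²)`, so convolution turns approximation in
the Stepanov norm into uniform approximation. The constant does not depend on the sup bound `M`. -/
lemma exists_norm_kerConv_le (hε : 0 < ε) (ρ : ℝ) : ∃ A, 0 ≤ A ∧ ∀ (g : ℝ → ℂ) (M η : ℝ),
    AEStronglyMeasurable g volume → (∀ t, ‖g t‖ ≤ M) →
    (∀ u, ∫ t in Set.Ioc u (u + Real.pi), ‖g t‖ ≤ η) → ∀ x, ‖kerConv ε ρ g x‖ ≤ A * η := by
  set A := 2 * (|ρ| + 1 / ε ^ 2) with hA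
  have hA0 : 0 ≤ A := by positivity
  refine ⟨A * 40, by positivity, fun g M η hm hb hη x => ?_⟩
  have hη0 : 0 ≤ η := (integral_nonneg fun _ => norm_nonneg _).trans (hη 0)
  have hpi := Real.pi_gt_three
  have hM : 0 ≤ M := (norm_nonneg _).trans (hb 0)
  set v : ℝ → ℝ := fun t => ‖g (x + t)‖ + ‖g (x - t)‖ with hv
  have hvm : AEStronglyMeasurable v volume :=
    (aestronglyMeasurable_add_left hm x).norm.add (aestronglyMeasurable_sub_left hm x).norm
  have hv0 : ∀ t, 0 ≤ v t := fun t => by positivity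
  have hvb : ∀ t, v t ≤ M + M := fun t => add_le_add (hb _) (hb _)
  have hvI : ∀ s, 1 ≤ s → ∫ t in Set.Ioc 0 s, v t ≤ (4 * η) * s ^ 1 := by
    intro s hs
    have hs0 : 0 ≤ s := by linarith
    rw [← intervalIntegral.integral_of_le hs0, hv, intervalIntegral.integral_add
      (intervalIntegrable_of_bound (aestronglyMeasurable_add_left hm x).norm (M := M)
        (fun t => by rw [norm_norm]; exact hb _) _ _)
      (intervalIntegrable_of_bound (aestronglyMeasurable_sub_left hm x).norm (M := M)
        (fun t => by rw [norm_norm]; exact hb _) _ _),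
      intervalIntegral.integral_comp_add_left (fun t => ‖g t‖),
      intervalIntegral.integral_comp_sub_left (fun t => ‖g t‖), add_zero, sub_zero]
    have h1 := integral_norm_le_of_stepanov hm hb hη x hs0
    have h2 := integral_norm_le_of_stepanov hm hb hη (x - s) hs0
    rw [sub_add_cancel] at h2
    have h3 : s / Real.pi ≤ s := div_le_self hs0 (by linarith)
    have h4 : (s / Real.pi + 1) * η ≤ (2 * s) * η := by gcongr; linarith
    rw [pow_one]
    linarith
  have hfar := integral_Ioi_div_pow_le hvm hv0 hvb one_pos le_rfl hvI
  have hnear : ∫ t in Set.Ioc 0 1, v t ≤ 4 * η := by simpa using hvI 1 le_rfl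
  have hvi : IntegrableOn v (Set.Ioc 0 1) :=
    Integrable.of_bound hvm.restrict (M + M) (Eventually.of_forall fun t => by
      rw [Real.norm_of_nonneg (hv0 t)]; exact hvb t)
  have hvi2 : IntegrableOn (fun t => v t / t ^ (1 + 1)) (Set.Ioi 1) :=
    integrableOn_div_pow hvm (M := M + M) (fun t => by rw [abs_of_nonneg (hv0 t)]; exact hvb t)
      one_pos (by norm_num)
  have hintg := integrableOn_kerConv hε ρ hm hb x
  set k : ℝ → ℂ := fun t => (g (x + t) + g (x - t)) * ((Real.sin (ρ * t) * kerK ε t : ℝ) : ℂ) with hk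
  have hkb : ∀ t, 0 < t → ‖k t‖ ≤ v t * (A * (1 + t ^ 2)⁻¹) := by
    intro t ht
    rw [hk, norm_mul, Complex.norm_real]
    exact mul_le_mul (norm_add_le _ _) (abs_sin_mul_kerK_le hε ρ ht) (norm_nonneg _) (hv0 t)
  have hsplit : ∫ t in Set.Ioi (0 : ℝ), k t = (∫ t in Set.Ioc 0 1, k t) + ∫ t in Set.Ioi 1, k t := by
    rw [← setIntegral_union (Set.Ioc_disjoint_Ioi le_rfl) measurableSet_Ioi
      (hintg.mono_set Set.Ioc_subset_Ioi_self) (hintg.mono_set (Set.Ioi_subset_Ioi zero_le_one)),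
      Set.Ioc_union_Ioi_eq_Ioi zero_le_one]
  have n1 : ‖∫ t in Set.Ioc (0 : ℝ) 1, k t‖ ≤ A * (4 * η) := by
    calc _ ≤ ∫ t in Set.Ioc (0 : ℝ) 1, A * v t := by
          refine norm_integral_le_of_norm_le (hvi.const_mul A) ?_
          refine (ae_restrict_iff' measurableSet_Ioc).2 (Eventually.of_forall fun t ht => ?_)
          refine (hkb t ht.1).trans ?_
          rw [mul_comm]
          refine mul_le_mul_of_nonneg_right ?_ (hv0 t)
          refine mul_le_of_le_one_right hA0 (inv_le_one_of_one_le₀ (by nlinarith [sq_nonneg t]))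
      _ = A * ∫ t in Set.Ioc (0 : ℝ) 1, v t := integral_const_mul _ _
      _ ≤ _ := by gcongr
  have n2 : ‖∫ t in Set.Ioi (1 : ℝ), k t‖ ≤ A * (2 ^ (1 + 1) * (4 * η) / 1) := by
    calc _ ≤ ∫ t in Set.Ioi (1 : ℝ), A * (v t / t ^ (1 + 1)) := by
          refine norm_integral_le_of_norm_le (hvi2.const_mul A) ?_
          refine (ae_restrict_iff' measurableSet_Ioi).2 (Eventually.of_forall fun t ht => ?_)
          have ht0 : (0 : ℝ) < t := zero_lt_one.trans ht
          refine (hkb t ht0).trans ?_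
          calc v t * (A * (1 + t ^ 2)⁻¹) ≤ v t * (A * (t ^ 2)⁻¹) := by
                have := hv0 t
                gcongr
                linarith
            _ = _ := by norm_num; ring
      _ = A * ∫ t in Set.Ioi (1 : ℝ), (v t / t ^ (1 + 1)) := integral_const_mul _ _
      _ ≤ _ := by gcongr
  have n3 : ‖∫ t in Set.Ioi (0 : ℝ), k t‖ ≤ A * 40 * η := by
    rw [hsplit]
    refine (norm_add_le _ _).trans ((add_le_add n1 n2).trans ?_)
    have : 0 ≤ A * η := by positivity
    linarith
  rw [kerConv, norm_mul, norm_div, norm_one, Complex.norm_real, Real.norm_of_nonneg Real.pi_pos.le]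
  calc 1 / Real.pi * ‖∫ t in Set.Ioi (0 : ℝ), k t‖ ≤ 1 * (A * 40 * η) := by
        gcongr
        rw [div_le_one Real.pi_pos]; linarith
    _ = _ := one_mul _

/-- The convolution with the kernel is the partial sum, when the multiplier separates the
exponents. -/
theorem kerConv_eq_partialSum (hε : 0 < ε) {M : ℝ} {f : ℝ → ℂ} (hf : IsS1AP M f) {G : ℝ}
    (hfin : {l : ℝ | |l| ≤ G ∧ fourierCoef f l ≠ 0}.Finite)
    (hsep : ∀ l, fourierCoef f l ≠ 0 → kerMult ε ρ l = if |l| ≤ G then 1 else 0) (x : ℝ) :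
    kerConv ε ρ f x = partialSum f G x := by
  classical
  set S := hfin.toFinset with hS
  have hmemS : ∀ l, l ∈ S ↔ |l| ≤ G ∧ fourierCoef f l ≠ 0 := fun l => by simp [hS]
  have hps : ∀ x, partialSum f G x = trigPoly S (fourierCoef f) x := by
    intro x
    have h := finsum_mem_eq_sum_of_inter_support_eq (s := {l : ℝ | |l| ≤ G}) (t := S)
      (fun l : ℝ => fourierCoef f l * Complex.exp (Complex.I * l * x)) (by
        ext l
        simp only [Set.mem_inter_iff, Set.mem_ofPred_eq, Function.mem_support, Finset.mem_coe, hmemS]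
        constructor
        · rintro ⟨h1, h2⟩
          exact ⟨⟨h1, left_ne_zero_of_mul h2⟩, h2⟩
        · rintro ⟨h1, h2⟩
          exact ⟨h1.1, h2⟩)
    exact h
  set P := trigPoly S (fourierCoef f) with hP
  obtain ⟨A, hA0, hA⟩ := exists_norm_kerConv_le hε ρ
  obtain ⟨B, hB0, hB⟩ := exists_norm_kerMult_le hε ρ
  -- The multiplier matters only at the exponents of `f`; its unknown values in the transition zone
  -- are harmless.
  have hmul : ∀ l, kerMult ε ρ l * fourierCoef f l = if l ∈ S then fourierCoef f l else 0 := by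
    intro l
    by_cases hl : fourierCoef f l = 0
    · simp [hl]
    · rw [hsep l hl]
      by_cases hG : |l| ≤ G
      · simp [hG, hmemS, hl]
      · simp [hG, hmemS]
  -- approximation of the convolution by trigonometric polynomials
  have happ : ∀ η : ℝ, 0 < η → ∃ (s : Finset ℝ) (b : ℝ → ℂ),
      (∀ t, ‖kerConv ε ρ f t - trigPoly s (fun l => b l * kerMult ε ρ l) t‖ ≤ A * η) ∧
      ∀ l, ‖fourierCoef f l - (if l ∈ s then b l else 0)‖ ≤ η := by
    intro η hη
    obtain ⟨s, b, hsb⟩ := hf.approx η hη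
    refine ⟨s, b, fun t => ?_, fun l => hf.norm_coef_sub_le hsb l⟩
    have hc := (continuous_trigPoly s b)
    rw [← kerConv_trigPoly hε, ← kerConv_sub hε ρ hf.meas hf.bound hc.aestronglyMeasurable
      (norm_trigPoly_le s b)]
    exact hA _ (M + ∑ l ∈ s, ‖b l‖) η (hf.meas.sub hc.aestronglyMeasurable)
      (fun t => (norm_sub_le _ _).trans (add_le_add (hf.bound t) (norm_trigPoly_le s b t))) hsb t
  have hdiff : ∀ (s : Finset ℝ) (b : ℝ → ℂ) (t : ℝ), trigPoly s b t - P t =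
      trigPoly (s ∪ S) (fun l => (if l ∈ s then b l else 0) -
        (if l ∈ S then fourierCoef f l else 0)) t := by
    intro s b t
    rw [hP, trigPoly_eq, trigPoly_eq, trigPoly_eq]
    simp only [sub_mul, Finset.sum_sub_distrib, ite_mul, zero_mul]
    rw [Finset.sum_ite_mem, Finset.sum_ite_mem, Finset.union_inter_cancel_left,
      Finset.union_inter_cancel_right]
  set F : ℝ → ℂ := fun t => kerConv ε ρ f t - P t with hF
  have hFap : IsUniformAP F := by
    intro η hη
    obtain ⟨s, b, h1, -⟩ := happ (η / (A + 1)) (by positivity)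
    refine ⟨s ∪ S, fun l => (if l ∈ s then b l * kerMult ε ρ l else 0) -
      (if l ∈ S then fourierCoef f l else 0), fun t => ?_⟩
    rw [← hdiff s (fun l => b l * kerMult ε ρ l) t, hF, sub_sub_sub_cancel_right]
    refine (h1 t).trans ?_
    calc A * (η / (A + 1)) = η * (A / (A + 1)) := by ring
      _ ≤ η * 1 := by
        gcongr
        rw [div_le_one (by positivity)]; linarith
      _ = η := mul_one _
  have hFc := hFap.continuous
  -- The mean at `l` is within `O(η)` of that of a polynomial, which in turn equals the multiplier
  -- times the error of the coefficient. The multiplier is bounded in `l`, so the limit is `O(η)`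
  -- for every `η`.
  have hF0 : ∀ l, Tendsto (avg (fun t => F t * expi (-l) t)) atTop (𝓝 0) := by
    intro l
    rw [Metric.tendsto_atTop]
    intro δ hδ
    set η := δ / (2 * (A + B + 1)) with hη
    have hη0 : 0 < η := by positivity
    obtain ⟨s, b, h1, h2⟩ := happ η hη0
    set R : ℝ → ℂ := fun t => trigPoly s (fun l => b l * kerMult ε ρ l) t - P t with hR
    have hRc : Continuous R := (continuous_trigPoly _ _).sub (continuous_trigPoly _ _)
    have h3 : Tendsto (avg (fun t => R t * expi (-l) t)) atTop
        (𝓝 (kerMult ε ρ l * ((if l ∈ s then b l else 0) - fourierCoef f l))) := by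
      have h4 : R = trigPoly (s ∪ S) (fun l => (if l ∈ s then b l * kerMult ε ρ l else 0) -
        (if l ∈ S then fourierCoef f l else 0)) := by
        funext t; rw [hR]; exact hdiff _ _ t
      rw [h4]
      convert tendsto_avg_trigPoly _ _ l using 2
      rw [mul_sub, hmul l]
      by_cases hls : l ∈ s
      · by_cases hlS : l ∈ S <;> simp [hls, hlS, mul_comm]
      · by_cases hlS : l ∈ S <;> simp [hls, hlS]
    rw [Metric.tendsto_atTop] at h3
    obtain ⟨N, hN⟩ := h3 η hη0
    refine ⟨max N 1, fun L hL => ?_⟩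
    have hL0 : 0 < L := zero_lt_one.trans_le ((le_max_right _ _).trans hL)
    have h5 := (hN L ((le_max_left _ _).trans hL)).le
    rw [dist_eq_norm] at h5
    have h6 : ‖kerMult ε ρ l * ((if l ∈ s then b l else 0) - fourierCoef f l)‖ ≤ B * η := by
      rw [norm_mul]
      gcongr
      · exact hB l
      · rw [norm_sub_rev]; exact h2 l
    have h7 : ‖avg (fun t => F t * expi (-l) t) L - avg (fun t => R t * expi (-l) t) L‖ ≤ A * η := by
      rw [← avg_sub (g := fun t => F t * expi (-l) t) (h := fun t => R t * expi (-l) t)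
        ((hFc.mul (continuous_expi _)).intervalIntegrable _ _) ((hRc.mul (continuous_expi _)).intervalIntegrable _ _), avg, norm_mul, norm_div, norm_one,
        Complex.norm_real, Real.norm_of_nonneg hL0.le]
      have h8 : ‖∫ t in (0 : ℝ)..L, (F t * expi (-l) t - R t * expi (-l) t)‖ ≤
          A * η * |L - 0| := by
        refine intervalIntegral.norm_integral_le_of_norm_le_const fun t _ => ?_
        rw [← sub_mul, norm_mul, norm_expi, mul_one, hF, hR, sub_sub_sub_cancel_right]
        exact h1 t
      rw [sub_zero, abs_of_pos hL0] at h8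
      calc _ ≤ 1 / L * (A * η * L) := by gcongr
        _ = _ := by field_simp
    rw [dist_zero_right]
    set a1 := avg (fun t => F t * expi (-l) t) L
    set a2 := avg (fun t => R t * expi (-l) t) L
    set a3 := kerMult ε ρ l * ((if l ∈ s then b l else 0) - fourierCoef f l)
    have e : a1 = (a1 - a2) + (a2 - a3) + a3 := by ring
    rw [e]
    refine (norm_add_le _ _).trans_lt ?_
    have h9 := norm_add_le (a1 - a2) (a2 - a3)
    have h10 : (A + B + 1) * η = δ / 2 := by rw [hη]; field_simp
    nlinarith
  have := hFap.eq_zero hF0 x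
  rw [hps x]
  exact sub_eq_zero.1 this

end conv

/-! ### The class `Ω_{α,p}(w_x)` -/

lemma isProbabilityMeasure_mean {a b : ℝ} (hab : a < b) :
    IsProbabilityMeasure (ENNReal.ofReal (1 / (b - a)) • volume.restrict (Set.Ioc a b)) := by
  constructor
  have : 0 < b - a := by linarith
  rw [Measure.smul_apply, Measure.restrict_apply_univ, Real.volume_Ioc, smul_eq_mul,
    ← ENNReal.ofReal_mul (by positivity), one_div_mul_cancel this.ne', ENNReal.ofReal_one]

/-- The normalised measure is a probability measure, so `L^p` means increase with `p`. This replaces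
`p`, possibly infinite, by a finite exponent `r > 1`. -/
lemma integral_rpow_le_of_intervalMean_le {p : ℝ≥0∞} {r : ℝ} (hr : 0 < r)
    (hrp : ENNReal.ofReal r ≤ p) {a b : ℝ} (hab : a < b) {g : ℝ → ℂ}
    (hg : AEStronglyMeasurable g volume) {W : ℝ} (hW : 0 ≤ W)
    (h : intervalMean p a b g ≤ ENNReal.ofReal W) :
    ∫ t in Set.Ioc a b, ‖g t‖ ^ r ≤ (b - a) * W ^ r := by
  have hba : 0 < b - a := by linarith
  set μ := ENNReal.ofReal (1 / (b - a)) • volume.restrict (Set.Ioc a b) with hμ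
  have : IsProbabilityMeasure μ := isProbabilityMeasure_mean hab
  have hgμ : AEStronglyMeasurable g μ := hg.restrict.smul_measure _
  have h1 : eLpNorm g (ENNReal.ofReal r) μ ≤ ENNReal.ofReal W :=
    (eLpNorm_le_eLpNorm_of_exponent_le hrp hgμ).trans h
  rw [eLpNorm_eq_lintegral_rpow_enorm_toReal (by simpa using hr) ENNReal.ofReal_ne_top,
    ENNReal.toReal_ofReal hr.le, one_div, ENNReal.rpow_inv_le_iff hr, hμ, lintegral_smul_measure,
    smul_eq_mul] at h1
  have h2 : ∫⁻ t in Set.Ioc a b, ‖g t‖ₑ ^ r ≤ ENNReal.ofReal ((b - a) * W ^ r) := by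
    calc ∫⁻ t in Set.Ioc a b, ‖g t‖ₑ ^ r = ENNReal.ofReal (b - a) *
          (ENNReal.ofReal (1 / (b - a)) * ∫⁻ t in Set.Ioc a b, ‖g t‖ₑ ^ r) := by
          rw [← mul_assoc, ← ENNReal.ofReal_mul hba.le, mul_one_div_cancel hba.ne',
            ENNReal.ofReal_one, one_mul]
      _ ≤ ENNReal.ofReal (b - a) * ENNReal.ofReal W ^ r := by gcongr
      _ = _ := by rw [ENNReal.ofReal_mul hba.le, ENNReal.ofReal_rpow_of_nonneg hW hr.le]
  rw [integral_eq_lintegral_of_nonneg_ae (Eventually.of_forall fun _ => by positivity)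
    (hg.norm.aemeasurable.pow_const r).aestronglyMeasurable.restrict]
  refine ENNReal.toReal_le_of_le_ofReal (by positivity) (le_trans (le_of_eq ?_) h2)
  refine lintegral_congr fun t => ?_
  rw [← ENNReal.ofReal_rpow_of_nonneg (norm_nonneg _) hr.le, ofReal_norm]

lemma integral_norm_le_of_intervalMean_le {p : ℝ≥0∞} (hp : 1 ≤ p) {a b : ℝ} (hab : a < b)
    {g : ℝ → ℂ} (hg : AEStronglyMeasurable g volume) {W : ℝ} (hW : 0 ≤ W)
    (h : intervalMean p a b g ≤ ENNReal.ofReal W) :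
    ∫ t in Set.Ioc a b, ‖g t‖ ≤ (b - a) * W := by
  simpa using integral_rpow_le_of_intervalMean_le one_pos (by simpa using hp) hab hg hW h

lemma integral_norm_le_of_stepanovNorm_le {p : ℝ≥0∞} (hp : 1 ≤ p) {g : ℝ → ℂ}
    (hg : AEStronglyMeasurable g volume) {W : ℝ} (hW : 0 ≤ W)
    (h : stepanovNorm p g ≤ ENNReal.ofReal W) (u : ℝ) :
    ∫ t in Set.Ioc u (u + Real.pi), ‖g t‖ ≤ Real.pi * W := by
  have hpi := Real.pi_pos
  have key : intervalMean p u (u + Real.pi) g ≤ ENNReal.ofReal W := by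
    unfold stepanovNorm at h
    split_ifs at h with hp'
    · rw [hp', intervalMean, eLpNorm_exponent_top]
      refine eLpNormEssSup_le_of_ae_enorm_bound (Eventually.of_forall fun t => ?_)
      exact (le_iSup (fun u => ‖g u‖ₑ) t).trans h
    · exact (le_iSup (fun u => intervalMean p u (u + Real.pi) g) u).trans h
  have := integral_norm_le_of_intervalMean_le hp (by linarith : u < u + Real.pi) hg hW key
  simpa using this

lemma Omega.exists_isS1AP {α : ℝ} {p : ℝ≥0∞} (hp : 1 ≤ p) {f : ℝ → ℂ} (hf : Omega α p f) :
    ∃ M, IsS1AP M f := by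
  obtain ⟨M, hM⟩ := hf.bounded
  refine ⟨M, hf.stepanov.aestronglyMeasurable, hM, fun η hη => ?_⟩
  have hpi := Real.pi_pos
  obtain ⟨s, b, h⟩ := hf.stepanov.approx (ENNReal.ofReal (η / Real.pi))
    (by simpa using div_pos hη hpi)
  refine ⟨s, b, fun u => ?_⟩
  have := integral_norm_le_of_stepanovNorm_le hp
    (hf.stepanov.aestronglyMeasurable.sub (continuous_trigPoly s b).aestronglyMeasurable)
    (by positivity) h.le u
  rwa [mul_div_cancel₀ _ hpi.ne'] at this

/-- By the gap condition `⌊|l| / α⌋` is injective on the positive absolute values of exponents. -/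
lemma Omega.finite_exponents {α : ℝ} (hα : 0 < α) {p : ℝ≥0∞} {f : ℝ → ℂ} (hf : Omega α p f)
    (G : ℝ) : {l : ℝ | |l| ≤ G ∧ fourierCoef f l ≠ 0}.Finite := by
  set X : Set ℝ := (fun l : ℝ => |l|) '' {l : ℝ | |l| ≤ G ∧ fourierCoef f l ≠ 0 ∧ l ≠ 0} with hX
  have hXfin : X.Finite := by
    refine Set.Finite.of_finite_image (f := fun y : ℝ => ⌊y / α⌋)
      ((Set.finite_Icc 0 ⌊G / α⌋).subset ?_) ?_
    · rintro _ ⟨_, ⟨l, ⟨h1, -, -⟩, rfl⟩, rfl⟩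
      exact ⟨Int.floor_nonneg.2 (by positivity), Int.floor_le_floor (by gcongr)⟩
    · have hlt : ∀ l l' : ℝ, fourierCoef f l ≠ 0 → l ≠ 0 → fourierCoef f l' ≠ 0 →
          |l| < |l'| → ⌊|l| / α⌋ ≠ ⌊|l'| / α⌋ := by
        intro l l' h1 h2 h3 h4 h5
        have h6 := hf.gap l l' h1 h3 (abs_pos.2 h2) h4
        have h7 := Int.abs_sub_lt_one_of_floor_eq_floor h5
        rw [abs_sub_comm, ← sub_div, abs_of_pos (div_pos (by linarith) hα), div_lt_one hα] at h7
        linarith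
      rintro _ ⟨l, ⟨-, h2, h3⟩, rfl⟩ _ ⟨l', ⟨-, h2', h3'⟩, rfl⟩ heq
      rcases lt_trichotomy (|l|) (|l'|) with h | h | h
      · exact absurd heq (hlt l l' h2 h3 h2' h)
      · exact h
      · exact absurd heq.symm (hlt l' l h2' h3' h2 h)
  refine ((Set.finite_singleton (0 : ℝ)).union (hXfin.union (hXfin.image Neg.neg))).subset ?_
  rintro l ⟨h1, h2⟩
  by_cases hl : l = 0
  · exact Or.inl hl
  · right
    have hm : |l| ∈ X := ⟨l, ⟨h1, h2, hl⟩, rfl⟩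
    rcases abs_choice l with h | h
    · left; rwa [h] at hm
    · right; exact ⟨|l|, hm, by rw [h, neg_neg]⟩

lemma Omega.aestronglyMeasurable_phi {α : ℝ} {p : ℝ≥0∞} {f : ℝ → ℂ} (hf : Omega α p f) (x : ℝ) :
    AEStronglyMeasurable (phi f x) volume := by
  have hm := hf.stepanov.aestronglyMeasurable
  exact ((aestronglyMeasurable_add_left hm x).add (aestronglyMeasurable_sub_left hm x)).sub
    aestronglyMeasurable_const

/-- The integral representation of the deviation of the partial sums. -/
theorem Omega.exists_partialSum_sub_eq {α : ℝ} (hα : 0 < α) {p : ℝ≥0∞} (hp : 1 ≤ p) {f : ℝ → ℂ}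
    (hf : Omega α p f) (x : ℝ) {k : ℕ} (hk : 1 ≤ k) :
    ∃ ρ : ℝ, (ρ = α / 2 * k + α / 4 ∨ ρ = α / 2 * k - α / 4) ∧
      partialSum f (α * k / 2) x - f x = (1 / Real.pi : ℂ) * ∫ t in Set.Ioi (0 : ℝ),
        phi f x t * ((Real.sin (ρ * t) * kerK (α / 8) t : ℝ) : ℂ) := by
  obtain ⟨M, hM⟩ := hf.exists_isS1AP hp
  have hε : 0 < α / 8 := by positivity
  have hk1 : (1 : ℝ) ≤ k := by exact_mod_cast hk
  have hαk : α ≤ α * k := le_mul_of_one_le_right hα.le hk1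
  have hsep : ∃ ρ : ℝ, (ρ = α / 2 * k + α / 4 ∨ ρ = α / 2 * k - α / 4) ∧ ∀ l, fourierCoef f l ≠ 0 →
      kerMult (α / 8) ρ l = if |l| ≤ α * k / 2 then 1 else 0 := by
    -- An exponent in the window just above `αk/2` keeps all nonzero exponents below it at distance
    -- more than `α/2` from `αk/2`, so the transition zone is put below. Otherwise it is put into
    -- the window itself.
    by_cases hex : ∃ l, fourierCoef f l ≠ 0 ∧ α * k / 2 < |l| ∧ |l| < α * k / 2 + α / 2
    · obtain ⟨m, hm0, hm1, hm2⟩ := hex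
      refine ⟨α / 2 * k - α / 4, Or.inr rfl, fun l hl => ?_⟩
      by_cases hlk : |l| ≤ α * k / 2
      · rw [if_pos hlk]
        refine kerMult_eq_one hε ?_
        by_cases hl0 : l = 0
        · subst hl0; rw [abs_zero]; linarith
        · have := hf.gap l m hl hm0 (abs_pos.2 hl0) (by linarith)
          linarith
      · rw [if_neg hlk]
        exact kerMult_eq_zero hε (by linarith) (by linarith [not_le.1 hlk])
    · push Not at hex
      refine ⟨α / 2 * k + α / 4, Or.inl rfl, fun l hl => ?_⟩
      by_cases hlk : |l| ≤ α * k / 2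
      · rw [if_pos hlk]
        exact kerMult_eq_one hε (by linarith)
      · rw [if_neg hlk]
        have := hex l hl (not_le.1 hlk)
        exact kerMult_eq_zero hε (by linarith) (by linarith)
  obtain ⟨ρ, hρ, hmult⟩ := hsep
  refine ⟨ρ, hρ, ?_⟩
  rw [← kerConv_eq_partialSum hε hM (hf.finite_exponents hα _) hmult x]
  have hρ0 : |(0 : ℝ)| ≤ ρ - 2 * (α / 8) := by
    rw [abs_zero]
    rcases hρ with rfl | rfl <;> linarith
  have h1 := kerMult_eq_one hε hρ0
  -- The multiplier at frequency `0` is `1`, so `f x` has the same representation and the difference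
  -- produces `phi`.
  have h2 : f x = (1 / Real.pi : ℂ) * ∫ t in Set.Ioi (0 : ℝ),
      2 * f x * ((Real.sin (ρ * t) * kerK (α / 8) t : ℝ) : ℂ) := by
    rw [integral_const_mul, integral_complex_ofReal]
    rw [kerMult] at h1
    simp only [zero_mul, Real.cos_zero, mul_one] at h1
    rw [integral_const_mul] at h1
    push_cast at h1 ⊢
    linear_combination (-f x) * h1
  have hi2 : IntegrableOn (fun t => 2 * f x * ((Real.sin (ρ * t) * kerK (α / 8) t : ℝ) : ℂ))
      (Set.Ioi 0) := ((integrableOn_sin_mul_kerK hε ρ).ofReal (𝕜 := ℂ)).const_mul _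
  conv_lhs => rw [h2]
  rw [kerConv, ← mul_sub, ← integral_sub (integrableOn_kerConv hε ρ hM.meas hM.bound x) hi2]
  congr 2 with t
  rw [phi]; ring

namespace IsModulus
variable {w : ℝ → ℝ}

lemma nonneg (hw : IsModulus w) {s : ℝ} (hs : 0 ≤ s) : 0 ≤ w s := by
  have := hw.monotoneOn (Set.mem_Ici.2 le_rfl) (Set.mem_Ici.2 hs) hs
  rwa [hw.map_zero] at this

lemma le_nat_mul (hw : IsModulus w) {s : ℝ} (hs : 0 ≤ s) (n : ℕ) : w (n * s) ≤ n * w s := by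
  induction n with
  | zero => simp [hw.map_zero]
  | succ n ih =>
    push_cast
    rw [add_mul, add_mul, one_mul, one_mul]
    exact (hw.subadd _ _ (by positivity) hs).trans (by linarith)

lemma le_mul (hw : IsModulus w) {s γ : ℝ} (hs : 0 ≤ s) (hγ : 0 < γ) : w s ≤ (s / γ + 1) * w γ := by
  have h1 : s ≤ ⌈s / γ⌉₊ * γ := by
    have := Nat.le_ceil (s / γ)
    rwa [div_le_iff₀ hγ] at this
  have h2 : (⌈s / γ⌉₊ : ℝ) ≤ s / γ + 1 := (Nat.ceil_lt_add_one (by positivity)).le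
  calc w s ≤ w (⌈s / γ⌉₊ * γ) :=
        hw.monotoneOn (Set.mem_Ici.2 hs) (Set.mem_Ici.2 (hs.trans h1)) h1
    _ ≤ ⌈s / γ⌉₊ * w γ := hw.le_nat_mul hγ.le _
    _ ≤ _ := by gcongr; exact hw.nonneg hγ.le

end IsModulus

/-- The quadratic growth in `mean` comes from `w s ≤ (s/γ + 1) w γ ≤ 2 (s/γ) w γ` for `s ≥ γ`. The
bound `M` depends on `f` but serves only integrability and enters no constant. -/
lemma OmegaW.exists_shiftBound {α : ℝ} {p : ℝ≥0∞} {r : ℝ} (hr : 1 < r)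
    (hrp : ENNReal.ofReal r ≤ p) {x : ℝ} {w : ℝ → ℝ} (hw : IsModulus w) {C : ℝ≥0} {f : ℝ → ℂ}
    (hf : OmegaW α p x w C f) {γ : ℝ} (hγ : 0 < γ) :
    ∃ M, ShiftBound r γ (C * w γ) M (phi f x) := by
  have hp : 1 ≤ p := le_trans (by simpa using hr.le) hrp
  obtain ⟨M, hM⟩ := hf.omega.bounded
  have hm := hf.omega.aestronglyMeasurable_phi x
  have hd : AEStronglyMeasurable (fun t => phi f x t - phi f x (t + γ)) volume :=
    hm.sub (aestronglyMeasurable_comp_add hm γ)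
  have hcoe : ∀ y, (C : ℝ≥0∞) * ENNReal.ofReal y = ENNReal.ofReal (C * y) := fun y => by
    rw [ENNReal.ofReal_mul C.coe_nonneg, ENNReal.ofReal_coe_nnreal]
  have hwγ := hw.nonneg hγ.le
  refine ⟨M + M + 2 * M, hγ, hm, fun t => ?_, fun s hs => ?_, fun s hs => ?_, fun s hs => ?_⟩
  · refine (norm_sub_le _ _).trans (add_le_add ((norm_add_le _ _).trans
      (add_le_add (hM _) (hM _))) ?_)
    rw [norm_mul, Complex.norm_two]
    gcongr
    exact hM x
  · have hs0 : 0 < s := hγ.trans_le hs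
    have h1 := hf.modulus s hs0
    rw [hcoe] at h1
    have h2 := integral_norm_le_of_intervalMean_le hp hs0 hm
      (mul_nonneg C.coe_nonneg (hw.nonneg hs0.le)) h1
    rw [sub_zero] at h2
    refine h2.trans ?_
    have h3 := hw.le_mul hs0.le hγ
    have h4 : s / γ + 1 ≤ 2 * (s / γ) := by
      have : 1 ≤ s / γ := by rwa [one_le_div hγ]
      linarith
    calc s * (C * w s) ≤ s * (C * (2 * (s / γ) * w γ)) := by
          gcongr
          exact h3.trans (by gcongr)
      _ = _ := by ring
  · have h1 := hf.shift_add γ s hγ hs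
    rw [hcoe] at h1
    have h2 := integral_norm_le_of_intervalMean_le hp hs hd (by positivity) h1
    rw [sub_zero] at h2
    linarith
  · have h1 := hf.shift_add γ s hγ hs
    rw [hcoe] at h1
    have h2 := integral_rpow_le_of_intervalMean_le (by linarith) hrp hs hd (by positivity) h1
    rwa [sub_zero] at h2

/-! ### Strong means over dyadic blocks -/

/-- The strong means over a dyadic block, for large exponents. -/
theorem exists_block_pow_le {α : ℝ} (hα : 0 < α) {p : ℝ≥0∞} {r : ℝ} (hr : 1 < r)
    (hrp : ENNReal.ofReal r ≤ p) (C : ℝ≥0) {Q : ℕ} (hQ : 2 ≤ Q)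
    (hrQ : 1 < (r - 1) * ((Q : ℝ) - 1)) :
    ∃ K : ℝ, 0 ≤ K ∧ ∀ (x : ℝ) (w : ℝ → ℝ) (f : ℝ → ℂ), IsModulus w → OmegaW α p x w C f →
      ∀ m : ℕ, 1 ≤ m → ∑ k ∈ Finset.Ico m (2 * m), ‖partialSum f (α * k / 2) x - f x‖ ^ Q ≤
        m * (K * w (Real.pi / (m + 1))) ^ Q := by
  have hp : 1 ≤ p := le_trans (by simpa using hr.le) hrp
  have hpi := Real.pi_pos
  have hQ0 : (0 : ℝ) < Q := by exact_mod_cast (by omega : 0 < Q)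
  obtain ⟨A, hA0, hA⟩ := exists_lqNorm_integral_sin_le (α / 4) (half_pos hα)
    (by positivity : 0 < α / 8) hr hQ hrQ
  set Z : ℝ := (3 * α / (4 * Real.pi)) ^ (1 / (Q : ℝ)) with hZ
  refine ⟨A * C * (8 / (3 * α) + 1) * (1 + Z), by positivity, ?_⟩
  intro x w f hw hf m hm
  have hm1 : (1 : ℝ) ≤ m := by exact_mod_cast hm
  have hm0 : (0 : ℝ) < m := by linarith
  -- For `m ≤ k < 2m` the frequency `ρ k` lies between `αm/4` and `αm`. This `γ` sends that range
  -- onto `[π/3, 4π/3]`, where `|1 - e^{iργ}| ≥ 1`.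
  set γ := 4 * Real.pi / (3 * α * m) with hγ
  have hγ0 : 0 < γ := by positivity
  obtain ⟨M, hM⟩ := hf.exists_shiftBound hr hrp hw hγ0
  have hrep : ∀ k : ℕ, ∃ ρ : ℝ, 1 ≤ k → ((ρ = α / 2 * k + α / 4 ∨ ρ = α / 2 * k - α / 4) ∧
      partialSum f (α * k / 2) x - f x = (1 / Real.pi : ℂ) * ∫ t in Set.Ioi (0 : ℝ),
        phi f x t * ((Real.sin (ρ * t) * kerK (α / 8) t : ℝ) : ℂ)) := by
    intro k
    by_cases hk : 1 ≤ k
    · obtain ⟨ρ, h⟩ := hf.omega.exists_partialSum_sub_eq hα hp x hk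
      exact ⟨ρ, fun _ => h⟩
    · exact ⟨0, fun h => absurd h hk⟩
  choose ρ hρ using hrep
  have hmem : ∀ k ∈ Finset.Ico m (2 * m), 1 ≤ k := fun k hk => hm.trans (Finset.mem_Ico.1 hk).1
  have hang : ∀ k ∈ Finset.Ico m (2 * m), Real.pi / 3 ≤ ρ k * γ ∧ ρ k * γ ≤ 4 * Real.pi / 3 := by
    intro k hk
    have hk1 : (m : ℝ) ≤ k := by exact_mod_cast (Finset.mem_Ico.1 hk).1
    have hk2 : (k : ℝ) + 1 ≤ 2 * m := by exact_mod_cast (Finset.mem_Ico.1 hk).2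
    have e1 := mul_le_mul_of_nonneg_left hk1 hα.le
    have e2 := mul_le_mul_of_nonneg_left hk2 hα.le
    have e3 := mul_le_mul_of_nonneg_left hm1 hα.le
    have b : α * m / 4 ≤ ρ k ∧ ρ k ≤ α * m := by
      rcases (hρ k (hmem k hk)).1 with h | h <;> rw [h] <;> constructor <;> nlinarith
    constructor
    · calc Real.pi / 3 = α * m / 4 * γ := by rw [hγ]; field_simp
        _ ≤ _ := by gcongr; exact b.1
    · calc ρ k * γ ≤ α * m * γ := by gcongr; exact b.2
        _ = _ := by rw [hγ]; field_simp
  have h1 := hA (Finset.Ico m (2 * m)) ρ γ (C * w γ) M (phi f x) hM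
    (fun k hk => (hρ k (hmem k hk)).1) hang
  have hcard : ((Finset.Ico m (2 * m)).card : ℝ) = m := by
    rw [Nat.card_Ico]; congr 1; omega
  rw [hcard] at h1
  have h2 : lqNorm Q (Finset.Ico m (2 * m)) (fun k => partialSum f (α * k / 2) x - f x) ≤
      lqNorm Q (Finset.Ico m (2 * m)) (fun k => ∫ t in Set.Ioi (0 : ℝ),
        phi f x t * ((Real.sin (ρ k * t) * kerK (α / 8) t : ℝ) : ℂ)) := by
    refine lqNorm_mono fun k hk => ?_
    rw [(hρ k (hmem k hk)).2, norm_mul, norm_div, norm_one, Complex.norm_real,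
      Real.norm_of_nonneg hpi.le]
    refine mul_le_of_le_one_left (norm_nonneg _) ?_
    rw [div_le_one hpi]
    linarith [Real.pi_gt_three]
  have hv : 0 < Real.pi / (m + 1) := by positivity
  set V := w (Real.pi / (m + 1)) with hV
  have hV0 : 0 ≤ V := hw.nonneg hv.le
  have h3 : w γ ≤ (8 / (3 * α) + 1) * V := by
    have h : γ / (Real.pi / (m + 1)) ≤ 8 / (3 * α) := by
      have e : γ / (Real.pi / (m + 1)) = 4 * (m + 1) / (3 * α * m) := by rw [hγ]; field_simp
      rw [e, div_le_div_iff₀ (by positivity) (by positivity)]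
      nlinarith
    exact (hw.le_mul hγ0.le hv).trans (mul_le_mul_of_nonneg_right (by linarith) hV0)
  have h4 : (1 / γ) ^ (1 / (Q : ℝ)) = Z * (m : ℝ) ^ (1 / (Q : ℝ)) := by
    rw [hZ, ← Real.mul_rpow (by positivity) (by positivity)]
    congr 1
    rw [hγ]; field_simp
  have h5 : lqNorm Q (Finset.Ico m (2 * m)) (fun k => partialSum f (α * k / 2) x - f x) ≤
      A * C * (8 / (3 * α) + 1) * (1 + Z) * V * (m : ℝ) ^ (1 / (Q : ℝ)) := by
    refine h2.trans (h1.trans ?_)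
    rw [h4]
    calc A * (C * w γ) * ((m : ℝ) ^ (1 / (Q : ℝ)) + Z * (m : ℝ) ^ (1 / (Q : ℝ)))
        ≤ A * (C * ((8 / (3 * α) + 1) * V)) *
          ((m : ℝ) ^ (1 / (Q : ℝ)) + Z * (m : ℝ) ^ (1 / (Q : ℝ))) := by gcongr
      _ = _ := by ring
  rw [lqNorm_le_iff (by omega) (by positivity)] at h5
  refine h5.trans_eq ?_
  rw [mul_pow _ ((m : ℝ) ^ (1 / (Q : ℝ))), ← Real.rpow_natCast ((m : ℝ) ^ (1 / (Q : ℝ))),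
    ← Real.rpow_mul hm0.le, one_div_mul_cancel hQ0.ne', Real.rpow_one, mul_comm]

/-- The strong means over a dyadic block. -/
theorem exists_block_rpow_le {α : ℝ} (hα : 0 < α) {p : ℝ≥0∞} (hp : 1 < p) {q : ℝ} (hq : 0 < q)
    (C : ℝ≥0) :
    ∃ K : ℝ, 0 ≤ K ∧ ∀ (x : ℝ) (w : ℝ → ℝ) (f : ℝ → ℂ), IsModulus w → OmegaW α p x w C f →
      ∀ m : ℕ, 1 ≤ m → ∑ k ∈ Finset.Ico m (2 * m), ‖partialSum f (α * k / 2) x - f x‖ ^ q ≤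
        K * m * w (Real.pi / (m + 1)) ^ q := by
  obtain ⟨r, hr, hrp⟩ : ∃ r : ℝ, 1 < r ∧ ENNReal.ofReal r ≤ p := by
    obtain ⟨r, h1, h2⟩ := ENNReal.lt_iff_exists_nnreal_btwn.1 hp
    exact ⟨r, by exact_mod_cast h1, by rw [ENNReal.ofReal_coe_nnreal]; exact h2.le⟩
  -- Above `1/(r-1) + 1` the layers of the Hausdorff-Young argument are summable; above `q` the
  -- exponent can afterwards be lowered.
  obtain ⟨Q, hQ⟩ := exists_nat_gt (max (1 / (r - 1) + 1) (max q 2))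
  have hQ1 : 1 / (r - 1) + 1 < Q := (le_max_left _ _).trans_lt hQ
  have hQ2 : q < Q := ((le_max_left _ _).trans (le_max_right _ _)).trans_lt hQ
  have hQ3 : (2 : ℝ) < Q := ((le_max_right _ _).trans (le_max_right _ _)).trans_lt hQ
  have hr1 : 0 < r - 1 := by linarith
  have hrQ : 1 < (r - 1) * ((Q : ℝ) - 1) := by
    have : 1 / (r - 1) < (Q : ℝ) - 1 := by linarith
    rwa [div_lt_iff₀ hr1, mul_comm] at this
  obtain ⟨K, hK0, hK⟩ := exists_block_pow_le hα hr hrp C (by exact_mod_cast hQ3.le) hrQ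
  refine ⟨2 * K ^ q, by positivity, fun x w f hw hf m hm => ?_⟩
  have h := hK x w f hw hf m hm
  set V := w (Real.pi / (m + 1)) with hV
  have hV0 : 0 ≤ V := hw.nonneg (by positivity)
  set D : ℕ → ℝ := fun k => ‖partialSum f (α * k / 2) x - f x‖ with hD
  have hD0 : ∀ k, 0 ≤ D k := fun k => norm_nonneg _
  have hQne : Q ≠ 0 := by rintro rfl; norm_num at hQ3
  -- The negative power `B^(q-Q)` used below needs `B > 0`; if `K V = 0`, all deviations of the
  -- block vanish.
  rcases (mul_nonneg hK0 hV0).eq_or_lt with h0 | hpos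
  · rw [← h0, zero_pow hQne, mul_zero] at h
    have hz : ∀ k ∈ Finset.Ico m (2 * m), D k = 0 := by
      intro k hk
      have := (Finset.sum_eq_zero_iff_of_nonneg (fun k _ => pow_nonneg (hD0 k) Q)).1
        (le_antisymm h (Finset.sum_nonneg fun k _ => pow_nonneg (hD0 k) Q)) k hk
      exact pow_eq_zero_iff hQne |>.1 this
    rw [Finset.sum_eq_zero]
    · positivity
    · intro k hk
      rw [show ‖partialSum f (α * k / 2) x - f x‖ = D k from rfl, hz k hk, Real.zero_rpow hq.ne']
  · set B := K * V with hB
    -- One of the two terms dominates according as `D k ≤ B` or `D k ≥ B`. This lowers the exponent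
    -- without Hölder's inequality.
    have hpt : ∀ k, D k ^ q ≤ B ^ q + D k ^ Q * B ^ (q - Q) := by
      intro k
      rcases le_total (D k) B with hle | hle
      · have h1 : D k ^ q ≤ B ^ q := Real.rpow_le_rpow (hD0 k) hle hq.le
        have h2 : 0 ≤ D k ^ Q * B ^ (q - Q) := mul_nonneg (pow_nonneg (hD0 k) _) (by positivity)
        linarith
      · have hDpos : 0 < D k := hpos.trans_le hle
        have h1 : D k ^ q = D k ^ Q * D k ^ (q - Q) := by
          rw [← Real.rpow_natCast, ← Real.rpow_add hDpos]; congr 1; ring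
        have h2 : D k ^ (q - Q) ≤ B ^ (q - Q) :=
          Real.rpow_le_rpow_of_nonpos hpos hle (by linarith)
        have h3 : 0 ≤ B ^ q := by positivity
        rw [h1]
        have := mul_le_mul_of_nonneg_left h2 (pow_nonneg (hD0 k) Q)
        linarith
    calc ∑ k ∈ Finset.Ico m (2 * m), D k ^ q
        ≤ ∑ k ∈ Finset.Ico m (2 * m), (B ^ q + D k ^ Q * B ^ (q - Q)) :=
          Finset.sum_le_sum fun k _ => hpt k
      _ = m * B ^ q + (∑ k ∈ Finset.Ico m (2 * m), D k ^ Q) * B ^ (q - Q) := by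
          rw [Finset.sum_add_distrib, Finset.sum_const, Nat.card_Ico, Finset.sum_mul, nsmul_eq_mul]
          congr 3; omega
      _ ≤ m * B ^ q + (m * B ^ Q) * B ^ (q - Q) := by gcongr
      _ = m * B ^ q + m * (B ^ ((Q : ℝ) + (q - Q))) := by
          rw [Real.rpow_add hpos, Real.rpow_natCast]; ring
      _ = 2 * m * B ^ q := by rw [add_sub_cancel]; ring
      _ = 2 * K ^ q * m * V ^ q := by rw [hB, Real.mul_rpow hK0 hV0]; ring

/-! ### Exponential type zero and the term `k = 0` -/

/-- Bounded entire functions of exponential type zero are constant. -/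
lemma IsExpTypeBounded.eq_const {g : ℂ → ℂ} (hg : IsExpTypeBounded 0 g) (z : ℂ) : g z = g 0 := by
  obtain ⟨B, hB⟩ := hg.bounded
  -- Phragmén-Lindelöf for `h(z) e^{-εz}`, which is bounded on the positive real axis because the
  -- type is zero; then `ε → 0`. Rotating `g` by `±i` turns the real axis into the boundary of the
  -- half plane, and Liouville's theorem finishes.
  have half : ∀ h : ℂ → ℂ, Differentiable ℂ h →
      (∀ ε : ℝ, 0 < ε → ∃ M : ℝ, ∀ z : ℂ, ‖h z‖ ≤ M * Real.exp (ε * ‖z‖)) →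
      (∀ t : ℝ, ‖h (t * Complex.I)‖ ≤ B) → ∀ z : ℂ, 0 ≤ z.re → ‖h z‖ ≤ B := by
    intro h hd hexp hb z hz
    have key : ∀ ε : ℝ, 0 < ε → ‖h z‖ ≤ B * Real.exp (ε * z.re) := by
      intro ε hε
      obtain ⟨M, hM⟩ := hexp ε hε
      have hM0 : 0 ≤ M := by
        have := (norm_nonneg _).trans (hM 0)
        simpa using this
      set k : ℂ → ℂ := fun z => h z * Complex.exp (-(ε * z)) with hk
      have hkd : Differentiable ℂ k := hd.mul ((differentiable_id.const_mul _).neg.cexp)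
      have hkn : ∀ z, ‖k z‖ = ‖h z‖ * Real.exp (-(ε * z.re)) := by
        intro z
        rw [hk, norm_mul, Complex.norm_exp, Complex.neg_re, Complex.re_ofReal_mul]
      have hkz : ‖k z‖ ≤ B := by
        refine PhragmenLindelof.right_half_plane_of_bounded_on_real hkd.diffContOnCl
          ⟨1, by norm_num, ε + ε, ?_⟩ ?_ (fun t => ?_) hz
        · refine Asymptotics.IsBigO.of_bound M (Eventually.of_forall fun z => ?_)
          rw [hkn, Real.norm_of_nonneg (Real.exp_pos _).le, Real.rpow_one, add_mul, Real.exp_add,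
            ← mul_assoc]
          refine mul_le_mul (hM z) ?_ (Real.exp_pos _).le (by positivity)
          rw [Real.exp_le_exp]
          have := (abs_le.1 (Complex.abs_re_le_norm z)).1
          nlinarith
        · refine ⟨M, ?_⟩
          rw [eventually_map]
          filter_upwards [eventually_ge_atTop 0] with t ht
          rw [hkn, Complex.ofReal_re]
          have := hM t
          rw [Complex.norm_real, Real.norm_of_nonneg ht] at this
          calc _ ≤ M * Real.exp (ε * t) * Real.exp (-(ε * t)) := by gcongr
            _ = M := by rw [mul_assoc, ← Real.exp_add]; simp
        · rw [hkn]
          simpa using hb t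
      rw [hkn] at hkz
      calc ‖h z‖ = ‖h z‖ * Real.exp (-(ε * z.re)) * Real.exp (ε * z.re) := by
            rw [mul_assoc, ← Real.exp_add]; simp
        _ ≤ _ := by gcongr
    have hlim : Tendsto (fun ε : ℝ => B * Real.exp (ε * z.re)) (𝓝[>] 0) (𝓝 B) := by
      have : Tendsto (fun ε : ℝ => B * Real.exp (ε * z.re)) (𝓝 0) (𝓝 (B * Real.exp (0 * z.re))) :=
        Continuous.tendsto (by fun_prop) 0
      rw [zero_mul, Real.exp_zero, mul_one] at this
      exact this.mono_left nhdsWithin_le_nhds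
    refine ge_of_tendsto hlim ?_
    filter_upwards [self_mem_nhdsWithin] with ε hε using key ε hε
  have hrot : ∀ c : ℂ, ‖c‖ = 1 → (∀ t : ℝ, ‖g (c * (t * Complex.I))‖ ≤ B) →
      ∀ z : ℂ, 0 ≤ z.re → ‖g (c * z)‖ ≤ B := by
    intro c hc hb
    refine half (fun z => g (c * z)) (hg.entire.comp (differentiable_id.const_mul c)) ?_ hb
    intro ε hε
    obtain ⟨M, hM⟩ := hg.expType ε hε
    refine ⟨M, fun z => ?_⟩
    have := hM (c * z)
    rwa [norm_mul, hc, one_mul, zero_add] at this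
  have hall : ∀ z, ‖g z‖ ≤ B := by
    intro z
    rcases le_total 0 z.im with him | him
    · have := hrot Complex.I (by simp) (fun t => by
        have := hB (-t)
        rwa [show ((-t : ℝ) : ℂ) = Complex.I * (t * Complex.I) by
          push_cast; linear_combination (-(t : ℂ)) * Complex.I_sq] at this) (-Complex.I * z)
        (by simpa using him)
      rwa [show Complex.I * (-Complex.I * z) = z by linear_combination (-z) * Complex.I_sq] at this
    · have := hrot (-Complex.I) (by simp) (fun t => by
        have := hB t
        rwa [show (t : ℂ) = -Complex.I * (t * Complex.I) by
          linear_combination (t : ℂ) * Complex.I_sq] at this) (Complex.I * z)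
        (by simpa using him)
      rwa [show -Complex.I * (Complex.I * z) = z by linear_combination (-z) * Complex.I_sq] at this
  refine hg.entire.apply_eq_apply_of_bounded ?_ z 0
  rw [isBounded_iff_forall_norm_le]
  exact ⟨B, by rintro _ ⟨z, rfl⟩; exact hall z⟩

lemma partialSum_zero (f : ℝ → ℂ) (x : ℝ) : partialSum f 0 x = fourierCoef f 0 := by
  have h := finsum_mem_singleton (f := fun l : ℝ => fourierCoef f l * Complex.exp (Complex.I * l * x))
    (a := 0)
  simp only [Complex.ofReal_zero, mul_zero, zero_mul, Complex.exp_zero, mul_one] at h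
  rw [← h, partialSum]
  refine finsum_congr fun l => ?_
  simp only [abs_nonpos_iff, Set.mem_singleton_iff]

/-- The deviation of the mean value. -/
lemma OmegaW.enorm_partialSum_zero_sub_le {α : ℝ} {p : ℝ≥0∞} (hp : 1 ≤ p) {x : ℝ} {w : ℝ → ℝ}
    (hw : IsModulus w) {C : ℝ≥0} {f : ℝ → ℂ} (hf : OmegaW α p x w C f) :
    ‖partialSum f 0 x - f x‖ₑ ≤
      ((C + 5 : ℝ≥0) : ℝ≥0∞) * (ENNReal.ofReal (w Real.pi) + bestApprox p 0 f) := by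
  have hpi := Real.pi_pos
  obtain ⟨M, hM⟩ := hf.omega.exists_isS1AP hp
  have hw0 := hw.nonneg hpi.le
  have key : ∀ g, IsExpTypeBounded 0 g → ‖partialSum f 0 x - f x‖ₑ ≤
      ((C + 5 : ℝ≥0) : ℝ≥0∞) * (ENNReal.ofReal (w Real.pi) +
        stepanovNorm p (fun t : ℝ => f t - g t)) := by
    intro g hg
    set c := g 0 with hc
    have hgc : (fun t : ℝ => f t - g t) = fun t => f t - c := by
      funext t; rw [hg.eq_const]
    rw [hgc]
    by_cases htop : stepanovNorm p (fun t => f t - c) = ∞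
    · rw [htop, add_top, ENNReal.mul_top]
      · exact le_top
      · simp
    set W := (stepanovNorm p (fun t => f t - c)).toReal with hW
    have hW0 : 0 ≤ W := ENNReal.toReal_nonneg
    have hWe : stepanovNorm p (fun t => f t - c) = ENNReal.ofReal W := (ENNReal.ofReal_toReal htop).symm
    have hfm : AEStronglyMeasurable (fun t => f t - c) volume :=
      hM.meas.sub aestronglyMeasurable_const
    have hfb : ∀ t, ‖f t - c‖ ≤ M + ‖c‖ := fun t => (norm_sub_le _ _).trans (by
      have := hM.bound t; linarith)
    have hS := integral_norm_le_of_stepanovNorm_le hp hfm hW0 hWe.le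
    have h1 : ‖fourierCoef f 0 - c‖ ≤ Real.pi * W := by
      have ht := hM.tendsto_avg_fourierCoef 0
      simp only [neg_zero, expi_zero_left, mul_one] at ht
      refine le_of_tendsto (ht.sub_const c).norm ?_
      filter_upwards [eventually_ge_atTop Real.pi] with L hL
      have hL0 : 0 < L := hpi.trans_le hL
      have e : avg (fun t => f t) L - c = avg (fun t => f t - c) L := by
        rw [avg_sub (h := fun _ => c) (intervalIntegrable_of_bound hM.meas hM.bound _ _)
          (continuous_const.intervalIntegrable _ _)]
        congr 1
        rw [avg, intervalIntegral.integral_const, sub_zero, Complex.real_smul]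
        have : (L : ℂ) ≠ 0 := by exact_mod_cast hL0.ne'
        field_simp
      rw [e]
      exact norm_avg_le_of_stepanov hfm hfb hS hL
    -- The value at the single point `x` is reached through `2(f(x) - c) = (f(x+t) - c) + (f(x-t) -
    -- c) - φ_x(t)`, averaged over `0 < t < π`.
    have h2 : ‖f x - c‖ ≤ W + C * w Real.pi := by
      have hφ := hf.modulus Real.pi hpi
      rw [← ENNReal.ofReal_coe_nnreal, ← ENNReal.ofReal_mul C.coe_nonneg] at hφ
      have hφm := hf.omega.aestronglyMeasurable_phi x
      have a1 := integral_norm_le_of_intervalMean_le hp hpi hφm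
        (mul_nonneg C.coe_nonneg hw0) hφ
      rw [sub_zero, ← intervalIntegral.integral_of_le hpi.le] at a1
      have a2 := hS x
      rw [← intervalIntegral.integral_of_le (by linarith)] at a2
      have a3 := hS (x - Real.pi)
      rw [sub_add_cancel, ← intervalIntegral.integral_of_le (by linarith)] at a3
      have ip : IntervalIntegrable (fun t => ‖phi f x t‖) volume 0 Real.pi :=
        intervalIntegrable_of_bound hφm.norm (M := M + M + 2 * M) (fun t => by
          rw [norm_norm]
          refine (norm_sub_le _ _).trans (add_le_add ((norm_add_le _ _).trans
            (add_le_add (hM.bound _) (hM.bound _))) ?_)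
          rw [norm_mul, Complex.norm_two]
          gcongr
          exact hM.bound x) _ _
      have i1 : IntervalIntegrable (fun t => ‖f (x + t) - c‖) volume 0 Real.pi :=
        intervalIntegrable_of_bound (aestronglyMeasurable_add_left hfm x).norm (M := M + ‖c‖)
          (fun t => by rw [norm_norm]; exact hfb _) _ _
      have i2 : IntervalIntegrable (fun t => ‖f (x - t) - c‖) volume 0 Real.pi :=
        intervalIntegrable_of_bound (aestronglyMeasurable_sub_left hfm x).norm (M := M + ‖c‖)
          (fun t => by rw [norm_norm]; exact hfb _) _ _
      have a4 : ∫ _ in (0 : ℝ)..Real.pi, 2 * ‖f x - c‖ ≤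
          ∫ t in (0 : ℝ)..Real.pi, (‖f (x + t) - c‖ + ‖f (x - t) - c‖ + ‖phi f x t‖) := by
        refine intervalIntegral.integral_mono_on hpi.le (continuous_const.intervalIntegrable _ _)
          ((i1.add i2).add ip) fun t _ => ?_
        have e : 2 * (f x - c) = (f (x + t) - c) + (f (x - t) - c) - phi f x t := by
          rw [phi]; ring
        have := norm_mul (2 : ℂ) (f x - c)
        rw [Complex.norm_two] at this
        rw [← this, e]
        exact (norm_sub_le _ _).trans (add_le_add_left (norm_add_le _ _) _)
      rw [intervalIntegral.integral_add (i1.add i2) ip, intervalIntegral.integral_add i1 i2,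
        intervalIntegral.integral_comp_add_left (fun t => ‖f t - c‖),
        intervalIntegral.integral_comp_sub_left (fun t => ‖f t - c‖), add_zero, sub_zero,
        intervalIntegral.integral_const, sub_zero, smul_eq_mul] at a4
      have a5 : Real.pi * (2 * ‖f x - c‖) ≤ Real.pi * (2 * W + C * w Real.pi) := by linarith
      have a6 := le_of_mul_le_mul_left a5 hpi
      have a7 : 0 ≤ C * w Real.pi := mul_nonneg C.coe_nonneg hw0
      linarith
    rw [hWe, partialSum_zero, ← ENNReal.ofReal_add hw0 hW0, ← ENNReal.ofReal_coe_nnreal,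
      ← ENNReal.ofReal_mul (by positivity), ← ofReal_norm]
    refine ENNReal.ofReal_le_ofReal ?_
    have h3 : ‖fourierCoef f 0 - f x‖ ≤ ‖fourierCoef f 0 - c‖ + ‖f x - c‖ := by
      rw [← sub_sub_sub_cancel_right _ _ c]; exact norm_sub_le _ _
    have h4 : Real.pi * W ≤ 4 * W := by
      gcongr; linarith [Real.pi_lt_d2]
    have h5 : 0 ≤ C * W := mul_nonneg C.coe_nonneg hW0
    push_cast
    nlinarith
  have hne : ((C + 5 : ℝ≥0) : ℝ≥0∞) ≠ 0 := by simp
  -- The infimum is isolated on one side, so that the bound for each `g` can be taken under it.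
  rw [← ENNReal.div_le_iff' hne ENNReal.coe_ne_top, ← tsub_le_iff_left]
  refine le_iInf₂ fun g hg => ?_
  rw [tsub_le_iff_left, ENNReal.div_le_iff' hne ENNReal.coe_ne_top]
  exact key g hg

/-! ### Sequences of class `GM(₂β)` -/

lemma le_add_sum_Ico_abs_sub (a : ℕ → ℝ) {m n i k : ℕ} (hi : i ∈ Finset.Ico m n)
    (hk : k ∈ Finset.Ico m n) : a k ≤ a i + ∑ j ∈ Finset.Ico m n, |a j - a (j + 1)| := by
  rw [Finset.mem_Ico] at hi hk
  have key : ∀ i k : ℕ, m ≤ i → k < n → i ≤ k →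
      |a i - a k| ≤ ∑ j ∈ Finset.Ico m n, |a j - a (j + 1)| := fun i k h1 h2 h3 =>
    (dist_le_Ico_sum_dist a h3).trans (Finset.sum_le_sum_of_subset_of_nonneg
      (Finset.Ico_subset_Ico h1 h2.le) fun _ _ _ => abs_nonneg _)
  rcases le_total i k with h | h
  · linarith [(abs_le.1 (key i k hi.1 hk.2 h)).1]
  · linarith [(abs_le.1 (key k i hk.1 hi.2 h)).2]

/-- A term of a `GM(₂β)` sequence is controlled by the mean of the terms of comparable index. -/
lemma IsGM.mul_le_sum {c : ℝ} (hc : 1 < c) {K₀ : ℝ≥0} {a : ℕ → ℝ} (ha0 : ∀ k, 0 ≤ a k)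
    (ha : IsGM c K₀ a) {m : ℕ} (hm : 1 ≤ ⌊(m : ℝ) / c⌋₊) {k : ℕ} (hk : k ∈ Finset.Ico m (2 * m)) :
    m * a k ≤ (1 + 2 * c * K₀) * ∑ i ∈ Finset.Icc ⌊(m : ℝ) / c⌋₊ ⌊2 * c * m⌋₊, a i := by
  have hc0 : 0 < c := by linarith
  set S := ∑ i ∈ Finset.Icc ⌊(m : ℝ) / c⌋₊ ⌊2 * c * m⌋₊, a i with hS
  set T := ∑ j ∈ Finset.Ico m (2 * m), |a j - a (j + 1)| with hT
  have h1 : ∑ i ∈ Finset.Ico m (2 * m), a i ≤ S := by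
    refine Finset.sum_le_sum_of_subset_of_nonneg (fun i hi => ?_) fun i _ _ => ha0 i
    rw [Finset.mem_Ico] at hi
    rw [Finset.mem_Icc]
    constructor
    · refine le_trans (Nat.floor_le_of_le ?_) hi.1
      exact div_le_self (by positivity) hc.le
    · refine Nat.le_floor ?_
      have : (i : ℝ) ≤ 2 * m := by exact_mod_cast hi.2.le
      nlinarith [(Nat.cast_nonneg m : (0 : ℝ) ≤ m)]
  have h2 : m * T ≤ 2 * c * K₀ * S := by
    calc m * T ≤ m * (K₀ * ∑ k ∈ Finset.Icc ⌊(m : ℝ) / c⌋₊ ⌊c * (m : ℝ)⌋₊, |a k| / (k : ℝ)) := by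
          gcongr
          exact ha m hm
      _ = K₀ * ∑ k ∈ Finset.Icc ⌊(m : ℝ) / c⌋₊ ⌊c * (m : ℝ)⌋₊, m * (|a k| / (k : ℝ)) := by
          rw [Finset.mul_sum, Finset.mul_sum, Finset.mul_sum]
          exact Finset.sum_congr rfl fun _ _ => by ring
      _ ≤ K₀ * ∑ k ∈ Finset.Icc ⌊(m : ℝ) / c⌋₊ ⌊c * (m : ℝ)⌋₊, 2 * c * a k := by
          refine mul_le_mul_of_nonneg_left (Finset.sum_le_sum fun i hi => ?_) K₀.coe_nonneg
          rw [Finset.mem_Icc] at hi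
          have hi1 : (1 : ℝ) ≤ i := by exact_mod_cast hm.trans hi.1
          -- Since `i ≥ 1`, this gives `m < c (i + 1) ≤ 2ci`, the source of the factor `2c`.
          have h3 : (m : ℝ) / c < i + 1 :=
            (Nat.lt_floor_add_one _).trans_le (by exact_mod_cast Nat.succ_le_succ hi.1)
          rw [div_lt_iff₀ hc0] at h3
          rw [abs_of_nonneg (ha0 i), mul_div_assoc', div_le_iff₀ (by linarith)]
          have h4 : (m : ℝ) ≤ 2 * c * i := by nlinarith
          nlinarith [mul_le_mul_of_nonneg_right h4 (ha0 i)]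
      _ ≤ K₀ * (2 * c * S) := by
          rw [← Finset.mul_sum]
          gcongr
          refine Finset.sum_le_sum_of_subset_of_nonneg (Finset.Icc_subset_Icc le_rfl
            (Nat.floor_le_floor ?_)) fun i _ _ => ha0 i
          nlinarith [mul_nonneg hc0.le (Nat.cast_nonneg m : (0 : ℝ) ≤ m)]
      _ = _ := by ring
  -- The bound of `a k` by `a i` plus the variation `T` is summed over the `m` indices `i` of the
  -- block.
  calc m * a k = ∑ _i ∈ Finset.Ico m (2 * m), a k := by
        rw [Finset.sum_const, Nat.card_Ico, nsmul_eq_mul]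
        congr 2
        omega
    _ ≤ ∑ i ∈ Finset.Ico m (2 * m), (a i + T) :=
        Finset.sum_le_sum fun i hi => le_add_sum_Ico_abs_sub a hi hk
    _ = ∑ i ∈ Finset.Ico m (2 * m), a i + m * T := by
        rw [Finset.sum_add_distrib, Finset.sum_const, Nat.card_Ico, nsmul_eq_mul]
        congr 3
        omega
    _ ≤ S + 2 * c * K₀ * S := add_le_add h1 h2
    _ = _ := by ring

/-- At least `k/2` terms, each at least `1/k`. The blocks `[m, 2m)` containing `k` are those with
`k/2 < m ≤ k`, so averaging over all `m` with weight `1/m` can replace a dyadic partition. -/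
lemma half_le_sum_Ioc_inv {k : ℕ} (hk : 1 ≤ k) :
    (1 / 2 : ℝ) ≤ ∑ m ∈ Finset.Ioc (k / 2) k, (1 / m : ℝ) := by
  have hk0 : (0 : ℝ) < k := by exact_mod_cast hk
  have h : ∑ _m ∈ Finset.Ioc (k / 2) k, (1 / k : ℝ) ≤ ∑ m ∈ Finset.Ioc (k / 2) k, (1 / m : ℝ) := by
    refine Finset.sum_le_sum fun m hm => ?_
    rw [Finset.mem_Ioc] at hm
    have : (0 : ℝ) < m := by exact_mod_cast (by omega : 0 < m)
    exact one_div_le_one_div_of_le this (by exact_mod_cast hm.2)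
  refine le_trans ?_ h
  rw [Finset.sum_const, Nat.card_Ioc, nsmul_eq_mul, mul_one_div, div_le_div_iff₀ two_pos hk0]
  have : k ≤ (k - k / 2) * 2 := by omega
  rw [one_mul]
  exact_mod_cast this

/-- There are at most `b i` such `m`, and each satisfies `1/m ≤ b/i`. This bounds how often an index
is counted when the block estimates are added. -/
lemma sum_inv_le_of_mem {b : ℝ} (hb : 0 < b) {i : ℕ} (hi : 1 ≤ i) {s : Finset ℕ}
    (hs : ∀ m ∈ s, 1 ≤ m ∧ (m : ℝ) ≤ b * i ∧ (i : ℝ) ≤ b * m) :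
    ∑ m ∈ s, (1 / m : ℝ) ≤ b ^ 2 := by
  have hi0 : (0 : ℝ) < i := by exact_mod_cast hi
  have hsub : s ⊆ Finset.Ioc 0 ⌊b * i⌋₊ := fun m hm => by
    obtain ⟨h1, h2, -⟩ := hs m hm
    exact Finset.mem_Ioc.2 ⟨h1, Nat.le_floor h2⟩
  have hcard : (s.card : ℝ) ≤ b * i := by
    refine le_trans ?_ (Nat.floor_le (by positivity : 0 ≤ b * i))
    have := Finset.card_le_card hsub
    rw [Nat.card_Ioc, Nat.sub_zero] at this
    exact_mod_cast this
  calc ∑ m ∈ s, (1 / m : ℝ) ≤ ∑ _m ∈ s, b / i := by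
        refine Finset.sum_le_sum fun m hm => ?_
        obtain ⟨h1, -, h3⟩ := hs m hm
        have : (0 : ℝ) < m := by exact_mod_cast h1
        rw [div_le_div_iff₀ this hi0]
        linarith
    _ = s.card * (b / i) := by rw [Finset.sum_const, nsmul_eq_mul]
    _ ≤ b * i * (b / i) := by gcongr
    _ = b ^ 2 := by field_simp

/-- Summation of block estimates against the weights of a `GM(₂β)` sequence. -/
theorem IsGM.sum_mul_le {c : ℝ} (hc : 1 < c) {K₀ : ℝ≥0} {a : ℕ → ℝ} (ha0 : ∀ k, 0 ≤ a k)
    (ha : IsGM c K₀ a) {D v : ℕ → ℝ} (hD : ∀ k, 0 ≤ D k) (hv : ∀ k, 0 ≤ v k) {B R : ℝ}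
    (hB : 0 ≤ B) (hR : 0 ≤ R)
    (hblock : ∀ m : ℕ, 1 ≤ m → ∑ k ∈ Finset.Ico m (2 * m), D k ≤ B * m * v m)
    (hvR : ∀ m i : ℕ, (i : ℝ) ≤ 2 * c * m → v m ≤ R * v i) (N : ℕ) :
    ∑ k ∈ Finset.Ico 1 N, a k * D k ≤
      (2 * B * ⌈c⌉₊ + 2 * ((1 + 2 * c * K₀) * B * R * (2 * c) ^ 2)) *
        ∑ i ∈ Finset.Icc 1 ⌊2 * c * N⌋₊, a i * v i := by
  have hc0 : 0 < c := by linarith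
  set m₀ := ⌈c⌉₊ with hm₀
  have hm₀1 : 1 ≤ m₀ := Nat.one_le_ceil_iff.2 hc0
  set L : ℝ := (1 + 2 * c * K₀) * B * R with hL
  have hL0 : 0 ≤ L := by positivity
  set S := ∑ i ∈ Finset.Icc 1 ⌊2 * c * N⌋₊, a i * v i with hS
  have hnn : ∀ i, 0 ≤ a i * v i := fun i => mul_nonneg (ha0 i) (hv i)
  have hnD : ∀ i, 0 ≤ a i * D i := fun i => mul_nonneg (ha0 i) (hD i)
  have hfl : ∀ m : ℕ, m₀ ≤ m → 1 ≤ ⌊(m : ℝ) / c⌋₊ := fun m hm => by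
    rw [Nat.one_le_floor_iff, one_le_div hc0]
    exact (Nat.le_ceil c).trans (by exact_mod_cast hm)
  -- one block
  have hone : ∀ m : ℕ, m₀ ≤ m → ∑ k ∈ Finset.Ico m (2 * m), a k * D k ≤
      L * ∑ i ∈ Finset.Icc ⌊(m : ℝ) / c⌋₊ ⌊2 * c * m⌋₊, a i * v i := by
    intro m hm
    have hm0 : (0 : ℝ) < m := by exact_mod_cast hm₀1.trans hm
    set Y := ∑ i ∈ Finset.Icc ⌊(m : ℝ) / c⌋₊ ⌊2 * c * m⌋₊, a i with hY
    have hY0 : 0 ≤ Y := Finset.sum_nonneg fun i _ => ha0 i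
    have h1 : ∀ k ∈ Finset.Ico m (2 * m), a k ≤ (1 + 2 * c * K₀) * Y / m := fun k hk => by
      rw [le_div_iff₀ hm0, mul_comm]
      exact ha.mul_le_sum hc ha0 (hfl m hm) hk
    calc ∑ k ∈ Finset.Ico m (2 * m), a k * D k
        ≤ ∑ k ∈ Finset.Ico m (2 * m), (1 + 2 * c * K₀) * Y / m * D k :=
          Finset.sum_le_sum fun k hk => mul_le_mul_of_nonneg_right (h1 k hk) (hD k)
      _ = (1 + 2 * c * K₀) * Y / m * ∑ k ∈ Finset.Ico m (2 * m), D k :=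
          (Finset.mul_sum _ _ _).symm
      _ ≤ (1 + 2 * c * K₀) * Y / m * (B * m * v m) := by
          refine mul_le_mul_of_nonneg_left (hblock m (hm₀1.trans hm)) (by positivity)
      _ = (1 + 2 * c * K₀) * B * (Y * v m) := by field_simp
      _ = (1 + 2 * c * K₀) * B * ∑ i ∈ Finset.Icc ⌊(m : ℝ) / c⌋₊ ⌊2 * c * m⌋₊, a i * v m := by
          rw [hY, Finset.sum_mul]
      _ ≤ (1 + 2 * c * K₀) * B *
          ∑ i ∈ Finset.Icc ⌊(m : ℝ) / c⌋₊ ⌊2 * c * m⌋₊, R * (a i * v i) := by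
          refine mul_le_mul_of_nonneg_left (Finset.sum_le_sum fun i hi => ?_) (by positivity)
          rw [Finset.mem_Icc] at hi
          have h := hvR m i ((Nat.le_floor_iff (by positivity)).1 hi.2)
          calc a i * v m ≤ a i * (R * v i) := mul_le_mul_of_nonneg_left h (ha0 i)
            _ = _ := by ring
      _ = _ := by rw [← Finset.mul_sum]; ring
  have hNfl : N ≤ ⌊2 * c * N⌋₊ := Nat.le_floor (by nlinarith [(Nat.cast_nonneg N : (0 : ℝ) ≤ N)])
  -- For small `m` the `GM` condition says nothing, since `⌊m/c⌋` may be `0`. Each of these finitely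
  -- many terms is bounded by the block that starts at `k` itself.
  have hsmall : ∑ k ∈ Finset.Ico 1 (2 * m₀) with k < N, a k * D k ≤ 2 * B * m₀ * S := by
    calc ∑ k ∈ Finset.Ico 1 (2 * m₀) with k < N, a k * D k
        ≤ ∑ k ∈ Finset.Ico 1 (2 * m₀) with k < N, 2 * B * m₀ * (a k * v k) := by
          refine Finset.sum_le_sum fun k hk => ?_
          rw [Finset.mem_filter, Finset.mem_Ico] at hk
          have h1 : D k ≤ B * k * v k :=
            (Finset.single_le_sum (f := D) (fun i _ => hD i)
              (Finset.mem_Ico.2 ⟨le_rfl, by omega⟩)).trans (hblock k hk.1.1)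
          have h2 : (k : ℝ) ≤ 2 * m₀ := by exact_mod_cast hk.1.2.le
          calc a k * D k ≤ a k * (B * k * v k) := mul_le_mul_of_nonneg_left h1 (ha0 k)
            _ = B * (a k * v k) * k := by ring
            _ ≤ B * (a k * v k) * (2 * m₀) :=
                mul_le_mul_of_nonneg_left h2 (mul_nonneg hB (hnn k))
            _ = _ := by ring
      _ ≤ _ := by
          rw [← Finset.mul_sum]
          refine mul_le_mul_of_nonneg_left ?_ (by positivity)
          refine Finset.sum_le_sum_of_subset_of_nonneg (fun k hk => ?_) fun i _ _ => hnn i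
          rw [Finset.mem_filter, Finset.mem_Ico] at hk
          exact Finset.mem_Icc.2 ⟨hk.1.1, hk.2.le.trans hNfl⟩
  -- For `k ≥ 2m₀` every `m` with `k/2 < m ≤ k` is at least `m₀`, so the single block estimate
  -- applies. The order of summation is changed twice: from `k` to the blocks `m`, then to the
  -- comparable indices `i`.
  have hlarge : ∑ k ∈ Finset.Ico (2 * m₀) N, a k * D k ≤ 2 * (L * (2 * c) ^ 2) * S := by
    calc ∑ k ∈ Finset.Ico (2 * m₀) N, a k * D k
        ≤ ∑ k ∈ Finset.Ico (2 * m₀) N, ∑ m ∈ Finset.Ioc (k / 2) k, 2 * (1 / m * (a k * D k)) := by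
          refine Finset.sum_le_sum fun k hk => ?_
          rw [Finset.mem_Ico] at hk
          rw [← Finset.mul_sum, ← Finset.sum_mul]
          have := mul_le_mul_of_nonneg_right (half_le_sum_Ioc_inv (by omega : 1 ≤ k)) (hnD k)
          linarith
      _ ≤ ∑ m ∈ Finset.Ico m₀ N, ∑ k ∈ Finset.Ico m (2 * m), 2 * (1 / m * (a k * D k)) := by
          rw [Finset.sum_comm' (t' := Finset.Ico m₀ N)
            (s' := fun m => (Finset.Ico m (2 * m)).filter fun k => 2 * m₀ ≤ k ∧ k < N)]
          · refine Finset.sum_le_sum fun m _ => Finset.sum_le_sum_of_subset_of_nonneg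
              (Finset.filter_subset _ _) fun k _ _ => ?_
            have := hnD k
            positivity
          · intro k m
            simp only [Finset.mem_filter, Finset.mem_Ico, Finset.mem_Ioc]
            omega
      _ = 2 * ∑ m ∈ Finset.Ico m₀ N, 1 / m * ∑ k ∈ Finset.Ico m (2 * m), a k * D k := by
          simp only [Finset.mul_sum]
      _ ≤ 2 * ∑ m ∈ Finset.Ico m₀ N,
          1 / m * (L * ∑ i ∈ Finset.Icc ⌊(m : ℝ) / c⌋₊ ⌊2 * c * m⌋₊, a i * v i) := by
          gcongr with m hm
          exact hone m (Finset.mem_Ico.1 hm).1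
      _ = 2 * L * ∑ m ∈ Finset.Ico m₀ N,
          ∑ i ∈ Finset.Icc ⌊(m : ℝ) / c⌋₊ ⌊2 * c * m⌋₊, 1 / m * (a i * v i) := by
          simp only [Finset.mul_sum]
          exact Finset.sum_congr rfl fun _ _ => Finset.sum_congr rfl fun _ _ => by ring
      _ = 2 * L * ∑ i ∈ Finset.Icc 1 ⌊2 * c * N⌋₊,
          ∑ m ∈ (Finset.Ico m₀ N).filter
            fun m : ℕ => i ∈ Finset.Icc ⌊(m : ℝ) / c⌋₊ ⌊2 * c * m⌋₊, 1 / m * (a i * v i) := by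
          congr 1
          refine Finset.sum_comm' fun m i => ?_
          simp only [Finset.mem_filter, Finset.mem_Icc, Finset.mem_Ico]
          refine ⟨fun h => ⟨⟨h.1, h.2⟩, (hfl m h.1.1).trans h.2.1, h.2.2.trans ?_⟩,
            fun h => h.1⟩
          refine Nat.floor_le_floor ?_
          have : (m : ℝ) ≤ N := by exact_mod_cast h.1.2.le
          gcongr
      _ ≤ 2 * L * ∑ i ∈ Finset.Icc 1 ⌊2 * c * N⌋₊, (2 * c) ^ 2 * (a i * v i) := by
          refine mul_le_mul_of_nonneg_left (Finset.sum_le_sum fun i hi => ?_) (by positivity)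
          rw [← Finset.sum_mul]
          refine mul_le_mul_of_nonneg_right ?_ (hnn i)
          have hi1 := (Finset.mem_Icc.1 hi).1
          refine sum_inv_le_of_mem (by positivity) hi1 fun m hm => ?_
          simp only [Finset.mem_filter, Finset.mem_Icc, Finset.mem_Ico] at hm
          refine ⟨hm₀1.trans hm.1.1, ?_, (Nat.le_floor_iff (by positivity)).1 hm.2.2⟩
          have h3 : (m : ℝ) / c < i + 1 :=
            (Nat.lt_floor_add_one _).trans_le (by exact_mod_cast Nat.succ_le_succ hm.2.1)
          rw [div_lt_iff₀ hc0] at h3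
          have : (1 : ℝ) ≤ i := by exact_mod_cast hi1
          nlinarith
      _ = _ := by rw [← Finset.mul_sum]; ring
  have hsplit : Finset.Ico 1 N ⊆ (Finset.Ico 1 (2 * m₀)).filter (· < N) ∪ Finset.Ico (2 * m₀) N := by
    intro k hk
    simp only [Finset.mem_union, Finset.mem_filter, Finset.mem_Ico] at hk ⊢
    omega
  calc ∑ k ∈ Finset.Ico 1 N, a k * D k
      ≤ ∑ k ∈ (Finset.Ico 1 (2 * m₀)).filter (· < N) ∪ Finset.Ico (2 * m₀) N, a k * D k :=
        Finset.sum_le_sum_of_subset_of_nonneg hsplit fun i _ _ => hnD i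
    _ ≤ _ := by
        refine le_of_le_of_eq (le_add_of_nonneg_right ?_) (Finset.sum_union_inter)
        exact Finset.sum_nonneg fun i _ => hnD i
    _ ≤ 2 * B * m₀ * S + 2 * (L * (2 * c) ^ 2) * S := add_le_add hsmall hlarge
    _ = _ := by ring

/-- Subadditivity compares the values at arguments with ratio `(i+1)/(m+1) ≤ b`, so `w` may be moved
between comparable indices. -/
lemma IsModulus.rpow_le {w : ℝ → ℝ} (hw : IsModulus w) {q b : ℝ} (hq : 0 < q) (hb : 1 ≤ b)
    {m i : ℕ} (hi : (i : ℝ) ≤ b * m) :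
    w (Real.pi / (m + 1)) ^ q ≤ (b + 1) ^ q * w (Real.pi / (i + 1)) ^ q := by
  have hpi := Real.pi_pos
  have hv : 0 ≤ w (Real.pi / (i + 1)) := hw.nonneg (by positivity)
  rw [← Real.mul_rpow (by linarith) hv]
  refine Real.rpow_le_rpow (hw.nonneg (by positivity)) ?_ hq.le
  refine (hw.le_mul (by positivity) (by positivity : 0 < Real.pi / (i + 1))).trans
    (mul_le_mul_of_nonneg_right ?_ hv)
  have e : Real.pi / (m + 1) / (Real.pi / (i + 1)) = (i + 1) / (m + 1) := by field_simp
  rw [e, add_le_add_iff_right, div_le_iff₀ (by positivity)]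
  linarith

/-! ### Assembling the estimate for one row -/

/-- The estimate of the `q`-th powers for one row of the matrix. -/
theorem exists_tsum_rpow_le {α : ℝ} (hα : 0 < α) {p : ℝ≥0∞} (hp : 1 < p) {q : ℝ} (hq : 0 < q)
    {c : ℝ} (hc : 1 < c) (C K₀ : ℝ≥0) :
    ∃ K : ℝ≥0, ∀ (x : ℝ) (w : ℝ → ℝ) (f : ℝ → ℂ), IsModulus w → OmegaW α p x w C f →
      ∀ a : ℕ → ℝ, (∀ k, 0 ≤ a k) → IsGM c K₀ a → ∀ E : ℕ → ℝ≥0∞, bestApprox p 0 f ≤ E 0 →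
        ∑' k : ℕ, ENNReal.ofReal (a k) * ‖partialSum f (α * k / 2) x - f x‖ₑ ^ q ≤
          K * ∑' k : ℕ, ENNReal.ofReal (a k) *
            (ENNReal.ofReal (w (Real.pi / (k + 1))) + E k) ^ q := by
  obtain ⟨B, hB0, hB⟩ := exists_block_rpow_le hα hp hq C
  have hpi := Real.pi_pos
  set A : ℝ := 2 * B * ⌈c⌉₊ + 2 * ((1 + 2 * c * K₀) * B * (2 * c + 1) ^ q * (2 * c) ^ 2) with hA
  have hA0 : 0 ≤ A := by positivity
  refine ⟨(C + 5) ^ q + A.toNNReal, fun x w f hw hf a ha0 ha E hE => ?_⟩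
  set D : ℕ → ℝ≥0∞ := fun k => ENNReal.ofReal (a k) * ‖partialSum f (α * k / 2) x - f x‖ₑ ^ q
    with hD
  set V : ℕ → ℝ≥0∞ := fun k => ENNReal.ofReal (a k) *
    (ENNReal.ofReal (w (Real.pi / (k + 1))) + E k) ^ q with hV
  have hwk : ∀ k : ℕ, 0 ≤ w (Real.pi / (k + 1)) := fun k => hw.nonneg (by positivity)
  -- The only term that needs the errors `E`, and only `E 0`. For `k ≥ 1` they are simply added on
  -- the right at the end.
  have hzero : D 0 ≤ ((C + 5 : ℝ≥0) : ℝ≥0∞) ^ q * ∑' k, V k := by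
    have h := (hf.enorm_partialSum_zero_sub_le hp.le hw).trans
      (mul_le_mul_right (add_le_add_right hE (ENNReal.ofReal (w Real.pi))) _)
    calc D 0 ≤ ENNReal.ofReal (a 0) * (((C + 5 : ℝ≥0) : ℝ≥0∞) *
          (ENNReal.ofReal (w Real.pi) + E 0)) ^ q := by
          simp only [hD, Nat.cast_zero, mul_zero, zero_div]
          gcongr
      _ = ((C + 5 : ℝ≥0) : ℝ≥0∞) ^ q * V 0 := by
          rw [ENNReal.mul_rpow_of_nonneg _ _ hq.le]
          simp only [hV, Nat.cast_zero, zero_add, div_one]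
          ring
      _ ≤ _ := by
          gcongr
          exact ENNReal.le_tsum 0
  have hpos : ∀ N, ∑ k ∈ Finset.Ico 1 N, D k ≤ ENNReal.ofReal A * ∑' k, V k := by
    intro N
    have h := ha.sum_mul_le hc ha0 (D := fun k => ‖partialSum f (α * k / 2) x - f x‖ ^ q)
      (v := fun k => w (Real.pi / (k + 1)) ^ q) (fun k => by positivity)
      (fun k => Real.rpow_nonneg (hwk k) q) hB0 (by positivity : 0 ≤ (2 * c + 1) ^ q)
      (fun m hm => hB x w f hw hf m hm) (fun m i hi => hw.rpow_le hq (by linarith) hi) N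
    have e1 : ∑ k ∈ Finset.Ico 1 N, D k = ENNReal.ofReal (∑ k ∈ Finset.Ico 1 N,
        a k * ‖partialSum f (α * k / 2) x - f x‖ ^ q) := by
      rw [ENNReal.ofReal_sum_of_nonneg fun k _ => mul_nonneg (ha0 k) (by positivity)]
      refine Finset.sum_congr rfl fun k _ => ?_
      rw [ENNReal.ofReal_mul (ha0 k), ← ENNReal.ofReal_rpow_of_nonneg (norm_nonneg _) hq.le,
        ofReal_norm]
    rw [e1]
    refine (ENNReal.ofReal_le_ofReal h).trans ?_
    rw [ENNReal.ofReal_mul hA0]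
    gcongr
    rw [ENNReal.ofReal_sum_of_nonneg
      fun k _ => mul_nonneg (ha0 k) (Real.rpow_nonneg (hwk k) q)]
    refine le_trans (Finset.sum_le_sum fun k _ => ?_) (ENNReal.sum_le_tsum _)
    rw [ENNReal.ofReal_mul (ha0 k), ← ENNReal.ofReal_rpow_of_nonneg (hwk k) hq.le]
    simp only [hV]
    gcongr
    exact le_self_add
  rw [ENNReal.tsum_eq_iSup_nat]
  refine iSup_le fun N => ?_
  have hsub : Finset.range N ⊆ {0} ∪ Finset.Ico 1 N := fun k hk => by
    simp only [Finset.mem_union, Finset.mem_singleton, Finset.mem_Ico, Finset.mem_range] at hk ⊢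
    omega
  calc ∑ k ∈ Finset.range N, D k ≤ ∑ k ∈ {0} ∪ Finset.Ico 1 N, D k :=
        Finset.sum_le_sum_of_subset hsub
    _ ≤ ∑ k ∈ {0}, D k + ∑ k ∈ Finset.Ico 1 N, D k := by
        rw [← Finset.sum_union_inter]
        exact le_self_add
    _ ≤ ((C + 5 : ℝ≥0) : ℝ≥0∞) ^ q * ∑' k, V k + ENNReal.ofReal A * ∑' k, V k := by
        rw [Finset.sum_singleton]
        exact add_le_add hzero (hpos N)
    _ = _ := by
        rw [← add_mul, ENNReal.coe_add ((C + 5) ^ q), ENNReal.coe_rpow_of_nonneg _ hq.le]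
        rfl

end StrongApprox

end

theorem theorem5 (α : ℝ) (hα : 0 < α) (p : ℝ≥0∞) (hp : 1 < p) (q : ℝ) (hq : 0 < q)
    (c : ℝ) (hc : 1 < c) (C K₀ : ℝ≥0) :
    ∃ K : ℝ≥0, ∀ (x : ℝ) (w : ℝ → ℝ), StrongApprox.IsModulus w →
      ∀ f : ℝ → ℂ, StrongApprox.OmegaW α p x w C f →
      ∀ a : ℕ → ℕ → ℝ, (∀ n k, 0 ≤ a n k) → (∀ n, HasSum (a n) 1) →
        (∀ n, StrongApprox.IsGM c K₀ (a n)) →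
        Tendsto (fun n => a n 0) atTop (𝓝 0) →
      ∀ n : ℕ,
        StrongApprox.strongMean q (a n) (fun k => α * k / 2) f x ≤
          K * (∑' k : ℕ, ENNReal.ofReal (a n k) *
            (ENNReal.ofReal (w (Real.pi / (k + 1))) +
              StrongApprox.bestApprox p (α * k / (2 : ℝ) ^ (1 + c)) f) ^ q) ^ (1 / q) := by
  obtain ⟨K, hK⟩ := StrongApprox.exists_tsum_rpow_le hα hp hq hc C K₀
  refine ⟨K ^ (1 / q), fun x w hw f hf a ha0 _ ha _ n => ?_⟩
  -- At `k = 0` the type `αk / 2^(1+c)` is `0`, which is all that is required of the approximation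
  -- errors.
  have h := hK x w f hw hf (a n) (ha0 n) (ha n)
    (fun k => StrongApprox.bestApprox p (α * k / (2 : ℝ) ^ (1 + c)) f) (by simp)
  have hq' : 0 ≤ 1 / q := by positivity
  rw [StrongApprox.strongMean, ENNReal.coe_rpow_of_nonneg _ hq',
    ← ENNReal.mul_rpow_of_nonneg _ _ hq']
  exact ENNReal.rpow_le_rpow h hq'
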